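/- Fix $q\in[2,\infty]$ and $p\in[1,\infty)$. For $n\ge 1$ let $B_q^n=\{x\in\mathbb R^n: |x_1|^q+\dots+|x_n|^q\le 1\}$ if $q<\infty$ and $B_\infty^n=[-1,1]^n$. For a real random variable $S$ and $r>0$ write $\|S\|_r=(\mathbb E|S|^r)^{1/r}$. Let $$\gamma_p=\sqrt2\left(\frac{\Gamma\left(\frac{p+1}{2}\right)}{\sqrt\pi}\right)^{1/p}$$ (the $p$-th moment $\|G\|_p$ of a standard Gaussian random variable $G$), and define $$A_p=\begin{cases}\gamma_p,& p\in[1,2)\\[2pt] \dfrac{3^{1/2}}{(p+1)^{1/p}},& p\in[2,\infty)\end{cases}\qquad\text{and}\qquad B_p=\begin{cases}\dfrac{3^{1/2}}{(p+1)^{1/p}},& p\in[1,2)\\[2pt] \gamma_p,& p\in[2,\infty).\end{cases}$$ Then for every $n\ge1$, every random vector $X=(X_1,\dots,X_n)$ uniformly distributed on $B_q^n$ and all real numbers $a_1,\dots,a_n$, $$A_p\Big\|\sum_{i=1}^n a_iX_i\Big\|_2\le\Big\|\sum_{i=1}^n a_iX_i\Big\|_p\le B_p\Big\|\sum_{i=1}^n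 a_iX_i\Big\|_2 .$$ These constants are sharp for each fixed $q$ and $p$: $A_p$ is the largest and $B_p$ the smallest real constant for which the respective inequality holds simultaneously for all $n\ge1$, all $X$ uniformly distributed on $B_q^n$ and all real $a_1,\dots,a_n$. -/

import Mathlib

open MeasureTheory
open scoped ENNReal

universe u

noncomputable section

namespace Khintchine

/-- The unit ball of `ℓ_q^n`: the points with `∑ |x i| ^ q ≤ 1` when `q < ∞`, and the cube
`[-1, 1]^n` when `q = ∞`. -/
def unitBall (q : ℝ≥0∞) (n : ℕ) : Set (Fin n → ℝ) :=
  if q = ∞ then {x | ∀ i, |x i| ≤ 1} else {x | ∑ i, |x i| ^ q.toReal ≤ 1}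

/-- `X` is uniformly distributed on the unit ball of `ℓ_q^n`: its law is the normalised restriction
of Lebesgue measure to the ball. -/
def IsUniformOnBall {Ω : Type*} [MeasurableSpace Ω] (q : ℝ≥0∞) (n : ℕ)
    (P : Measure Ω) (X : Ω → Fin n → ℝ) : Prop :=
  pdf.IsUniform X (unitBall q n) P volume

/-- `‖S‖_r = (𝔼 |S| ^ r) ^ (1 / r)`. It is used here only for linear forms of a uniform vector on a
ball, which are almost surely bounded, so the expectation is that of an integrable function. -/
def momentNorm {Ω : Type*} [MeasurableSpace Ω] (P : Measure Ω) (r : ℝ) (S : Ω → ℝ) : ℝ :=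
  (∫ ω, |S ω| ^ r ∂P) ^ (1 / r)

/-- The `p`-th moment `(𝔼 |G| ^ p) ^ (1 / p)` of a standard Gaussian variable `G`. -/
def gammaConst (p : ℝ) : ℝ :=
  √2 * (Real.Gamma ((p + 1) / 2) / √Real.pi) ^ (1 / p)

def edgeConst (p : ℝ) : ℝ :=
  (3 : ℝ) ^ (1 / 2 : ℝ) / (p + 1) ^ (1 / p)

def lowerConst (p : ℝ) : ℝ := if p < 2 then gammaConst p else edgeConst p

def upperConst (p : ℝ) : ℝ := if p < 2 then edgeConst p else gammaConst p

/-- `A ‖∑ a i X i‖_2 ≤ ‖∑ a i X i‖_p` in every dimension `n ≥ 1`, for every random vector `X` that is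
uniform on the unit ball of `ℓ_q^n` and all real coefficients. -/
def IsLowerBound (q : ℝ≥0∞) (p A : ℝ) : Prop :=
  ∀ n : ℕ, 1 ≤ n → ∀ (Ω : Type u) [MeasurableSpace Ω] (P : Measure Ω) [IsProbabilityMeasure P]
    (X : Ω → Fin n → ℝ), IsUniformOnBall q n P X → ∀ a : Fin n → ℝ,
      A * momentNorm P 2 (fun ω => ∑ i, a i * X ω i)
        ≤ momentNorm P p (fun ω => ∑ i, a i * X ω i)

/-- `‖∑ a i X i‖_p ≤ B ‖∑ a i X i‖_2` in every dimension `n ≥ 1`, for every random vector `X` that is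
uniform on the unit ball of `ℓ_q^n` and all real coefficients. -/
def IsUpperBound (q : ℝ≥0∞) (p B : ℝ) : Prop :=
  ∀ n : ℕ, 1 ≤ n → ∀ (Ω : Type u) [MeasurableSpace Ω] (P : Measure Ω) [IsProbabilityMeasure P]
    (X : Ω → Fin n → ℝ), IsUniformOnBall q n P X → ∀ a : Fin n → ℝ,
      momentNorm P p (fun ω => ∑ i, a i * X ω i)
        ≤ B * momentNorm P 2 (fun ω => ∑ i, a i * X ω i)

end Khintchine

end

namespace Khintchine

open Set

/-! ### Even functions that decrease on the half-line, and symmetric unimodal laws -/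

/-! The two constants come from two unrelated comparisons. Nearly every inequality carries a factor
`p - 2`, whose sign turns convexity into concavity, so that `p < 2` and `p ≥ 2` share one proof.

Constant `edgeConst`. By Prékopa–Leindler a nonzero linear form of a uniform vector on a symmetric
convex body has an even log-concave density. Such a density decreases on the half-line, so the law
is a mixture of uniform laws on intervals `[-b, b]`. For one such law `3 𝔼 s² = b²` and `(p + 1) 𝔼
|s|^p = b^p`, and the tangent inequality for `u ^ (p / 2)`, averaged over the mixture, compares the
two moments (`IsUnimodal.moment_le`). Dimension one gives equality.

Constant `gammaConst`. Let `Y i` be independent with density proportional to `exp (-|x|^q)`, or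
uniform on `[-1, 1]` if `q = ∞`. Radial integration shows that the `r`-th moments of `∑ a i Y i` and
`∑ a i X i` differ by a factor depending only on `n` and `r`, a quotient of Gamma values
(`lintegral_exp_neg_gauge_mul`). Log-convexity of Gamma orders these factors in the favourable
direction, so the inequality for `Y` implies the one for `X`.

For independent summands, each `Y i` is exchanged for a Gaussian of the same variance, one at a time
(`IsUnimodal.addLaw_le`, `addLaw_sumLaw_le`). The remaining sum is symmetric unimodal, so only a
uniform `U` need be tested in its place, and `𝔼 |x + U|^p` is convex (concave if `p ≤ 2`) in `x²`
(`convexOn_integral_abs_add_sqrt`). Moreover `Y i ^ 2` lies below the squared Gaussian in the convex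
order: the log-ratio of the densities is convex in `x²` when `2 ≤ q < ∞`, which gives the required
pattern of crossings (`integral_convex_sq_le`).

For sharpness, equal coefficients and `n → ∞` give the Gaussian constant, by the central limit
theorem with convergence of moments and because the multipliers `m n p / m n 2 ^ (p / 2)` tend to 1.
-/

theorem superlevel_ae_eq_Ioo {f : ℝ → ℝ} (hf0 : ∀ x, 0 ≤ f x) (heven : ∀ x, f (-x) = f x)
    (hanti : AntitoneOn f (Ici 0)) (hfi : Integrable f) {τ : ℝ} (hτ : 0 < τ) :
    {x | τ < f x} =ᵐ[volume] (∅ : Set ℝ) ∨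
      ∃ b, 0 < b ∧ {x | τ < f x} =ᵐ[volume] Ioc (-b) b := by
  have habs : ∀ x, f |x| = f x := fun x => by
    rcases abs_choice x with h | h <;> rw [h]
    exact heven x
  have hmono : ∀ x y, |x| ≤ |y| → f y ≤ f x := fun x y hxy => by
    rw [← habs x, ← habs y]
    exact hanti (abs_nonneg x) (abs_nonneg y) hxy
  set A := {x | τ < f x} with hA
  have hfin : volume A < ∞ := by
    have := hfi.measure_norm_ge_lt_top hτ
    refine lt_of_le_of_lt (measure_mono ?_) this
    intro x hx
    simpa [Real.norm_eq_abs, abs_of_nonneg (hf0 x)] using (le_of_lt hx)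
  -- An unbounded superlevel set would be the whole line by monotonicity in `|x|`, contradicting its
  -- finite measure.
  have hbdd : BddAbove A := by
    by_contra hcon
    have huniv : A = univ := by
      ext x
      simp only [mem_univ, iff_true]
      obtain ⟨y, hy, hxy⟩ := not_bddAbove_iff.1 hcon |x|
      exact lt_of_lt_of_le hy (hmono x y (hxy.le.trans (le_abs_self y)))
    rw [huniv] at hfin
    simp at hfin
  rcases A.eq_empty_or_nonempty with hne | hne
  · left; rw [hne]; exact Filter.EventuallyEq.rfl
  set b := sSup A with hb
  have hsub : A ⊆ Icc (-b) b := by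
    intro x hx
    refine ⟨?_, le_csSup hbdd hx⟩
    have : -x ∈ A := by simpa [hA, heven] using hx
    linarith [le_csSup hbdd this]
  have hsup : Ioo (-b) b ⊆ A := by
    intro x hx
    have hxb : |x| < b := abs_lt.2 hx
    obtain ⟨y, hy, hxy⟩ := exists_lt_of_lt_csSup hne hxb
    exact lt_of_lt_of_le hy (hmono x y (hxy.le.trans (le_abs_self y)))
  have hae : A =ᵐ[volume] Ioc (-b) b := by
    have h1 : (Ioo (-b) b : Set ℝ) =ᵐ[volume] Icc (-b) b := Ioo_ae_eq_Icc
    have h2 : (Ioc (-b) b : Set ℝ) =ᵐ[volume] Icc (-b) b := Ioc_ae_eq_Icc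
    refine Filter.EventuallyEq.trans ?_ h2.symm
    refine Filter.EventuallyLE.antisymm (LE.le.eventuallyLE hsub) ?_
    exact h1.symm.le.trans (LE.le.eventuallyLE hsup)
  -- The supremum is 0 when the superlevel set is `{0}`; being null, it falls under the empty
  -- alternative.
  by_cases hb0 : 0 < b
  · right; exact ⟨b, hb0, hae⟩
  · left
    refine hae.trans ?_
    rw [Ioc_eq_empty (by linarith)]
    exact Filter.EventuallyEq.rfl

/-- An even density which decreases on the half-line is a mixture of uniform densities on
symmetric intervals. -/
theorem integral_mul_nonneg_of_even_antitone {f h : ℝ → ℝ} (hf0 : ∀ x, 0 ≤ f x)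
    (heven : ∀ x, f (-x) = f x) (hanti : AntitoneOn f (Ici 0)) (hfm : Measurable f)
    (hfi : Integrable f) (hh : Measurable h) (hfh : Integrable fun x => f x * h x)
    (hsym : ∀ b, 0 < b → 0 ≤ ∫ s in -b..b, h s) : 0 ≤ ∫ x, f x * h x := by
  -- Layer cake: `f x` is the length of `{τ > 0 | τ < f x}`. Fubini then leaves, for each height
  -- `τ`, the integral of `h` over a superlevel set, which is a symmetric interval up to a null set.
  set S : Set (ℝ × ℝ) := {z | z.2 < f z.1} with hS
  have hSm : MeasurableSet S := measurableSet_lt measurable_snd (hfm.comp measurable_fst)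
  set F : ℝ × ℝ → ℝ := S.indicator fun z => h z.1 with hF
  have hFm : Measurable F := (hh.comp measurable_fst).indicator hSm
  have hFx : ∀ x, (fun τ => F (x, τ)) = (Iio (f x)).indicator fun _ => h x := by
    intro x; ext τ; simp [hF, hS, indicator]
  have hmeas : ∀ x, (volume.restrict (Ioi (0 : ℝ))) (Iio (f x)) = ENNReal.ofReal (f x) := by
    intro x
    rw [Measure.restrict_apply measurableSet_Iio, inter_comm, Ioi_inter_Iio, Real.volume_Ioo,
      sub_zero]
  have hint : ∀ x, ∫ τ in Ioi (0 : ℝ), F (x, τ) = f x * h x := by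
    intro x
    rw [hFx, integral_indicator measurableSet_Iio, setIntegral_const, measureReal_def, hmeas,
      ENNReal.toReal_ofReal (hf0 x), smul_eq_mul]
  have hFi : Integrable F (volume.prod (volume.restrict (Ioi 0))) := by
    rw [integrable_prod_iff hFm.aestronglyMeasurable]
    constructor
    · refine Filter.Eventually.of_forall fun x => ?_
      simp only [hFx]
      rw [integrable_indicator_iff measurableSet_Iio]
      refine integrableOn_const ?_
      rw [hmeas]; exact ENNReal.ofReal_ne_top
    · refine hfh.norm.congr (Filter.Eventually.of_forall fun x => ?_)
      have : (fun τ => ‖F (x, τ)‖) = (Iio (f x)).indicator fun _ => ‖h x‖ := by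
        ext τ; simp only [congrFun (hFx x) τ, norm_indicator_eq_indicator_norm]
      simp only [this]
      rw [integral_indicator measurableSet_Iio, setIntegral_const, measureReal_def, hmeas,
        ENNReal.toReal_ofReal (hf0 x), smul_eq_mul, norm_mul, Real.norm_of_nonneg (hf0 x)]
  calc (0 : ℝ) ≤ ∫ τ in Ioi (0 : ℝ), ∫ x, F (x, τ) := by
        refine setIntegral_nonneg measurableSet_Ioi fun τ hτ => ?_
        have h1 : (fun x => F (x, τ)) = {x | τ < f x}.indicator h := by
          ext x; simp [hF, hS, indicator]
        rw [h1, integral_indicator (measurableSet_lt measurable_const hfm)]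
        rcases superlevel_ae_eq_Ioo hf0 heven hanti hfi hτ with h2 | ⟨b, hb, h2⟩
        · rw [setIntegral_congr_set h2]; simp
        · rw [setIntegral_congr_set h2, ← intervalIntegral.integral_of_le (by linarith)]
          exact hsym b hb
    _ = ∫ x, ∫ τ in Ioi (0 : ℝ), F (x, τ) := (integral_integral_swap (f := fun x τ => F (x, τ)) hFi).symm
    _ = ∫ x, f x * h x := by simp only [hint]

/-- Test functions which integrate to something nonnegative against every symmetric uniform law. -/
structure IsTest (r : ℝ) (h : ℝ → ℝ) : Prop where
  meas : Measurable h
  growth : ∃ M, ∀ s, |h s| ≤ M * (1 + |s|) ^ r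
  -- The degenerate interval. This does not follow from `sym`, as `h` is only measurable, and it
  -- admits the Dirac mass at 0 from which the exchange of summands starts.
  zero : 0 ≤ h 0
  sym : ∀ b, 0 < b → 0 ≤ ∫ s in -b..b, h s

/-- Laws with a finite moment of order `r` which are limits of mixtures of symmetric uniform
laws. -/
structure IsUnimodal (r : ℝ) (κ : Measure ℝ) : Prop where
  integrable : Integrable (fun s => (1 + |s|) ^ r) κ
  -- Defining the class by duality reduces its stability under convolution to the stability of test
  -- functions under averaging.
  nonneg : ∀ h, IsTest r h → 0 ≤ ∫ s, h s ∂κ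

/-- Even probability densities, decreasing on the half-line, with a finite moment of order `r`. -/
structure IsUnimodalDensity (r : ℝ) (w : ℝ → ℝ) : Prop where
  nonneg : ∀ x, 0 ≤ w x
  even : ∀ x, w (-x) = w x
  anti : AntitoneOn w (Ici 0)
  meas : Measurable w
  integrable : Integrable w
  integral_eq : ∫ x, w x = 1
  moment : Integrable fun x => w x * (1 + |x|) ^ r

/-- The law with density `w`. -/
noncomputable def densityLaw (w : ℝ → ℝ) : Measure ℝ := volume.withDensity fun x => ENNReal.ofReal (w x)

theorem integral_densityLaw {w : ℝ → ℝ} (hw : ∀ x, 0 ≤ w x) (hm : Measurable w) (f : ℝ → ℝ) :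
    ∫ x, f x ∂densityLaw w = ∫ x, w x * f x := by
  rw [densityLaw, integral_withDensity_eq_integral_toReal_smul (by fun_prop) (by simp)]
  simp [ENNReal.toReal_ofReal (hw _)]

theorem integrable_densityLaw {w : ℝ → ℝ} (hw : ∀ x, 0 ≤ w x) (hm : Measurable w) {f : ℝ → ℝ} :
    Integrable f (densityLaw w) ↔ Integrable fun x => w x * f x := by
  rw [densityLaw, integrable_withDensity_iff_integrable_smul' (by fun_prop) (by simp)]
  simp [ENNReal.toReal_ofReal (hw _)]

theorem IsUnimodalDensity.isProbabilityMeasure {r : ℝ} {w : ℝ → ℝ} (hw : IsUnimodalDensity r w) :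
    IsProbabilityMeasure (densityLaw w) := by
  constructor
  rw [densityLaw, withDensity_apply _ MeasurableSet.univ, setLIntegral_univ,
    ← ofReal_integral_eq_lintegral_ofReal hw.integrable (Filter.Eventually.of_forall hw.nonneg),
    hw.integral_eq, ENNReal.ofReal_one]

theorem measurable_weight (r : ℝ) : Measurable fun s : ℝ => (1 + |s|) ^ r := by fun_prop

theorem IsTest.integrable {r : ℝ} {h : ℝ → ℝ} (hh : IsTest r h) {κ : Measure ℝ}
    (hκ : Integrable (fun s => (1 + |s|) ^ r) κ) : Integrable h κ := by
  obtain ⟨M, hM⟩ := hh.growth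
  exact (hκ.const_mul M).mono' hh.meas.aestronglyMeasurable (Filter.Eventually.of_forall hM)

theorem intervalIntegrable_of_growth {r : ℝ} (hr : 0 ≤ r) {h : ℝ → ℝ} (hm : Measurable h)
    (hg : ∃ M, ∀ s, |h s| ≤ M * (1 + |s|) ^ r) (a b : ℝ) : IntervalIntegrable h volume a b := by
  obtain ⟨M, hM⟩ := hg
  have : Continuous fun s : ℝ => M * (1 + |s|) ^ r := by
    refine continuous_const.mul (Continuous.rpow_const (by fun_prop) fun s => Or.inr hr)
  exact (this.intervalIntegrable a b).mono_fun' hm.aestronglyMeasurable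
    (Filter.Eventually.of_forall hM)

theorem weight_add_le {r : ℝ} (hr : 0 ≤ r) (s a x : ℝ) :
    (1 + |s + a * x|) ^ r ≤ (1 + |a|) ^ r * ((1 + |s|) ^ r * (1 + |x|) ^ r) := by
  rw [← Real.mul_rpow (by positivity) (by positivity), ← Real.mul_rpow (by positivity)
    (by positivity)]
  refine Real.rpow_le_rpow (by positivity) ?_ hr
  have := abs_add_le s (a * x)
  rw [abs_mul] at this
  have ha := abs_nonneg a
  have hs := abs_nonneg s
  have hx := abs_nonneg x
  nlinarith [mul_nonneg ha hs, mul_nonneg ha hx, mul_nonneg hs hx, mul_nonneg (mul_nonneg ha hs) hx]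

/-- Sums of two independent symmetric uniform variables are symmetric unimodal. -/
theorem integral_integral_add_nonneg {h : ℝ → ℝ} (hi : ∀ a b, IntervalIntegrable h volume a b)
    (hsym : ∀ b, 0 < b → 0 ≤ ∫ s in -b..b, h s) {b c : ℝ} (hb : 0 ≤ b) (hc : 0 ≤ c) :
    0 ≤ ∫ x in -c..c, ∫ s in -b..b, h (s + x) := by
  set H : ℝ → ℝ := fun t => ∫ s in (0 : ℝ)..t, h s with hH
  have hHc : Continuous H := intervalIntegral.continuous_primitive hi 0
  -- `K t` is the integral of `h` over `[-t, t]`: an odd function of `t`, nonnegative for `t ≥ 0`.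
  -- The double integral equals that of `K` over `[b - c, b + c]`; if `c > b`, the part over `[b -
  -- c, c - b]` cancels by oddness.
  set K : ℝ → ℝ := fun t => H t - H (-t) with hK
  have hKc : Continuous K := by fun_prop
  have hKi : ∀ a b, IntervalIntegrable K volume a b := fun a b => hKc.intervalIntegrable a b
  have hKnn : ∀ t, 0 ≤ t → 0 ≤ K t := by
    intro t ht
    simp only [hK, hH]
    rw [intervalIntegral.integral_interval_sub_left (hi _ _) (hi _ _)]
    rcases ht.eq_or_lt with rfl | ht
    · simp
    · exact hsym t ht
  have hinner : ∀ x, ∫ s in -b..b, h (s + x) = H (x + b) - H (x - b) := by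
    intro x
    simp only [hH]
    rw [intervalIntegral.integral_comp_add_right,
      intervalIntegral.integral_interval_sub_left (hi _ _) (hi _ _)]
    congr 1 <;> ring
  have hflip : ∫ x in -c..c, H (x - b) = ∫ x in -c..c, H (-(x + b)) := by
    have := intervalIntegral.integral_comp_neg (a := -c) (b := c) fun x => H (x - b)
    rw [neg_neg] at this
    rw [← this]
    congr 1; ext x; ring_nf
  have hkey : ∫ x in -c..c, ∫ s in -b..b, h (s + x) = ∫ x in (b - c)..(b + c), K x := by
    simp only [hinner]
    rw [intervalIntegral.integral_sub, hflip, ← intervalIntegral.integral_sub,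
      show b - c = -c + b by ring, show b + c = c + b by ring,
      ← intervalIntegral.integral_comp_add_right]
    all_goals exact Continuous.intervalIntegrable (by fun_prop) _ _
  rw [hkey]
  rcases le_total c b with hcb | hcb
  · exact intervalIntegral.integral_nonneg (by linarith) fun x hx => hKnn x (by linarith [hx.1])
  · have hodd : ∫ x in (b - c)..(c - b), K x = 0 := by
      have := intervalIntegral.integral_comp_neg (a := b - c) (b := c - b) K
      have h2 : ∀ x, K (-x) = -K x := fun x => by simp [hK]
      simp only [h2, neg_sub, intervalIntegral.integral_neg] at this
      linarith
    rw [← intervalIntegral.integral_add_adjacent_intervals (hKi (b - c) (c - b)) (hKi _ _), hodd,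
      zero_add]
    exact intervalIntegral.integral_nonneg (by linarith) fun x hx => hKnn x (by linarith [hx.1])

theorem IsTest.comp_mul {r : ℝ} (hr : 0 ≤ r) {h : ℝ → ℝ} (hh : IsTest r h) (a : ℝ) :
    IsTest r fun x => h (a * x) := by
  obtain ⟨M, hM⟩ := hh.growth
  have hM0 : 0 ≤ M := by simpa using (abs_nonneg _).trans (hM 0)
  have key : ∀ a, 0 < a → ∀ b, 0 < b → 0 ≤ ∫ s in -b..b, h (a * s) := by
    intro a ha b hb
    rw [intervalIntegral.integral_comp_mul_left _ ha.ne', mul_neg, smul_eq_mul]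
    exact mul_nonneg (inv_nonneg.2 ha.le) (hh.sym _ (by positivity))
  refine ⟨hh.meas.comp (by fun_prop), ⟨M * (1 + |a|) ^ r, fun s => ?_⟩, by simpa using hh.zero, ?_⟩
  · refine (hM _).trans ?_
    rw [mul_assoc]
    have := weight_add_le hr 0 a s
    simp only [zero_add, abs_zero, add_zero, Real.one_rpow, one_mul] at this
    exact mul_le_mul_of_nonneg_left this hM0
  · intro b hb
    rcases lt_trichotomy a 0 with ha | rfl | ha
    · have := intervalIntegral.integral_comp_neg (a := -b) (b := b) fun s => h (a * s)
      rw [neg_neg] at this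
      rw [← this]
      simpa using key (-a) (by linarith) b hb
    · simp only [zero_mul, intervalIntegral.integral_const, smul_eq_mul]
      exact mul_nonneg (by linarith) hh.zero
    · exact key a ha b hb

/-- Tested on another symmetric interval, the averaged function becomes a double integral over two
symmetric intervals, which is nonnegative because a sum of two symmetric uniform variables is
unimodal. -/
theorem IsTest.integral_interval {r : ℝ} (hr : 0 ≤ r) {h : ℝ → ℝ} (hh : IsTest r h) {b : ℝ}
    (hb : 0 < b) (a : ℝ) : IsTest r fun x => ∫ s in -b..b, h (s + a * x) := by
  suffices h1 : IsTest r fun x => ∫ s in -b..b, h (s + x) from h1.comp_mul hr a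
  obtain ⟨M, hM⟩ := hh.growth
  have hM0 : 0 ≤ M := by simpa using (abs_nonneg _).trans (hM 0)
  refine ⟨?_, ⟨(M * 2 ^ r * (1 + b) ^ r) * (2 * b), fun x => ?_⟩, ?_, fun c hc => ?_⟩
  · simp only [intervalIntegral.integral_of_le (show -b ≤ b by linarith)]
    refine StronglyMeasurable.measurable (StronglyMeasurable.integral_prod_right
      (f := fun x s => h (s + x)) ?_)
    exact (hh.meas.comp (by fun_prop)).stronglyMeasurable
  · have : ∀ s ∈ uIoc (-b) b, ‖h (s + x)‖ ≤ M * 2 ^ r * (1 + b) ^ r * (1 + |x|) ^ r := by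
      intro s hs
      rw [uIoc_of_le (by linarith)] at hs
      refine (hM _).trans ?_
      have h1 := weight_add_le hr s 1 x
      have h2 : (1 + |s|) ^ r ≤ (1 + b) ^ r :=
        Real.rpow_le_rpow (by positivity) (by linarith [abs_le.2 ⟨hs.1.le, hs.2⟩]) hr
      rw [one_mul, abs_one, one_add_one_eq_two] at h1
      calc M * (1 + |s + x|) ^ r ≤ M * (2 ^ r * ((1 + |s|) ^ r * (1 + |x|) ^ r)) := by gcongr
        _ ≤ M * (2 ^ r * ((1 + b) ^ r * (1 + |x|) ^ r)) := by gcongr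
        _ = _ := by ring
    refine (intervalIntegral.norm_integral_le_of_norm_le_const this).trans (le_of_eq ?_)
    rw [show |b - -b| = 2 * b by rw [abs_of_pos (by linarith)]; ring]
    ring
  · simpa using hh.sym b hb
  · exact integral_integral_add_nonneg (intervalIntegrable_of_growth hr hh.meas hh.growth) hh.sym
      hb.le hc.le

theorem IsUnimodalDensity.integral_nonneg {r : ℝ} {w : ℝ → ℝ} (hw : IsUnimodalDensity r w)
    {h : ℝ → ℝ} (hh : IsTest r h) : 0 ≤ ∫ x, h x ∂densityLaw w := by
  have hi : Integrable h (densityLaw w) :=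
    hh.integrable ((integrable_densityLaw hw.nonneg hw.meas).2 hw.moment)
  rw [integral_densityLaw hw.nonneg hw.meas]
  exact integral_mul_nonneg_of_even_antitone hw.nonneg hw.even hw.anti hw.meas hw.integrable
    hh.meas ((integrable_densityLaw hw.nonneg hw.meas).1 hi) hh.sym

theorem IsUnimodalDensity.integrable_law {r : ℝ} {w : ℝ → ℝ} (hw : IsUnimodalDensity r w) :
    Integrable (fun x => (1 + |x|) ^ r) (densityLaw w) :=
  (integrable_densityLaw hw.nonneg hw.meas).2 hw.moment

theorem isUnimodal_dirac (r : ℝ) : IsUnimodal r (Measure.dirac 0) := by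
  refine ⟨integrable_dirac (by simp), fun h hh => ?_⟩
  rw [integral_dirac]; exact hh.zero

theorem abs_comp_add_mul_le {r : ℝ} (hr : 0 ≤ r) {h : ℝ → ℝ} {M : ℝ}
    (hM : ∀ s, |h s| ≤ M * (1 + |s|) ^ r) (a : ℝ) (s x : ℝ) :
    |h (s + a * x)| ≤ M * (1 + |a|) ^ r * (1 + |s|) ^ r * (1 + |x|) ^ r := by
  have hM0 : 0 ≤ M := by simpa using (abs_nonneg _).trans (hM 0)
  refine (hM _).trans ?_
  calc M * (1 + |s + a * x|) ^ r
      ≤ M * ((1 + |a|) ^ r * ((1 + |s|) ^ r * (1 + |x|) ^ r)) :=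
        mul_le_mul_of_nonneg_left (weight_add_le hr s a x) hM0
    _ = _ := by ring

theorem measurable_average {h : ℝ → ℝ} (hm : Measurable h) (a : ℝ) (μ : Measure ℝ) [SFinite μ] : Measurable fun s => ∫ x, h (s + a * x) ∂μ := by
  refine StronglyMeasurable.measurable (StronglyMeasurable.integral_prod_right
    (f := fun s x => h (s + a * x)) ?_)
  exact (hm.comp (by fun_prop)).stronglyMeasurable

theorem integrable_comp_add_mul {r : ℝ} (hr : 0 ≤ r) {h : ℝ → ℝ} (hm : Measurable h) {M : ℝ}
    (hM : ∀ s, |h s| ≤ M * (1 + |s|) ^ r) (a : ℝ) (μ : Measure ℝ)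
    (hμ : Integrable (fun x => (1 + |x|) ^ r) μ) (s : ℝ) : Integrable (fun x => h (s + a * x)) μ :=
  (hμ.const_mul (M * (1 + |a|) ^ r * (1 + |s|) ^ r)).mono' (hm.comp (by fun_prop)).aestronglyMeasurable
    (Filter.Eventually.of_forall fun x => abs_comp_add_mul_le hr hM a s x)

theorem abs_average_le {r : ℝ} (hr : 0 ≤ r) {h : ℝ → ℝ} {M : ℝ}
    (hM : ∀ s, |h s| ≤ M * (1 + |s|) ^ r) (a : ℝ) (μ : Measure ℝ)
    (hμ : Integrable (fun x => (1 + |x|) ^ r) μ) (s : ℝ) :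
    |∫ x, h (s + a * x) ∂μ|
      ≤ (M * (1 + |a|) ^ r * ∫ x, (1 + |x|) ^ r ∂μ) * (1 + |s|) ^ r := by
  have h1 : ‖∫ x, h (s + a * x) ∂μ‖ ≤ ∫ x, M * (1 + |a|) ^ r * (1 + |s|) ^ r * (1 + |x|) ^ r ∂μ :=
    norm_integral_le_of_norm_le (hμ.const_mul _)
      (Filter.Eventually.of_forall fun x => abs_comp_add_mul_le hr hM a s x)
  rw [integral_const_mul] at h1
  refine h1.trans (le_of_eq ?_)
  ring

theorem integrable_prod_comp_add_mul {r : ℝ} (hr : 0 ≤ r) {h : ℝ → ℝ} (hm : Measurable h) {M : ℝ}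
    (hM : ∀ s, |h s| ≤ M * (1 + |s|) ^ r) (a : ℝ) (μ : Measure ℝ) [SFinite μ]
    (hμ : Integrable (fun x => (1 + |x|) ^ r) μ) {κ : Measure ℝ} [SFinite κ]
    (hκ : Integrable (fun s => (1 + |s|) ^ r) κ) :
    Integrable (fun z : ℝ × ℝ => h (z.1 + a * z.2)) (κ.prod μ) := by
  refine ((hκ.mul_prod hμ).const_mul (M * (1 + |a|) ^ r)).mono'
    (hm.comp (by fun_prop)).aestronglyMeasurable (Filter.Eventually.of_forall fun z => ?_)
  refine (abs_comp_add_mul_le hr hM a z.1 z.2).trans (le_of_eq (by ring))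

theorem integral_average_interval {r : ℝ} (hr : 0 ≤ r) {h : ℝ → ℝ} (hm : Measurable h) {M : ℝ}
    (hM : ∀ s, |h s| ≤ M * (1 + |s|) ^ r) (a : ℝ) (μ : Measure ℝ) [SFinite μ]
    (hμ : Integrable (fun x => (1 + |x|) ^ r) μ) {b : ℝ} (hb : 0 ≤ b) :
    ∫ s in -b..b, ∫ x, h (s + a * x) ∂μ = ∫ x, (∫ s in -b..b, h (s + a * x)) ∂μ := by
  simp only [intervalIntegral.integral_of_le (show -b ≤ b by linarith)]
  refine integral_integral_swap (f := fun s x => h (s + a * x)) ?_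
  refine integrable_prod_comp_add_mul hr hm hM a μ hμ ?_
  exact (intervalIntegrable_iff_integrableOn_Ioc_of_le (by linarith)).1
    (intervalIntegrable_of_growth hr (measurable_weight r) ⟨1, fun s => by
      rw [abs_of_nonneg (by positivity), one_mul]⟩ (-b) b)

/-- The law of `S + a Y`, for independent `S` and `Y` of laws `κ` and `μ`. -/
noncomputable def addLaw (κ μ : Measure ℝ) (a : ℝ) : Measure ℝ := (κ.prod μ).map fun z => z.1 + a * z.2

instance (κ μ : Measure ℝ) (a : ℝ) [IsProbabilityMeasure κ] [IsProbabilityMeasure μ] :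
    IsProbabilityMeasure (addLaw κ μ a) :=
  Measure.isProbabilityMeasure_map (by fun_prop)

theorem integrable_addLaw {r : ℝ} (hr : 0 ≤ r) {h : ℝ → ℝ} (hm : Measurable h)
    (hM : ∃ M, ∀ s, |h s| ≤ M * (1 + |s|) ^ r) (a : ℝ) {κ μ : Measure ℝ} [SFinite κ] [SFinite μ]
    (hκ : Integrable (fun s => (1 + |s|) ^ r) κ) (hμ : Integrable (fun x => (1 + |x|) ^ r) μ) :
    Integrable h (addLaw κ μ a) := by
  obtain ⟨M, hM⟩ := hM
  rw [addLaw, integrable_map_measure hm.aestronglyMeasurable (by fun_prop)]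
  exact integrable_prod_comp_add_mul hr hm hM a μ hμ hκ

theorem integral_addLaw {r : ℝ} (hr : 0 ≤ r) {h : ℝ → ℝ} (hm : Measurable h)
    (hM : ∃ M, ∀ s, |h s| ≤ M * (1 + |s|) ^ r) (a : ℝ) {κ μ : Measure ℝ} [SFinite κ] [SFinite μ]
    (hκ : Integrable (fun s => (1 + |s|) ^ r) κ) (hμ : Integrable (fun x => (1 + |x|) ^ r) μ) :
    ∫ t, h t ∂addLaw κ μ a = ∫ s, ∫ x, h (s + a * x) ∂μ ∂κ := by
  obtain ⟨M, hM⟩ := hM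
  rw [addLaw, integral_map (by fun_prop) hm.aestronglyMeasurable]
  exact integral_prod _ (integrable_prod_comp_add_mul hr hm hM a μ hμ hκ)

theorem exists_abs_weight_le (r : ℝ) :
    ∃ M : ℝ, ∀ s : ℝ, |(1 + |s|) ^ r| ≤ M * (1 + |s|) ^ r :=
  ⟨1, fun s => by rw [abs_of_nonneg (by positivity), one_mul]⟩

/-- Adding an independent variable with a symmetric unimodal density preserves unimodality. -/
theorem IsUnimodal.addLaw {r : ℝ} (hr : 0 ≤ r) {κ : Measure ℝ} [IsProbabilityMeasure κ]
    (hκ : IsUnimodal r κ) {w : ℝ → ℝ} (hw : IsUnimodalDensity r w) (a : ℝ) :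
    IsUnimodal r (addLaw κ (densityLaw w) a) := by
  have := hw.isProbabilityMeasure
  refine ⟨integrable_addLaw hr (measurable_weight r) (exists_abs_weight_le r) a hκ.integrable
    hw.integrable_law, fun h hh => ?_⟩
  rw [integral_addLaw hr hh.meas hh.growth a hκ.integrable hw.integrable_law]
  -- The average of `h` over the added variable is again a test function: by Fubini its integral
  -- over `[-b, b]` is the integral against `w` of a function to which `IsTest.integral_interval`
  -- applies.
  refine hκ.nonneg _ ?_
  obtain ⟨M, hM⟩ := hh.growth
  refine ⟨measurable_average hh.meas a _, ⟨_, abs_average_le hr hM a _ hw.integrable_law⟩, ?_, ?_⟩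
  · simpa using hw.integral_nonneg (hh.comp_mul hr a)
  · intro b hb
    rw [integral_average_interval hr hh.meas hM a _ hw.integrable_law hb.le]
    exact hw.integral_nonneg (hh.integral_interval hr hb a)

end Khintchine

namespace Khintchine

open Set

/-! ### Convexity of the averaged power in the squared variable -/

/-- The power `t ^ (p - 2)` increases for `p ≥ 2` and decreases for `p ≤ 2`; the factor `p - 2`
absorbs this change of sign here and in what follows. -/
theorem sub_two_mul_rpow_sub_nonneg (p : ℝ) {A B : ℝ} (hB : 0 < B) (hBA : B ≤ A) :
    0 ≤ (p - 2) * (A ^ (p - 2) - B ^ (p - 2)) := by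
  rcases le_total 2 p with h | h
  · exact mul_nonneg (by linarith) (sub_nonneg.2 (Real.rpow_le_rpow hB.le hBA (by linarith)))
  · exact mul_nonneg_of_nonpos_of_nonpos (by linarith)
      (sub_nonpos.2 (Real.rpow_le_rpow_of_nonpos hB hBA (by linarith)))

/-- Numerator of the derivative of `((b + x)^p - (b - x)^p) / x`. It vanishes at `x = 0`, and its
own derivative is `p (p - 1) x` times a difference of powers of exponent `p - 2`. -/
theorem secant_numerator_nonneg_of_lt {p b x : ℝ} (hp : 1 ≤ p) (hx : 0 ≤ x) (hxb : x < b) :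
    0 ≤ (p - 2) * (p * ((b + x) ^ (p - 1) + (b - x) ^ (p - 1)) * x
      - ((b + x) ^ p - (b - x) ^ p)) := by
  have hd : ∀ y ∈ Ico 0 b, HasDerivAt (fun y => (p - 2) * (p * ((b + y) ^ (p - 1)
      + (b - y) ^ (p - 1)) * y - ((b + y) ^ p - (b - y) ^ p)))
      (p * (p - 1) * y * ((p - 2) * ((b + y) ^ (p - 2) - (b - y) ^ (p - 2)))) y := by
    intro y hy
    have h1 : b + y ≠ 0 := by linarith [hy.1, hy.2]
    have h2 : b - y ≠ 0 := by linarith [hy.1, hy.2]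
    have e1 : ∀ r : ℝ, HasDerivAt (fun y => (b + y) ^ r) (r * (b + y) ^ (r - 1)) y := fun r => by
      simpa using ((hasDerivAt_id y).const_add b).rpow_const (p := r) (Or.inl h1)
    have e2 : ∀ r : ℝ, HasDerivAt (fun y => (b - y) ^ r) (-(r * (b - y) ^ (r - 1))) y := fun r => by
      simpa using ((hasDerivAt_id y).const_sub b).rpow_const (p := r) (Or.inl h2)
    have := (((((e1 (p - 1)).add (e2 (p - 1))).const_mul p).mul (hasDerivAt_id y)).sub
      ((e1 p).sub (e2 p))).const_mul (p - 2)
    refine this.congr_deriv ?_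
    simp only [Pi.add_apply, id]
    rw [show p - 1 - 1 = p - 2 by ring]
    ring
  have hmono : MonotoneOn (fun y => (p - 2) * (p * ((b + y) ^ (p - 1)
      + (b - y) ^ (p - 1)) * y - ((b + y) ^ p - (b - y) ^ p))) (Ico 0 b) := by
    refine monotoneOn_of_deriv_nonneg (convex_Ico 0 b)
      (fun y hy => (hd y hy).continuousAt.continuousWithinAt)
      (fun y hy => (hd y (interior_subset hy)).differentiableAt.differentiableWithinAt) ?_
    intro y hy
    have hy' := interior_subset hy
    rw [(hd y hy').deriv]
    refine mul_nonneg (mul_nonneg (mul_nonneg (by linarith) (by linarith)) hy'.1) ?_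
    exact sub_two_mul_rpow_sub_nonneg p (by linarith [hy'.2]) (by linarith [hy'.1])
  have := hmono ⟨le_rfl, hx.trans_lt hxb⟩ ⟨hx, hxb⟩ hx
  simpa using this

theorem secant_numerator_nonneg_of_gt {p b x : ℝ} (hp : 1 ≤ p) (hb : 0 ≤ b) (hxb : b < x) :
    0 ≤ (p - 2) * (p * ((x + b) ^ (p - 1) - (x - b) ^ (p - 1)) * x
      - ((x + b) ^ p - (x - b) ^ p)) := by
  have hA : 0 < x + b := by linarith
  have hB : 0 < x - b := by linarith
  have e1 : ∀ A : ℝ, 0 < A → A ^ (p - 1) = A ^ (p - 2) * A := fun A hA => by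
    rw [← Real.rpow_add_one hA.ne']; congr 1; ring
  have e2 : ∀ A : ℝ, 0 < A → A ^ p = A ^ (p - 2) * A ^ 2 := fun A hA => by
    rw [← Real.rpow_natCast, ← Real.rpow_add hA]; congr 1; norm_num
  have h1 := sub_two_mul_rpow_sub_nonneg p hB (show x - b ≤ x + b by linarith)
  have h2 : 0 ≤ (x + b) ^ p - (x - b) ^ p :=
    sub_nonneg.2 (Real.rpow_le_rpow hB.le (by linarith) (by linarith))
  rw [e2 _ hA, e2 _ hB] at h2
  -- With `A = x + b`, `B = x - b` and `x = (A + B) / 2`, the expression is exactly `(p - 2)² / 2 *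
  -- (A^p - B^p) + p / 2 * A * B * (p - 2) * (A^(p-2) - B^(p-2))`.
  rw [e1 _ hA, e1 _ hB, e2 _ hA, e2 _ hB]
  have h3 := mul_nonneg (mul_nonneg (show 0 ≤ p / 2 by linarith) (mul_pos hA hB).le) h1
  have h4 := mul_nonneg (show 0 ≤ (p - 2) ^ 2 / 2 by positivity) h2
  nlinarith [h3, h4]

/-- At `x = √u` this is twice the derivative in `u` of `(p - 2) * ∫ s in -b..b, |s + √u|^p`, so its
monotonicity is the convexity sought. The kink at `x = b` forces a separate treatment of the two
sides, glued by continuity. -/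
theorem monotoneOn_secant {p b : ℝ} (hp : 1 ≤ p) (hb : 0 < b) :
    MonotoneOn (fun x : ℝ => (p - 2) * ((|x + b| ^ p - |x - b| ^ p) / x)) (Ioi 0) := by
  have hc : ContinuousOn (fun x : ℝ => (p - 2) * ((|x + b| ^ p - |x - b| ^ p) / x)) (Ioi 0) := by
    refine continuousOn_const.mul (ContinuousOn.div ?_ continuousOn_id fun x hx => ne_of_gt hx)
    refine Continuous.continuousOn (Continuous.sub ?_ ?_) <;>
      exact Continuous.rpow_const (by fun_prop) fun x => Or.inr (by linarith)
  have e1 : ∀ (c r y : ℝ), y + c ≠ 0 →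
      HasDerivAt (fun y => (y + c) ^ r) (r * (y + c) ^ (r - 1)) y := fun c r y h => by
    simpa using ((hasDerivAt_id y).add_const c).rpow_const (p := r) (Or.inl h)
  have e2 : ∀ (c r y : ℝ), c - y ≠ 0 →
      HasDerivAt (fun y => (c - y) ^ r) (-(r * (c - y) ^ (r - 1))) y := fun c r y h => by
    simpa using ((hasDerivAt_id y).const_sub c).rpow_const (p := r) (Or.inl h)
  have hlow : ∀ x ∈ Ioo 0 b, HasDerivAt (fun x : ℝ => (p - 2) * ((|x + b| ^ p - |x - b| ^ p) / x))
      ((p - 2) * (p * ((b + x) ^ (p - 1) + (b - x) ^ (p - 1)) * x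
      - ((b + x) ^ p - (b - x) ^ p)) / x ^ 2) x := by
    intro x hx
    have h0 : x ≠ 0 := hx.1.ne'
    have h := ((((e1 b p x (by linarith [hx.1])).sub (e2 b p x (by linarith [hx.2]))).div
      (hasDerivAt_id x) h0).const_mul (p - 2))
    refine (h.congr_of_eventuallyEq ?_).congr_deriv ?_
    · filter_upwards [Ioo_mem_nhds hx.1 hx.2] with y hy
      simp only [Pi.sub_apply, Pi.div_apply, id]
      rw [abs_of_pos (by linarith [hy.1, hb]), abs_of_neg (by linarith [hy.2]), neg_sub]
    · simp only [Pi.sub_apply, id, add_comm x b]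
      ring
  have hhigh : ∀ x ∈ Ioi b, HasDerivAt (fun x : ℝ => (p - 2) * ((|x + b| ^ p - |x - b| ^ p) / x))
      ((p - 2) * (p * ((x + b) ^ (p - 1) - (x - b) ^ (p - 1)) * x
      - ((x + b) ^ p - (x - b) ^ p)) / x ^ 2) x := by
    intro x hx
    have hx' : b < x := hx
    have h0 : x ≠ 0 := by linarith
    have h := ((((e1 b p x (by linarith)).sub (e1 (-b) p x (by linarith))).div
      (hasDerivAt_id x) h0).const_mul (p - 2))
    refine (h.congr_of_eventuallyEq ?_).congr_deriv ?_
    · filter_upwards [Ioi_mem_nhds hx'] with y hy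
      have hy' : b < y := hy
      simp only [Pi.sub_apply, Pi.div_apply, id]
      rw [abs_of_pos (by linarith), abs_of_pos (by linarith), ← sub_eq_add_neg]
    · simp only [Pi.sub_apply, id, ← sub_eq_add_neg]
      ring
  have m1 : MonotoneOn (fun x : ℝ => (p - 2) * ((|x + b| ^ p - |x - b| ^ p) / x)) (Ioc 0 b) := by
    refine monotoneOn_of_deriv_nonneg (convex_Ioc 0 b) (hc.mono fun x hx => hx.1) ?_ ?_
    · rw [interior_Ioc]
      exact fun x hx => (hlow x hx).differentiableAt.differentiableWithinAt
    · rw [interior_Ioc]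
      intro x hx
      rw [(hlow x hx).deriv]
      exact div_nonneg (secant_numerator_nonneg_of_lt hp hx.1.le hx.2) (by positivity)
  have m2 : MonotoneOn (fun x : ℝ => (p - 2) * ((|x + b| ^ p - |x - b| ^ p) / x)) (Ici b) := by
    refine monotoneOn_of_deriv_nonneg (convex_Ici b) (hc.mono fun x hx => hb.trans_le hx) ?_ ?_
    · rw [interior_Ici]
      exact fun x hx => (hhigh x hx).differentiableAt.differentiableWithinAt
    · rw [interior_Ici]
      intro x hx
      rw [(hhigh x hx).deriv]
      exact div_nonneg (secant_numerator_nonneg_of_gt hp hb.le hx) (by positivity)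
  rw [← Ioc_union_Ici_eq_Ioi hb]
  exact m1.union_right m2 (isGreatest_Ioc hb) isLeast_Ici

theorem continuous_abs_rpow {p : ℝ} (hp : 0 ≤ p) : Continuous fun y : ℝ => |y| ^ p :=
  continuous_abs.rpow_const fun _ => Or.inr hp

theorem hasDerivAt_integral_abs_add_rpow {p : ℝ} (hp : 0 ≤ p) (b x : ℝ) :
    HasDerivAt (fun x : ℝ => ∫ s in -b..b, |s + x| ^ p) (|x + b| ^ p - |x - b| ^ p) x := by
  have hc := continuous_abs_rpow hp
  have hi : ∀ a b, IntervalIntegrable (fun y : ℝ => |y| ^ p) volume a b :=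
    fun a b => hc.intervalIntegrable a b
  set H : ℝ → ℝ := fun t => ∫ y in (0 : ℝ)..t, |y| ^ p with hH
  have hd : ∀ t, HasDerivAt H (|t| ^ p) t := fun t =>
    intervalIntegral.integral_hasDerivAt_right (hi _ _) (hc.stronglyMeasurableAtFilter _ _)
      hc.continuousAt
  have heq : (fun x : ℝ => ∫ s in -b..b, |s + x| ^ p) = fun x => H (x + b) - H (x - b) := by
    ext x
    rw [intervalIntegral.integral_comp_add_right fun y => |y| ^ p,
      intervalIntegral.integral_interval_sub_left (hi _ _) (hi _ _)]
    congr 1 <;> ring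
  rw [heq]
  have h1 := (hd (x + b)).comp x ((hasDerivAt_id x).add_const b)
  have h2 := (hd (x - b)).comp x ((hasDerivAt_id x).sub_const b)
  exact (h1.sub h2).congr_deriv (by simp)

/-- The average of `|x + U|^p` over a symmetric uniform variable `U` is convex in `x ^ 2` for
`p ≥ 2` and concave for `1 ≤ p ≤ 2`. -/
theorem convexOn_integral_abs_add_sqrt {p b : ℝ} (hp : 1 ≤ p) (hb : 0 < b) :
    ConvexOn ℝ (Ici 0) fun u : ℝ => (p - 2) * ∫ s in -b..b, |s + √u| ^ p := by
  have hd := hasDerivAt_integral_abs_add_rpow (show 0 ≤ p by linarith) b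
  have hd2 : ∀ u ∈ Ioi (0 : ℝ), HasDerivAt (fun u : ℝ => (p - 2) * ∫ s in -b..b, |s + √u| ^ p)
      ((p - 2) * ((|√u + b| ^ p - |√u - b| ^ p) / √u) / 2) u := by
    intro u hu
    have hu' : (0 : ℝ) < u := hu
    refine (((hd (√u)).comp u (Real.hasDerivAt_sqrt hu'.ne')).const_mul (p - 2)).congr_deriv ?_
    ring
  refine MonotoneOn.convexOn_of_deriv (convex_Ici 0) ?_ ?_ ?_
  · refine Continuous.continuousOn (continuous_const.mul ?_)
    exact (continuous_iff_continuousAt.2 fun x => (hd x).continuousAt).comp Real.continuous_sqrt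
  · rw [interior_Ici]
    exact fun u hu => (hd2 u hu).differentiableAt.differentiableWithinAt
  · rw [interior_Ici]
    intro u hu v hv huv
    rw [(hd2 u hu).deriv, (hd2 v hv).deriv]
    have := monotoneOn_secant hp hb (Real.sqrt_pos.2 hu) (Real.sqrt_pos.2 hv)
      (Real.sqrt_le_sqrt huv)
    simp only at this
    linarith

theorem integral_abs_add_neg (p b x : ℝ) :
    ∫ s in -b..b, |s + -x| ^ p = ∫ s in -b..b, |s + x| ^ p := by
  have := intervalIntegral.integral_comp_neg (a := -b) (b := b) fun s => |s + x| ^ p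
  rw [neg_neg] at this
  rw [← this]
  congr 1; ext s
  rw [← abs_neg]; congr 2; ring

theorem integral_abs_add_sqrt_sq (p b x : ℝ) :
    ∫ s in -b..b, |s + √(x ^ 2)| ^ p = ∫ s in -b..b, |s + x| ^ p := by
  rw [Real.sqrt_sq_eq_abs]
  rcases abs_choice x with h | h <;> rw [h]
  exact integral_abs_add_neg p b x

/-- The degenerate case of the preceding convexity, with the uniform variable replaced by 0; it
serves the value at the origin of the test function in `IsUnimodal.addLaw_le`. -/
theorem convexOn_sub_two_mul_rpow {p : ℝ} (hp : 1 ≤ p) :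
    ConvexOn ℝ (Ici 0) fun u : ℝ => (p - 2) * u ^ (p / 2) := by
  rcases le_total 2 p with h | h
  · exact (convexOn_rpow (by linarith)).smul (by linarith)
  · have := (Real.concaveOn_rpow (p := p / 2) (by linarith) (by linarith)).neg.smul
      (show 0 ≤ 2 - p by linarith)
    refine this.congr fun u _ => ?_
    simp only [Pi.neg_apply, smul_eq_mul]; ring

end Khintchine

namespace Khintchine

open Set ProbabilityTheory
open scoped NNReal

/-! ### Comparison of sums of independent variables with Gaussian variables -/

theorem weight_le {r : ℝ} (hr : 0 ≤ r) (s : ℝ) : (1 + |s|) ^ r ≤ 2 ^ r * (1 + |s| ^ r) := by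
  have h0 : (0 : ℝ) ≤ |s| ^ r := by positivity
  rcases le_total |s| 1 with hs | hs
  · calc (1 + |s|) ^ r ≤ 2 ^ r := Real.rpow_le_rpow (by positivity) (by linarith) hr
      _ ≤ 2 ^ r * (1 + |s| ^ r) := le_mul_of_one_le_right (by positivity) (by linarith)
  · calc (1 + |s|) ^ r ≤ (2 * |s|) ^ r := Real.rpow_le_rpow (by positivity) (by linarith) hr
      _ = 2 ^ r * |s| ^ r := Real.mul_rpow (by norm_num) (abs_nonneg s)
      _ ≤ 2 ^ r * (1 + |s| ^ r) := by gcongr; linarith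

theorem integrable_weight {r : ℝ} (hr : 0 ≤ r) {κ : Measure ℝ} [IsFiniteMeasure κ]
    (h : Integrable (fun s => |s| ^ r) κ) : Integrable (fun s => (1 + |s|) ^ r) κ := by
  refine (((integrable_const (1 : ℝ)).add h).const_mul (2 ^ r)).mono'
    (measurable_weight r).aestronglyMeasurable (Filter.Eventually.of_forall fun s => ?_)
  rw [Real.norm_of_nonneg (by positivity)]
  exact weight_le hr s

theorem integrable_weight_gaussianReal {r : ℝ} (hr : 0 ≤ r) (v : ℝ≥0) :
    Integrable (fun s => (1 + |s|) ^ r) (gaussianReal 0 v) := by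
  refine integrable_weight hr ?_
  exact integrable_rpow_abs_of_integrable_exp_mul (X := id) one_ne_zero
    (integrable_exp_mul_gaussianReal 1) (integrable_exp_mul_gaussianReal (-1)) hr

theorem gaussianReal_eq_densityLaw {v : ℝ≥0} (hv : v ≠ 0) :
    gaussianReal 0 v = densityLaw (gaussianPDFReal 0 v) := by
  rw [gaussianReal_of_var_ne_zero 0 hv]; rfl

theorem isUnimodalDensity_gaussianPDFReal {r : ℝ} (hr : 0 ≤ r) {v : ℝ≥0} (hv : v ≠ 0) :
    IsUnimodalDensity r (gaussianPDFReal 0 v) where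
  nonneg := gaussianPDFReal_nonneg 0 v
  even x := by simp [gaussianPDFReal_def]
  anti := by
    intro x hx y hy hxy
    have hx' : (0 : ℝ) ≤ x := hx
    have : x ^ 2 ≤ y ^ 2 := pow_le_pow_left₀ hx' hxy 2
    simp only [gaussianPDFReal_def, sub_zero]
    gcongr
  meas := measurable_gaussianPDFReal 0 v
  integrable := integrable_gaussianPDFReal 0 v
  integral_eq := integral_gaussianPDFReal_eq_one 0 hv
  moment := by
    have := integrable_weight_gaussianReal hr v
    rw [gaussianReal_eq_densityLaw hv] at this
    exact (integrable_densityLaw (gaussianPDFReal_nonneg 0 v) (measurable_gaussianPDFReal 0 v)).1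
      this

theorem integral_abs_rpow_gaussianReal {p : ℝ} (hp : 0 < p) (v : ℝ≥0) :
    ∫ x, |x| ^ p ∂gaussianReal 0 v = (v : ℝ) ^ (p / 2) * gammaConst p ^ p := by
  rcases eq_or_ne v 0 with rfl | hv
  · simp [Real.zero_rpow hp.ne', Real.zero_rpow (show p / 2 ≠ 0 by positivity)]
  have hv' : (0 : ℝ) < v := NNReal.coe_pos.2 (pos_iff_ne_zero.2 hv)
  have hG : 0 < Real.Gamma ((p + 1) / 2) := Real.Gamma_pos_of_pos (by positivity)
  have hpi := Real.pi_pos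
  have hγ : gammaConst p ^ p = 2 ^ (p / 2) * (Real.Gamma ((p + 1) / 2) / √Real.pi) := by
    rw [gammaConst, Real.mul_rpow (by positivity) (by positivity), ← Real.rpow_mul (by positivity),
      one_div_mul_cancel hp.ne', Real.rpow_one, Real.sqrt_eq_rpow, ← Real.rpow_mul (by positivity)]
    congr 2; ring
  rw [gaussianReal_eq_densityLaw hv, integral_densityLaw (gaussianPDFReal_nonneg 0 v)
    (measurable_gaussianPDFReal 0 v), hγ]
  have h1 : ∀ x, gaussianPDFReal 0 v x * |x| ^ p
      = (√(2 * Real.pi * v))⁻¹ * (|x| ^ p * Real.exp (-(1 / (2 * v)) * |x| ^ (2 : ℝ))) := by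
    intro x
    rw [gaussianPDFReal_def]
    simp only [sub_zero, Real.rpow_two, sq_abs]
    rw [show -x ^ 2 / (2 * (v : ℝ)) = -(1 / (2 * v)) * x ^ 2 by ring]
    ring
  simp only [h1]
  rw [integral_const_mul, integral_comp_abs
    (f := fun x => x ^ p * Real.exp (-(1 / (2 * v)) * x ^ (2 : ℝ))),
    integral_rpow_mul_exp_neg_mul_rpow (by norm_num) (by linarith) (by positivity)]
  have h2 : (1 / (2 * (v : ℝ))) ^ (-(p + 1) / 2) = 2 ^ (p / 2) * (v : ℝ) ^ (p / 2) * √(2 * v) := by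
    rw [one_div, Real.inv_rpow (by positivity), ← Real.rpow_neg (by positivity),
      ← Real.mul_rpow (by norm_num) hv'.le, Real.sqrt_eq_rpow, ← Real.rpow_add (by positivity)]
    congr 1; ring
  have h3 : √(2 * Real.pi * v) = √(2 * v) * √Real.pi := by
    rw [← Real.sqrt_mul (by positivity)]; congr 1; ring
  rw [h2, h3]
  have h4 : √(2 * (v : ℝ)) ≠ 0 := by positivity
  have h5 : √Real.pi ≠ 0 := by positivity
  field_simp

/-- Symmetric unimodal densities which are dominated by the centred Gaussian of variance `v` for
convex functions of the square. -/
structure IsSubGaussianDensity (r : ℝ) (v : ℝ≥0) (w : ℝ → ℝ) : Prop extends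
    IsUnimodalDensity r w where
  var_ne_zero : v ≠ 0
  convex_le : ∀ ψ : ℝ → ℝ, ConvexOn ℝ (Ici 0) ψ → Integrable (fun x => ψ (x ^ 2)) (densityLaw w) →
    Integrable (fun x => ψ (x ^ 2)) (gaussianReal 0 v) →
    ∫ x, ψ (x ^ 2) ∂densityLaw w ≤ ∫ x, ψ (x ^ 2) ∂gaussianReal 0 v

theorem abs_rpow_le_weight {p : ℝ} (hp : 0 ≤ p) (s : ℝ) : |(|s| ^ p)| ≤ 1 * (1 + |s|) ^ p := by
  rw [abs_of_nonneg (by positivity), one_mul]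
  exact Real.rpow_le_rpow (abs_nonneg s) (by linarith) hp

theorem measurable_abs_rpow (p : ℝ) : Measurable fun s : ℝ => |s| ^ p := by fun_prop

theorem integral_swap_interval_abs_rpow {p : ℝ} (hp : 0 ≤ p) (a : ℝ) {b : ℝ} (hb : 0 ≤ b)
    {μ : Measure ℝ} [SFinite μ] (hμ : Integrable (fun x => (1 + |x|) ^ p) μ) :
    Integrable (fun x => ∫ s in -b..b, |s + a * x| ^ p) μ := by
  simp only [intervalIntegral.integral_of_le (show -b ≤ b by linarith)]
  have hκ : Integrable (fun s : ℝ => (1 + |s|) ^ p) (volume.restrict (Ioc (-b) b)) :=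
    (intervalIntegrable_iff_integrableOn_Ioc_of_le (by linarith)).1
      (intervalIntegrable_of_growth hp (measurable_weight p) (exists_abs_weight_le p) (-b) b)
  exact (integrable_prod_comp_add_mul hp (measurable_abs_rpow p) (abs_rpow_le_weight hp) a μ hμ
    hκ).integral_prod_right

/-- Replacing a sub-Gaussian summand by a Gaussian one, in the presence of an independent symmetric
unimodal summand. -/
theorem IsUnimodal.addLaw_le {p : ℝ} (hp : 1 ≤ p) {κ : Measure ℝ} [IsProbabilityMeasure κ]
    (hκ : IsUnimodal p κ) {v : ℝ≥0} {w : ℝ → ℝ} (hw : IsSubGaussianDensity p v w) (a : ℝ) :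
    (p - 2) * ∫ t, |t| ^ p ∂Khintchine.addLaw κ (densityLaw w) a
      ≤ (p - 2) * ∫ t, |t| ^ p ∂Khintchine.addLaw κ (gaussianReal 0 v) a := by
  have hp0 : 0 ≤ p := by linarith
  have := hw.isProbabilityMeasure
  have hN := integrable_weight_gaussianReal hp0 v
  have hW := hw.integrable_law
  have hm := measurable_abs_rpow p
  have hM := abs_rpow_le_weight hp0
  -- The gain of the exchange, conditional on the value `s` of the other summand. As `κ` is
  -- unimodal, it suffices that this is a test function.
  set h : ℝ → ℝ := fun s => (p - 2) * (∫ x, |s + a * x| ^ p ∂gaussianReal 0 v)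
    - (p - 2) * ∫ x, |s + a * x| ^ p ∂densityLaw w with hh
  have hsq : ∀ b x : ℝ, ∫ s in -b..b, |s + √(a ^ 2 * x ^ 2)| ^ p
      = ∫ s in -b..b, |s + a * x| ^ p := fun b x => by
    rw [← mul_pow]; exact integral_abs_add_sqrt_sq p b (a * x)
  have hgN := fun s => abs_average_le hp0 hM a _ hN s
  have hgW := fun s => abs_average_le hp0 hM a _ hW s
  have hmN := measurable_average hm a (gaussianReal 0 v)
  have hmW := measurable_average hm a (densityLaw w)
  have hTest : IsTest p h := by
    refine ⟨(hmN.const_mul _).sub (hmW.const_mul _), ?_, ?_, ?_⟩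
    · refine ⟨|p - 2| * (1 * (1 + |a|) ^ p * ∫ x, (1 + |x|) ^ p ∂gaussianReal 0 v) + |p - 2| *
        (1 * (1 + |a|) ^ p * ∫ x, (1 + |x|) ^ p ∂densityLaw w), fun s => (abs_sub _ _).trans ?_⟩
      rw [abs_mul, abs_mul]
      refine (add_le_add (mul_le_mul_of_nonneg_left (hgN s) (abs_nonneg _))
        (mul_le_mul_of_nonneg_left (hgW s) (abs_nonneg _))).trans (le_of_eq ?_)
      ring
    · have hconv := (convexOn_sub_two_mul_rpow hp).smul (show 0 ≤ |a| ^ p by positivity)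
      have hval : ∀ x : ℝ, (|a| ^ p) • ((p - 2) * (x ^ 2) ^ (p / 2))
          = (p - 2) * |0 + a * x| ^ p := fun x => by
        rw [zero_add, abs_mul, Real.mul_rpow (abs_nonneg _) (abs_nonneg _), ← sq_abs x,
          ← Real.rpow_natCast, ← Real.rpow_mul (abs_nonneg _), smul_eq_mul]
        norm_num
        ring_nf
      have := hw.convex_le _ hconv
      simp only [hval] at this
      simp only [hh, sub_nonneg, ← integral_const_mul]
      exact this ((integrable_comp_add_mul hp0 hm hM a _ hW 0).const_mul _)
        ((integrable_comp_add_mul hp0 hm hM a _ hN 0).const_mul _)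
    · intro b hb
      -- After exchanging integrals, the integral over `[-b, b]` compares the means of one function
      -- under the two laws, and that function is convex in `x ^ 2`: exactly what `convex_le`
      -- handles.
      have hconv := (convexOn_integral_abs_add_sqrt hp hb).comp_linearMap
        ((a ^ 2) • (LinearMap.id : ℝ →ₗ[ℝ] ℝ))
      have hconv' : ConvexOn ℝ (Ici 0) fun u : ℝ =>
          (p - 2) * ∫ s in -b..b, |s + √(a ^ 2 * u)| ^ p := by
        refine (hconv.subset (fun u hu => ?_) (convex_Ici 0)).congr fun u _ => ?_
        · exact mul_nonneg (sq_nonneg a) hu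
        · simp
      have := hw.convex_le _ hconv'
      simp only [hsq] at this
      have h1 : ∫ s in -b..b, h s = (p - 2) * (∫ x, (∫ s in -b..b, |s + a * x| ^ p)
          ∂gaussianReal 0 v) - (p - 2) * ∫ x, (∫ s in -b..b, |s + a * x| ^ p) ∂densityLaw w := by
        simp only [hh]
        rw [intervalIntegral.integral_sub, intervalIntegral.integral_const_mul,
          intervalIntegral.integral_const_mul, integral_average_interval hp0 hm hM a _ hN hb.le,
          integral_average_interval hp0 hm hM a _ hW hb.le]
        · exact (intervalIntegrable_of_growth hp0 hmN ⟨_, hgN⟩ _ _).const_mul _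
        · exact (intervalIntegrable_of_growth hp0 hmW ⟨_, hgW⟩ _ _).const_mul _
      rw [h1, sub_nonneg, ← integral_const_mul, ← integral_const_mul]
      exact this ((integral_swap_interval_abs_rpow hp0 a hb.le hW).const_mul _)
        ((integral_swap_interval_abs_rpow hp0 a hb.le hN).const_mul _)
  have hfin := hκ.nonneg h hTest
  have hiN : Integrable (fun s => ∫ x, |s + a * x| ^ p ∂gaussianReal 0 v) κ :=
    (integrable_prod_comp_add_mul hp0 hm hM a _ hN hκ.integrable).integral_prod_left
  have hiW : Integrable (fun s => ∫ x, |s + a * x| ^ p ∂densityLaw w) κ :=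
    (integrable_prod_comp_add_mul hp0 hm hM a _ hW hκ.integrable).integral_prod_left
  rw [integral_addLaw hp0 hm ⟨1, hM⟩ a hκ.integrable hN,
    integral_addLaw hp0 hm ⟨1, hM⟩ a hκ.integrable hW]
  simp only [hh] at hfin
  rw [integral_sub (hiN.const_mul _) (hiW.const_mul _), integral_const_mul,
    integral_const_mul] at hfin
  linarith

/-- Characteristic functions identify laws, so regrouping independent summands becomes commutative
algebra. -/
theorem charFun_addLaw (κ μ : Measure ℝ) [IsProbabilityMeasure κ] [IsProbabilityMeasure μ]
    (a t : ℝ) : charFun (addLaw κ μ a) t = charFun κ t * charFun μ (a * t) := by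
  simp only [charFun_apply_real]
  rw [addLaw, integral_map (by fun_prop) (by fun_prop), ← integral_prod_mul]
  refine integral_congr_ae (Filter.Eventually.of_forall fun z => ?_)
  simp only [← Complex.exp_add]
  congr 1
  push_cast
  ring

theorem measurable_linear {n : ℕ} (a : Fin n → ℝ) :
    Measurable fun x : Fin n → ℝ => ∑ i, a i * x i :=
  Finset.measurable_fun_sum _ fun i _ => measurable_const.mul (measurable_pi_apply i)

/-- The law of `∑ a i Y i`, for independent `Y i` of law `μ`. -/
noncomputable def sumLaw (μ : Measure ℝ) {n : ℕ} (a : Fin n → ℝ) : Measure ℝ :=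
  (Measure.pi fun _ : Fin n => μ).map fun x => ∑ i, a i * x i

instance (μ : Measure ℝ) [IsProbabilityMeasure μ] {n : ℕ} (a : Fin n → ℝ) :
    IsProbabilityMeasure (sumLaw μ a) :=
  Measure.isProbabilityMeasure_map (measurable_linear a).aemeasurable

theorem charFun_sumLaw (μ : Measure ℝ) [IsProbabilityMeasure μ] {n : ℕ} (a : Fin n → ℝ) (t : ℝ) :
    charFun (sumLaw μ a) t = ∏ i, charFun μ (a i * t) := by
  simp only [charFun_apply_real]
  rw [sumLaw, integral_map (measurable_linear a).aemeasurable (by fun_prop), ← integral_fintype_prod_eq_prod]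
  refine integral_congr_ae (Filter.Eventually.of_forall fun z => ?_)
  simp only [← Complex.exp_sum]
  congr 1
  push_cast
  rw [Finset.mul_sum, Finset.sum_mul]
  exact Finset.sum_congr rfl fun i _ => by ring

/-- Lindeberg exchange by induction on the number of summands, with `κ` arbitrary. First `a 0 Y 0`
is absorbed into `κ` and the other summands become one Gaussian; then that Gaussian, itself
unimodal, is absorbed into `κ` and `Y 0` is exchanged. -/
theorem addLaw_sumLaw_le {p : ℝ} (hp : 1 ≤ p) {v : ℝ≥0} {w : ℝ → ℝ}
    (hw : IsSubGaussianDensity p v w) {n : ℕ} (a : Fin n → ℝ) {κ : Measure ℝ}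
    [IsProbabilityMeasure κ] (hκ : IsUnimodal p κ) :
    (p - 2) * ∫ t, |t| ^ p ∂addLaw κ (sumLaw (densityLaw w) a) 1
      ≤ (p - 2) * ∫ t, |t| ^ p ∂addLaw κ (gaussianReal 0 v) (√(∑ i, a i ^ 2)) := by
  have hp0 : 0 ≤ p := by linarith
  have := hw.isProbabilityMeasure
  have hg := isUnimodalDensity_gaussianPDFReal hp0 hw.var_ne_zero
  have hgl := gaussianReal_eq_densityLaw hw.var_ne_zero
  induction n generalizing κ with
  | zero =>
    have e0 : addLaw κ (sumLaw (densityLaw w) a) 1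
        = addLaw κ (gaussianReal 0 v) (√(∑ i, a i ^ 2)) := by
      refine Measure.ext_of_charFun ?_
      ext t
      simp [charFun_addLaw, charFun_sumLaw]
    rw [e0]
  | succ n ih =>
    set c : ℝ := √(∑ i : Fin n, a i.succ ^ 2) with hc
    have e1 : addLaw κ (sumLaw (densityLaw w) a) 1
        = addLaw (addLaw κ (densityLaw w) (a 0)) (sumLaw (densityLaw w) fun i => a i.succ) 1 := by
      refine Measure.ext_of_charFun ?_
      ext t
      simp [charFun_addLaw, charFun_sumLaw, Fin.prod_univ_succ, mul_assoc]
    have e2 : addLaw (addLaw κ (densityLaw w) (a 0)) (gaussianReal 0 v) c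
        = addLaw (addLaw κ (gaussianReal 0 v) c) (densityLaw w) (a 0) := by
      refine Measure.ext_of_charFun ?_
      ext t
      simp only [charFun_addLaw]
      ring
    have e3 : addLaw (addLaw κ (gaussianReal 0 v) c) (gaussianReal 0 v) (a 0)
        = addLaw κ (gaussianReal 0 v) (√(∑ i, a i ^ 2)) := by
      refine Measure.ext_of_charFun ?_
      ext t
      simp only [charFun_addLaw, charFun_gaussianReal]
      rw [mul_assoc, ← Complex.exp_add]
      congr 2
      have h1 : c ^ 2 = ∑ i : Fin n, a i.succ ^ 2 :=
        Real.sq_sqrt (Finset.sum_nonneg fun i _ => sq_nonneg _)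
      have h2 : (√(∑ i, a i ^ 2)) ^ 2 = a 0 ^ 2 + c ^ 2 := by
        rw [h1, Real.sq_sqrt (Finset.sum_nonneg fun i _ => sq_nonneg _), Fin.sum_univ_succ]
      have h3 : ((√(∑ i, a i ^ 2) : ℝ) : ℂ) ^ 2 = (a 0 : ℂ) ^ 2 + (c : ℂ) ^ 2 := by
        exact_mod_cast h2
      push_cast
      rw [mul_pow, mul_pow, mul_pow, h3]
      ring
    have hκ1 := hκ.addLaw hp0 hw.toIsUnimodalDensity (a 0)
    have hκ2 : IsUnimodal p (addLaw κ (gaussianReal 0 v) c) := by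
      rw [hgl]; exact hκ.addLaw hp0 hg c
    rw [e1]
    refine (ih (fun i => a i.succ) hκ1).trans ?_
    rw [e2, ← e3]
    exact hκ2.addLaw_le hp hw (a 0)

/-- The sharp comparison of the `p`-th and the second moment of a sum of independent
sub-Gaussian variables. -/
theorem sumLaw_moment_le {p : ℝ} (hp : 1 ≤ p) {v : ℝ≥0} {w : ℝ → ℝ}
    (hw : IsSubGaussianDensity p v w) {n : ℕ} (a : Fin n → ℝ) :
    (p - 2) * ∫ t, |t| ^ p ∂sumLaw (densityLaw w) a
      ≤ (p - 2) * ((v * ∑ i, a i ^ 2) ^ (p / 2) * gammaConst p ^ p) := by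
  have := hw.isProbabilityMeasure
  have h := addLaw_sumLaw_le hp hw a (isUnimodal_dirac p)
  have e1 : addLaw (Measure.dirac 0) (sumLaw (densityLaw w) a) 1 = sumLaw (densityLaw w) a := by
    refine Measure.ext_of_charFun ?_
    ext t
    simp [charFun_addLaw]
  have hs : 0 ≤ ∑ i, a i ^ 2 := Finset.sum_nonneg fun i _ => sq_nonneg _
  obtain ⟨V, hV⟩ : ∃ V : ℝ≥0, (V : ℝ) = ∑ i, a i ^ 2 := ⟨⟨_, hs⟩, rfl⟩
  have e2 : addLaw (Measure.dirac 0) (gaussianReal 0 v) (√(∑ i, a i ^ 2))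
      = gaussianReal 0 (v * V) := by
    refine Measure.ext_of_charFun ?_
    ext t
    have h3 : ((√(∑ i, a i ^ 2) : ℝ) : ℂ) ^ 2 = ((V : ℝ) : ℂ) := by
      rw [hV]; exact_mod_cast Real.sq_sqrt hs
    simp only [charFun_addLaw, charFun_gaussianReal, charFun_dirac]
    push_cast
    rw [mul_pow, h3]
    simp
    ring_nf
  rw [e1, e2, integral_abs_rpow_gaussianReal (by linarith), NNReal.coe_mul, hV] at h
  exact h

end Khintchine

namespace Khintchine

open Set ProbabilityTheory
open scoped NNReal

/-! ### Densities dominated by a Gaussian for convex functions of the square -/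

/-- A three-fold sign change of `g - w` in the squared variable yields the convex comparison. -/
theorem integral_convex_sq_le {w g ψ : ℝ → ℝ} (hwe : ∀ x, w (-x) = w x) (hge : ∀ x, g (-x) = g x)
    (hw : Integrable w) (hg : Integrable g) (h0 : ∫ x, w x = ∫ x, g x)
    (hw2 : Integrable fun x => w x * x ^ 2) (hg2 : Integrable fun x => g x * x ^ 2)
    (h2 : ∫ x, w x * x ^ 2 = ∫ x, g x * x ^ 2)
    (hI : ∀ u t s : ℝ, 0 ≤ u → u ≤ t → t ≤ s → g (√u) ≤ w (√u) → g (√s) ≤ w (√s) →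
      g (√t) ≤ w (√t))
    {R : ℝ} (hR : ∀ u, R < u → w (√u) < g (√u))
    (hψ : ConvexOn ℝ (Ici 0) ψ) (hwψ : Integrable fun x => w x * ψ (x ^ 2))
    (hgψ : Integrable fun x => g x * ψ (x ^ 2)) :
    ∫ x, w x * ψ (x ^ 2) ≤ ∫ x, g x * ψ (x ^ 2) := by
  have hsq : ∀ f : ℝ → ℝ, (∀ x, f (-x) = f x) → ∀ x, f (√(x ^ 2)) = f x := fun f hf x => by
    rw [Real.sqrt_sq_eq_abs]
    rcases abs_choice x with h | h <;> rw [h]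
    exact hf x
  -- In the variable `u = x²`, `w` dominates `g` precisely on `I`, a bounded interval by `hI` and
  -- `hR`.
  set I : Set ℝ := {u | 0 ≤ u ∧ g (√u) ≤ w (√u)} with hIdef
  have hbdd : BddAbove I := ⟨R, fun u hu => by
    by_contra hcon
    exact absurd hu.2 (not_le.2 (hR u (not_le.1 hcon)))⟩
  have hbdd' : BddBelow I := ⟨0, fun u hu => hu.1⟩
  have hout : ∀ x : ℝ, x ^ 2 ∉ I → w x < g x := fun x hx => by
    by_contra hcon
    refine hx ⟨sq_nonneg x, ?_⟩
    rw [hsq g hge, hsq w hwe]; exact not_lt.1 hcon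
  have hin : ∀ x : ℝ, x ^ 2 ∈ I → g x ≤ w x := fun x hx => by
    have := hx.2
    rwa [hsq g hge, hsq w hwe] at this
  have hD0 : ∫ x, (g x - w x) = 0 := by rw [integral_sub hg hw, h0, sub_self]
  -- Were `I` empty or a single point, `w < g` would hold almost everywhere, against the equality of
  -- the masses.
  have hlt : sInf I < sSup I := by
    by_contra hcon
    have hsub : ∀ u ∈ I, u = sSup I := fun u hu =>
      le_antisymm (le_csSup hbdd hu) ((not_lt.1 hcon).trans (csInf_le hbdd' hu))
    have hpos : ∀ x : ℝ, x ∉ ({√(sSup I), -√(sSup I)} : Set ℝ) → w x < g x := by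
      intro x hx
      refine hout x fun hxI => hx ?_
      have h3 := hsub _ hxI
      rw [← h3, Real.sqrt_sq_eq_abs]
      rcases abs_choice x with h | h <;> simp [h]
    have hae : ∀ᵐ x : ℝ, x ∉ ({√(sSup I), -√(sSup I)} : Set ℝ) :=
      measure_eq_zero_iff_ae_notMem.1 ((Set.toFinite _).measure_zero _)
    have hz : (fun x => g x - w x) =ᵐ[volume] 0 := by
      refine (integral_eq_zero_iff_of_nonneg_ae ?_ (hg.sub hw)).1 hD0
      filter_upwards [hae] with x hx
      exact sub_nonneg.2 (hpos x hx).le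
    obtain ⟨x, hx1, hx2⟩ := (hae.and hz).exists
    have := hpos x hx1
    simp only [Pi.zero_apply] at hx2
    linarith
  have hne : I.Nonempty := by
    by_contra hcon
    rw [not_nonempty_iff_eq_empty.1 hcon] at hlt
    simp at hlt
  set u₁ := sInf I
  set u₂ := sSup I
  have hu₁ : 0 ≤ u₁ := le_csInf hne fun u hu => hu.1
  have hmid : ∀ t, u₁ < t → t < u₂ → t ∈ I := by
    intro t ht1 ht2
    obtain ⟨a, ha, hat⟩ := exists_lt_of_csInf_lt hne ht1
    obtain ⟨b, hb, hbt⟩ := exists_lt_of_lt_csSup hne ht2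
    exact ⟨hu₁.trans ht1.le, hI a t b ha.1 hat.le hbt.le ha.2 hb.2⟩
  -- The chord of `ψ` over the endpoints of `I`. By convexity `ψ` is below it inside `I` and above
  -- it outside, so `ψ` minus the chord has the sign of `g - w`; equal masses and second moments
  -- make the affine correction integrate to 0.
  set m := (ψ u₂ - ψ u₁) / (u₂ - u₁) with hm
  have hmul : m * (u₂ - u₁) = ψ u₂ - ψ u₁ := div_mul_cancel₀ _ (by linarith)
  have hpt : ∀ x : ℝ, 0 ≤ (g x - w x) * (ψ (x ^ 2) - (ψ u₁ + m * (x ^ 2 - u₁))) := by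
    intro x
    have hx0 : x ^ 2 ∈ Ici (0 : ℝ) := sq_nonneg x
    have hm1 : u₁ ∈ Ici (0 : ℝ) := hu₁
    have hm2 : u₂ ∈ Ici (0 : ℝ) := hu₁.trans hlt.le
    have hd : 0 < u₂ - u₁ := by linarith
    set t := x ^ 2 with ht
    have hscale : (u₂ - u₁) * (ψ t - (ψ u₁ + m * (t - u₁)))
        = (u₂ - u₁) * (ψ t - ψ u₁) - (ψ u₂ - ψ u₁) * (t - u₁) := by rw [← hmul]; ring
    rcases lt_trichotomy t u₁ with h | h | h
    · have h3 := hout x fun hxI => absurd (csInf_le hbdd' hxI) (not_le.2 h)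
      refine mul_nonneg (by linarith) ?_
      have h4 := hψ.secant_mono_aux1 hx0 hm2 h hlt
      refine nonneg_of_mul_nonneg_right ?_ hd
      rw [hscale]; linarith
    · rw [h]; simp
    · rcases lt_trichotomy t u₂ with h' | h' | h'
      · have h3 := hin x (hmid t h h')
        refine mul_nonneg_of_nonpos_of_nonpos (by linarith) ?_
        have h4 := hψ.secant_mono_aux1 hm1 hm2 h h'
        refine nonpos_of_mul_nonpos_right ?_ hd
        rw [hscale]; linarith
      · rw [h', hmul]; simp
      · have h3 := hout x fun hxI => absurd (le_csSup hbdd hxI) (not_le.2 h')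
        refine mul_nonneg (by linarith) ?_
        have h4 := hψ.secant_mono_aux1 hm1 hx0 hlt h'
        refine nonneg_of_mul_nonneg_right ?_ hd
        rw [hscale]; linarith
  have hint : 0 ≤ ∫ x, (g x - w x) * (ψ (x ^ 2) - (ψ u₁ + m * (x ^ 2 - u₁))) :=
    integral_nonneg hpt
  have hexp : ∀ x : ℝ, (g x - w x) * (ψ (x ^ 2) - (ψ u₁ + m * (x ^ 2 - u₁)))
      = (g x * ψ (x ^ 2) - w x * ψ (x ^ 2)) - ((ψ u₁ - m * u₁) * (g x - w x)
        + m * (g x * x ^ 2 - w x * x ^ 2)) := fun x => by ring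
  simp only [hexp] at hint
  have i1 : Integrable fun x => g x * ψ (x ^ 2) - w x * ψ (x ^ 2) := hgψ.sub hwψ
  have i2 : Integrable fun x => (ψ u₁ - m * u₁) * (g x - w x) := (hg.sub hw).const_mul _
  have i3 : Integrable fun x => m * (g x * x ^ 2 - w x * x ^ 2) := (hg2.sub hw2).const_mul _
  have i4 : Integrable fun x => (ψ u₁ - m * u₁) * (g x - w x)
      + m * (g x * x ^ 2 - w x * x ^ 2) := i2.add i3
  rw [integral_sub i1 i4, integral_add i2 i3, integral_const_mul, integral_const_mul, hD0,
    integral_sub hg2 hw2, h2, integral_sub hgψ hwψ] at hint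
  linarith

theorem integral_sq_gaussianReal (v : ℝ≥0) : ∫ x, x ^ 2 ∂gaussianReal 0 v = v := by
  have h := variance_fun_id_gaussianReal (μ := 0) (v := v)
  rwa [variance_of_integral_eq_zero (by fun_prop) (by simp)] at h

theorem integrable_sq_gaussianReal (v : ℝ≥0) : Integrable (fun x => x ^ 2) (gaussianReal 0 v) := by
  simpa using (memLp_id_gaussianReal (μ := 0) (v := v) 2).integrable_sq

theorem IsUnimodalDensity.isSubGaussianDensity {r : ℝ} {w : ℝ → ℝ} (hw : IsUnimodalDensity r w)
    {v : ℝ≥0} (hv : v ≠ 0) (hw2 : Integrable fun x => w x * x ^ 2)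
    (h2 : ∫ x, w x * x ^ 2 = v)
    (hI : ∀ u t s : ℝ, 0 ≤ u → u ≤ t → t ≤ s → gaussianPDFReal 0 v (√u) ≤ w (√u) →
      gaussianPDFReal 0 v (√s) ≤ w (√s) → gaussianPDFReal 0 v (√t) ≤ w (√t))
    {R : ℝ} (hR : ∀ u, R < u → w (√u) < gaussianPDFReal 0 v (√u)) :
    IsSubGaussianDensity r v w := by
  refine ⟨hw, hv, fun ψ hψ hwψ hgψ => ?_⟩
  have hgl := gaussianReal_eq_densityLaw hv
  have hg := isUnimodalDensity_gaussianPDFReal le_rfl hv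
  have hs := integral_sq_gaussianReal v
  have hs' := integrable_sq_gaussianReal v
  rw [hgl] at hgψ hs hs' ⊢
  rw [integrable_densityLaw hg.nonneg hg.meas] at hgψ hs'
  rw [integral_densityLaw hg.nonneg hg.meas] at hs
  rw [integrable_densityLaw hw.nonneg hw.meas] at hwψ
  rw [integral_densityLaw hg.nonneg hg.meas, integral_densityLaw hw.nonneg hw.meas]
  exact integral_convex_sq_le hw.even hg.even hw.integrable hg.integrable
    (by rw [hw.integral_eq, hg.integral_eq]) hw2 hs' (by rw [h2, hs]) hI hR hψ hwψ hgψ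

/-- The uniform density on `[-1, 1]`. -/
noncomputable def cubeDensity : ℝ → ℝ := (Icc (-1) 1).indicator fun _ => 1 / 2

theorem integral_cubeDensity_mul (f : ℝ → ℝ) :
    ∫ x, cubeDensity x * f x = (1 / 2) * ∫ x in (-1 : ℝ)..1, f x := by
  have h : (fun x => cubeDensity x * f x) = (Icc (-1) 1).indicator fun x => (1 / 2) * f x := by
    ext x
    by_cases hx : x ∈ Icc (-1 : ℝ) 1 <;> simp [cubeDensity, hx]
  rw [h, integral_indicator measurableSet_Icc, integral_Icc_eq_integral_Ioc,
    ← intervalIntegral.integral_of_le (by norm_num), intervalIntegral.integral_const_mul]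

theorem integrable_cubeDensity_mul {f : ℝ → ℝ} (hf : Continuous f) :
    Integrable fun x => cubeDensity x * f x := by
  have h : (fun x => cubeDensity x * f x) = (Icc (-1) 1).indicator fun x => (1 / 2) * f x := by
    ext x
    by_cases hx : x ∈ Icc (-1 : ℝ) 1 <;> simp [cubeDensity, hx]
  rw [h, integrable_indicator_iff measurableSet_Icc]
  exact (continuous_const.mul hf).integrableOn_Icc

theorem isUnimodalDensity_cubeDensity {r : ℝ} (hr : 0 ≤ r) : IsUnimodalDensity r cubeDensity where
  nonneg x := indicator_nonneg (fun _ _ => by norm_num) x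
  even x := by
    have : -x ∈ Icc (-1 : ℝ) 1 ↔ x ∈ Icc (-1 : ℝ) 1 := by
      simp only [mem_Icc]; constructor <;> rintro ⟨h1, h2⟩ <;> constructor <;> linarith
    by_cases hx : x ∈ Icc (-1 : ℝ) 1
    · simp only [cubeDensity, indicator_of_mem hx, indicator_of_mem (this.2 hx)]
    · simp only [cubeDensity, indicator_of_notMem hx, indicator_of_notMem (mt this.1 hx)]
  anti := by
    intro x hx y hy hxy
    have hx' : (0 : ℝ) ≤ x := hx
    by_cases hy1 : y ≤ 1
    · have h1 : x ∈ Icc (-1 : ℝ) 1 := ⟨by linarith, by linarith⟩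
      have h2 : y ∈ Icc (-1 : ℝ) 1 := ⟨by linarith, hy1⟩
      simp only [cubeDensity, indicator_of_mem h1, indicator_of_mem h2, le_refl]
    · have h2 : y ∉ Icc (-1 : ℝ) 1 := fun h => hy1 h.2
      simp only [cubeDensity, indicator_of_notMem h2]
      exact indicator_nonneg (fun _ _ => by norm_num) x
  meas := measurable_const.indicator measurableSet_Icc
  integrable := by simpa using integrable_cubeDensity_mul (f := fun _ => 1) continuous_const
  integral_eq := by
    have := integral_cubeDensity_mul fun _ => 1
    simp only [mul_one] at this
    rw [this]; norm_num
  moment := integrable_cubeDensity_mul (Continuous.rpow_const (by fun_prop) fun _ => Or.inr hr)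

/-- The variance is `1 / 3`. The Gaussian density decreases, while this one is constant on `[0, 1]`
and vanishes beyond, so the set where it dominates is convex. -/
theorem isSubGaussianDensity_cubeDensity {r : ℝ} (hr : 0 ≤ r) :
    IsSubGaussianDensity r (1 / 3) cubeDensity := by
  have hg := isUnimodalDensity_gaussianPDFReal hr (v := 1 / 3) (by norm_num)
  refine (isUnimodalDensity_cubeDensity hr).isSubGaussianDensity (by norm_num)
    (integrable_cubeDensity_mul (by fun_prop)) ?_ ?_ (R := 1) ?_
  · rw [integral_cubeDensity_mul fun x => x ^ 2, integral_pow]; norm_num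
  · intro u t s hu hut hts h1 h2
    have hs : s ≤ 1 := by
      by_contra hs
      have : √s ∉ Icc (-1 : ℝ) 1 := fun h => hs (Real.sqrt_le_one.1 h.2)
      rw [cubeDensity, indicator_of_notMem this] at h2
      exact absurd h2 (not_le.2 (gaussianPDFReal_pos 0 _ _ (by norm_num)))
    have hmem : ∀ y, y ≤ s → √y ∈ Icc (-1 : ℝ) 1 := fun y hy =>
      ⟨by linarith [Real.sqrt_nonneg y], Real.sqrt_le_one.2 (hy.trans hs)⟩
    rw [cubeDensity, indicator_of_mem (hmem t hts)]
    rw [cubeDensity, indicator_of_mem (hmem u (hut.trans hts))] at h1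
    exact (hg.anti (Real.sqrt_nonneg u) (Real.sqrt_nonneg t) (Real.sqrt_le_sqrt hut)).trans h1
  · intro u hu
    have : √u ∉ Icc (-1 : ℝ) 1 := fun h => absurd (Real.sqrt_le_one.1 h.2) (not_le.2 hu)
    rw [cubeDensity, indicator_of_notMem this]
    exact gaussianPDFReal_pos 0 _ _ (by norm_num)

/-- The probability density proportional to `exp (-|x| ^ q)`. -/
noncomputable def powerDensity (q x : ℝ) : ℝ :=
  (∫ y : ℝ, Real.exp (-|y| ^ q))⁻¹ * Real.exp (-|x| ^ q)

theorem integrable_comp_abs {f : ℝ → ℝ} (hf : IntegrableOn f (Ioi 0)) :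
    Integrable fun x => f |x| := by
  have h1 : IntegrableOn (fun x => f |x|) (Ioi 0) :=
    hf.congr_fun (fun x hx => by simp only [abs_of_pos (mem_Ioi.1 hx)]) measurableSet_Ioi
  have h2 : IntegrableOn (fun x => f |x|) (Iic 0) := by
    rw [← Measure.map_neg_eq_self (volume : Measure ℝ)]
    let m : MeasurableEmbedding fun x : ℝ => -x := (Homeomorph.neg ℝ).measurableEmbedding
    rw [m.integrableOn_map_iff]
    simp_rw [Function.comp_def, abs_neg, neg_preimage, neg_Iic, neg_zero]
    exact Iff.mpr integrableOn_Ici_iff_integrableOn_Ioi h1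
  rw [← integrableOn_univ, ← Iic_union_Ioi (a := (0 : ℝ))]
  exact h2.union h1

theorem integrable_abs_rpow_mul_exp {q s : ℝ} (hq : 0 < q) (hs : 0 ≤ s) :
    Integrable fun x : ℝ => |x| ^ s * Real.exp (-|x| ^ q) := by
  have := integrableOn_rpow_mul_exp_neg_rpow (p := q) (s := s) (by linarith) hq
  exact integrable_comp_abs this

theorem integrable_exp_neg_abs_rpow {q : ℝ} (hq : 0 < q) :
    Integrable fun x : ℝ => Real.exp (-|x| ^ q) := by
  simpa using integrable_abs_rpow_mul_exp hq le_rfl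

theorem integral_exp_neg_abs_rpow_pos {q : ℝ} (hq : 0 < q) :
    0 < ∫ x : ℝ, Real.exp (-|x| ^ q) :=
  integral_exp_pos (integrable_exp_neg_abs_rpow hq)

theorem isUnimodalDensity_powerDensity {q r : ℝ} (hq : 0 < q) (hr : 0 ≤ r) :
    IsUnimodalDensity r (powerDensity q) where
  nonneg x := mul_nonneg (inv_nonneg.2 (integral_exp_neg_abs_rpow_pos hq).le) (Real.exp_pos _).le
  even x := by simp [powerDensity]
  anti := by
    intro x hx y hy hxy
    have hx' : (0 : ℝ) ≤ x := hx
    have hy' : (0 : ℝ) ≤ y := hy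
    simp only [powerDensity, abs_of_nonneg hx', abs_of_nonneg hy']
    have := (integral_exp_neg_abs_rpow_pos hq).le
    gcongr
  meas := by unfold powerDensity; fun_prop
  integrable := (integrable_exp_neg_abs_rpow hq).const_mul _
  integral_eq := by
    simp only [powerDensity]
    rw [integral_const_mul, inv_mul_cancel₀ (integral_exp_neg_abs_rpow_pos hq).ne']
  moment := by
    simp only [powerDensity]
    have h1 := ((integrable_exp_neg_abs_rpow hq).add (integrable_abs_rpow_mul_exp hq hr)).const_mul
      (2 ^ r * (∫ y : ℝ, Real.exp (-|y| ^ q))⁻¹)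
    refine h1.mono' (by fun_prop) (Filter.Eventually.of_forall fun s => ?_)
    have hZ := inv_nonneg.2 (integral_exp_neg_abs_rpow_pos hq).le
    set Z := (∫ y : ℝ, Real.exp (-|y| ^ q))⁻¹
    rw [Real.norm_of_nonneg (by positivity)]
    have key := weight_le hr s
    calc Z * Real.exp (-|s| ^ q) * (1 + |s|) ^ r
        ≤ Z * Real.exp (-|s| ^ q) * (2 ^ r * (1 + |s| ^ r)) := by gcongr
      _ = _ := by simp only [Pi.add_apply]; ring

theorem integrable_powerDensity_mul_sq {q : ℝ} (hq : 0 < q) :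
    Integrable fun x => powerDensity q x * x ^ 2 := by
  have := (integrable_abs_rpow_mul_exp hq (show (0 : ℝ) ≤ 2 by norm_num)).const_mul
    (∫ y : ℝ, Real.exp (-|y| ^ q))⁻¹
  refine this.congr (Filter.Eventually.of_forall fun x => ?_)
  simp only [powerDensity, Real.rpow_two, sq_abs]
  ring

theorem powerDensity_two : powerDensity 2 = gaussianPDFReal 0 (1 / 2) := by
  ext x
  have h : ∫ y : ℝ, Real.exp (-|y| ^ (2 : ℝ)) = √Real.pi := by
    have := integral_gaussian 1
    simpa using this
  rw [powerDensity, h, gaussianPDFReal_def]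
  simp only [Real.rpow_two, sq_abs, sub_zero]
  congr 1
  · congr 2; push_cast; ring
  · congr 1; push_cast; ring

/-- With `v` the variance of the density itself, the logarithm of the ratio of Gaussian to power
density at `√u` is `u ^ (q / 2) - u / (2 v)` up to a constant. It is convex in `u`, so its sublevel
sets are intervals. The case `q = 2` is separate: there the densities coincide and the strict
domination at infinity fails. -/
theorem exists_isSubGaussianDensity_powerDensity {q : ℝ} (hq : 2 ≤ q) :
    ∃ v : ℝ≥0, ∀ r, 0 ≤ r → IsSubGaussianDensity r v (powerDensity q) := by
  have hq0 : 0 < q := by linarith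
  rcases hq.eq_or_lt with rfl | hq2
  · refine ⟨1 / 2, fun r hr => ⟨isUnimodalDensity_powerDensity hq0 hr, by norm_num, ?_⟩⟩
    intro ψ _ _ _
    rw [powerDensity_two, gaussianReal_eq_densityLaw (by norm_num)]
  have hwpos : ∀ x, 0 < powerDensity q x := fun x =>
    mul_pos (inv_pos.2 (integral_exp_neg_abs_rpow_pos hq0)) (Real.exp_pos _)
  have hvpos : 0 < ∫ x, powerDensity q x * x ^ 2 := by
    rw [integral_pos_iff_support_of_nonneg (fun x => mul_nonneg (hwpos x).le (sq_nonneg x))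
      (integrable_powerDensity_mul_sq hq0)]
    have : Function.support (fun x => powerDensity q x * x ^ 2) = {0}ᶜ := by
      ext x; simp [(hwpos x).ne']
    rw [this, ← Measure.restrict_apply_univ, restrict_compl_singleton]
    simp
  refine ⟨⟨_, hvpos.le⟩, fun r hr => ?_⟩
  set v : ℝ≥0 := ⟨∫ x, powerDensity q x * x ^ 2, hvpos.le⟩ with hv
  have hv0 : v ≠ 0 := fun h => hvpos.ne' (congrArg NNReal.toReal h)
  have hv1 : (0 : ℝ) < v := hvpos
  set Z := (∫ y : ℝ, Real.exp (-|y| ^ q))⁻¹ with hZ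
  have hZpos : 0 < Z := inv_pos.2 (integral_exp_neg_abs_rpow_pos hq0)
  set c : ℝ := Real.log Z - Real.log (√(2 * Real.pi * v))⁻¹ with hc
  have hiff : ∀ u, 0 ≤ u → (gaussianPDFReal 0 v (√u) ≤ powerDensity q (√u) ↔
      u ^ (q / 2) + -(u / (2 * v)) ≤ c) := by
    intro u hu
    have hs : 0 < √(2 * Real.pi * v) := Real.sqrt_pos.2 (by positivity)
    have e1 : gaussianPDFReal 0 v (√u)
        = Real.exp (Real.log (√(2 * Real.pi * v))⁻¹ + -u / (2 * v)) := by
      rw [Real.exp_add, Real.exp_log (inv_pos.2 hs), gaussianPDFReal_def]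
      simp only [sub_zero, Real.sq_sqrt hu]
    have e2 : powerDensity q (√u) = Real.exp (Real.log Z + -u ^ (q / 2)) := by
      rw [Real.exp_add, Real.exp_log hZpos, powerDensity, abs_of_nonneg (Real.sqrt_nonneg u),
        Real.sqrt_eq_rpow, ← Real.rpow_mul hu]
      congr 4; ring
    rw [e1, e2, Real.exp_le_exp, hc, neg_div]
    constructor <;> intro h <;> linarith
  have hconv : ConvexOn ℝ (Ici 0) fun u : ℝ => u ^ (q / 2) + -(u / (2 * v)) := by
    refine (convexOn_rpow (by linarith)).add ?_
    have := ((LinearMap.lsmul ℝ ℝ (-(1 / (2 * v : ℝ)))).convexOn (convex_Ici (0 : ℝ)))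
    refine this.congr fun u _ => ?_
    simp only [LinearMap.lsmul_apply, smul_eq_mul]; ring
  -- Once `u ^ (q / 2 - 1) ≥ k`, one has `u ^ (q / 2) ≥ u / (2 v) + u`, so the log-ratio exceeds `c`
  -- as soon as also `u > c`.
  set k : ℝ := 1 / (2 * v) + 1 with hk
  have hk1 : 1 ≤ k := by have : 0 ≤ 1 / (2 * (v : ℝ)) := by positivity
                         linarith
  refine (isUnimodalDensity_powerDensity hq0 hr).isSubGaussianDensity hv0
    (integrable_powerDensity_mul_sq hq0) rfl ?_ (R := max c (k ^ (q / 2 - 1)⁻¹)) ?_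
  · intro u t s hu hut hts h1 h2
    have ht := hu.trans hut
    have hs := ht.trans hts
    rw [hiff _ hu] at h1
    rw [hiff _ hs] at h2
    rw [hiff _ ht]
    exact ((hconv.convex_le c).ordConnected.out ⟨hu, h1⟩ ⟨hs, h2⟩ ⟨hut, hts⟩).2
  · intro u hu
    have hkpos : 0 < k ^ (q / 2 - 1)⁻¹ := Real.rpow_pos_of_pos (by linarith) _
    have hcu := (le_max_left _ _).trans_lt hu
    have hku := (le_max_right _ _).trans_lt hu
    have hu0 : 0 < u := hkpos.trans hku
    rw [← not_le, hiff u hu0.le, not_le]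
    have h1 : k ≤ u ^ (q / 2 - 1) := by
      have := Real.rpow_le_rpow hkpos.le hku.le (show 0 ≤ q / 2 - 1 by linarith)
      rwa [← Real.rpow_mul (by linarith), inv_mul_cancel₀ (by linarith), Real.rpow_one] at this
    have h2 : u ^ (q / 2) = u ^ (q / 2 - 1) * u := by
      rw [← Real.rpow_add_one hu0.ne']; congr 1; ring
    rw [h2]
    have h3 := mul_le_mul_of_nonneg_right h1 hu0.le
    have h4 : k * u = u / (2 * v) + u := by rw [hk]; ring
    linarith

end Khintchine

namespace Khintchine

open Set ProbabilityTheory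
open scoped NNReal

/-! ### Marginals of log-concave functions -/

/-- Brunn–Minkowski for bounded intervals: every point strictly between the combined infima and the
combined suprema is a combination of a point of `P` and a point of `Q`. -/
theorem volume_combination_le {P Q S : Set ℝ} (hP : P.OrdConnected) (hQ : Q.OrdConnected)
    (hPne : P.Nonempty) (hQne : Q.Nonempty) {R : ℝ} (hPR : P ⊆ Icc (-R) R) (hQR : Q ⊆ Icc (-R) R)
    {l m : ℝ} (hl : 0 < l) (hm : 0 < m) (hlm : l + m = 1)
    (hS : ∀ x ∈ P, ∀ y ∈ Q, l * x + m * y ∈ S) :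
    ENNReal.ofReal l * volume P + ENNReal.ofReal m * volume Q ≤ volume S := by
  have hPb : BddBelow P := ⟨-R, fun x hx => (hPR hx).1⟩
  have hPa : BddAbove P := ⟨R, fun x hx => (hPR hx).2⟩
  have hQb : BddBelow Q := ⟨-R, fun x hx => (hQR hx).1⟩
  have hQa : BddAbove Q := ⟨R, fun x hx => (hQR hx).2⟩
  have hvol : ∀ T : Set ℝ, BddBelow T → BddAbove T →
      volume T ≤ ENNReal.ofReal (sSup T - sInf T) := fun T h1 h2 => by
    rw [← Real.volume_Icc]
    exact measure_mono fun x hx => ⟨csInf_le h1 hx, le_csSup h2 hx⟩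
  have hsub : Ioo (l * sInf P + m * sInf Q) (l * sSup P + m * sSup Q) ⊆ S := by
    rintro z ⟨hz1, hz2⟩
    -- The same slack is allowed in `P` and in `Q`; as `l + m = 1`, the combined points stay on the
    -- correct side of `z`. Interpolating in both sets with the same parameter `s` then hits `z`.
    obtain ⟨x₁, hx₁, hx₁'⟩ := exists_lt_of_csInf_lt hPne
      (show sInf P < sInf P + (z - (l * sInf P + m * sInf Q)) by linarith)
    obtain ⟨y₁, hy₁, hy₁'⟩ := exists_lt_of_csInf_lt hQne
      (show sInf Q < sInf Q + (z - (l * sInf P + m * sInf Q)) by linarith)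
    obtain ⟨x₂, hx₂, hx₂'⟩ := exists_lt_of_lt_csSup hPne
      (show sSup P - ((l * sSup P + m * sSup Q) - z) < sSup P by linarith)
    obtain ⟨y₂, hy₂, hy₂'⟩ := exists_lt_of_lt_csSup hQne
      (show sSup Q - ((l * sSup P + m * sSup Q) - z) < sSup Q by linarith)
    have h1 : l * x₁ + m * y₁ < z := by
      have e1 := mul_lt_mul_of_pos_left hx₁' hl
      have e2 := mul_lt_mul_of_pos_left hy₁' hm
      have e3 : l * (sInf P + (z - (l * sInf P + m * sInf Q)))
        + m * (sInf Q + (z - (l * sInf P + m * sInf Q))) = l * sInf P + m * sInf Q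
        + (l + m) * (z - (l * sInf P + m * sInf Q)) := by ring
      rw [hlm] at e3
      linarith
    have h2 : z < l * x₂ + m * y₂ := by
      have e1 := mul_lt_mul_of_pos_left hx₂' hl
      have e2 := mul_lt_mul_of_pos_left hy₂' hm
      have e3 : l * (sSup P - ((l * sSup P + m * sSup Q) - z))
        + m * (sSup Q - ((l * sSup P + m * sSup Q) - z)) = l * sSup P + m * sSup Q
        - (l + m) * ((l * sSup P + m * sSup Q) - z) := by ring
      rw [hlm] at e3
      linarith
    set A := l * x₁ + m * y₁ with hA
    set B := l * x₂ + m * y₂ with hB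
    have hAB : 0 < B - A := by linarith
    set s := (z - A) / (B - A) with hs
    have hs0 : 0 ≤ s := div_nonneg (by linarith) hAB.le
    have hs1 : s ≤ 1 := (div_le_one hAB).2 (by linarith)
    have hsz : z = A + s * (B - A) := by rw [hs, div_mul_cancel₀ _ hAB.ne']; ring
    have hconv : ∀ T : Set ℝ, T.OrdConnected → ∀ a ∈ T, ∀ b ∈ T, a + s * (b - a) ∈ T := by
      intro T hT a ha b hb
      have := hT.convex ha hb (show 0 ≤ 1 - s by linarith) hs0 (by ring)
      simp only [smul_eq_mul] at this
      convert this using 1; ring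
    have := hS _ (hconv P hP _ hx₁ _ hx₂) _ (hconv Q hQ _ hy₁ _ hy₂)
    convert this using 1
    rw [hsz, hA, hB]; ring
  calc ENNReal.ofReal l * volume P + ENNReal.ofReal m * volume Q
      ≤ ENNReal.ofReal l * ENNReal.ofReal (sSup P - sInf P)
        + ENNReal.ofReal m * ENNReal.ofReal (sSup Q - sInf Q) := by
        gcongr
        · exact hvol P hPb hPa
        · exact hvol Q hQb hQa
    _ = ENNReal.ofReal ((l * sSup P + m * sSup Q) - (l * sInf P + m * sInf Q)) := by
        have h1 := Real.sInf_le_sSup P hPb hPa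
        have h2 := Real.sInf_le_sSup Q hQb hQa
        rw [← ENNReal.ofReal_mul hl.le, ← ENNReal.ofReal_mul hm.le, ← ENNReal.ofReal_add
          (mul_nonneg hl.le (by linarith)) (mul_nonneg hm.le (by linarith))]
        congr 1; ring
    _ ≤ volume S := by rw [← Real.volume_Ioo]; exact measure_mono hsub

/-- The additive form of the Prékopa–Leindler inequality on the line, for quasi-concave functions of
supremum `1`. -/
theorem lintegral_combination_le {f g h : ℝ → ℝ} (hf0 : ∀ x, 0 ≤ f x) (hg0 : ∀ x, 0 ≤ g x)
    (hh0 : ∀ x, 0 ≤ h x) (hfm : Measurable f) (hgm : Measurable g) (hhm : Measurable h)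
    (hf1 : ∀ x, f x ≤ 1) (hg1 : ∀ x, g x ≤ 1) (hfs : ∀ t < 1, ∃ x, t < f x)
    (hgs : ∀ t < 1, ∃ x, t < g x) (hfq : ∀ t, 0 < t → {x | t < f x}.OrdConnected)
    (hgq : ∀ t, 0 < t → {x | t < g x}.OrdConnected) {R : ℝ} (hfR : ∀ x, R < |x| → f x = 0)
    (hgR : ∀ x, R < |x| → g x = 0) {l m : ℝ} (hl : 0 < l) (hm : 0 < m) (hlm : l + m = 1)
    (H : ∀ x y, f x ^ l * g y ^ m ≤ h (l * x + m * y)) :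
    ENNReal.ofReal l * (∫⁻ x, ENNReal.ofReal (f x)) + ENNReal.ofReal m * (∫⁻ x, ENNReal.ofReal (g x))
      ≤ ∫⁻ x, ENNReal.ofReal (h x) := by
  have hmeas : ∀ f : ℝ → ℝ, Measurable fun t : ℝ => volume {x | t < f x} := fun f =>
    Antitone.measurable fun s t hst => measure_mono fun x hx => lt_of_le_of_lt hst hx
  rw [lintegral_eq_lintegral_meas_lt volume (Filter.Eventually.of_forall hf0) hfm.aemeasurable,
    lintegral_eq_lintegral_meas_lt volume (Filter.Eventually.of_forall hg0) hgm.aemeasurable,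
    lintegral_eq_lintegral_meas_lt volume (Filter.Eventually.of_forall hh0) hhm.aemeasurable,
    ← lintegral_const_mul _ (hmeas f), ← lintegral_const_mul _ (hmeas g),
    ← lintegral_add_left ((hmeas f).const_mul _)]
  refine setLIntegral_mono (hmeas h) fun t ht => ?_
  have ht' : (0 : ℝ) < t := ht
  -- Below height 1 both superlevel sets are nonempty, as Brunn–Minkowski requires; this is the
  -- purpose of the normalisation of the suprema. From height 1 on, they are empty.
  by_cases ht1 : t < 1
  · have hsub : ∀ f : ℝ → ℝ, (∀ x, R < |x| → f x = 0) → {x | t < f x} ⊆ Icc (-R) R := by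
      intro f hfR x hx
      refine abs_le.1 (not_lt.1 fun hcon => ?_)
      have hx' : t < f x := hx
      rw [hfR x hcon] at hx'
      linarith
    refine volume_combination_le (hfq t ht) (hgq t ht) (hfs t ht1) (hgs t ht1) (hsub f hfR)
      (hsub g hgR) hl hm hlm fun x hx y hy => lt_of_lt_of_le ?_ (H x y)
    calc t = t ^ l * t ^ m := by rw [← Real.rpow_add ht', hlm, Real.rpow_one]
      _ < f x ^ l * g y ^ m := mul_lt_mul'' (Real.rpow_lt_rpow ht'.le hx hl)
        (Real.rpow_lt_rpow ht'.le hy hm) (by positivity) (by positivity)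
  · have hempty : ∀ f : ℝ → ℝ, (∀ x, f x ≤ 1) → {x | t < f x} = ∅ := fun f hf => by
      ext x
      simp only [mem_ofPred_eq, mem_empty_iff_false, iff_false, not_lt]
      exact (hf x).trans (not_lt.1 ht1)
    rw [hempty f hf1, hempty g hg1]
    simp

/-- The Prékopa–Leindler inequality on the line, for bounded quasi-concave functions of bounded
support. -/
theorem integral_rpow_mul_integral_rpow_le {f g h : ℝ → ℝ} (hf0 : ∀ x, 0 ≤ f x)
    (hg0 : ∀ x, 0 ≤ g x) (hh0 : ∀ x, 0 ≤ h x) (hfi : Integrable f) (hgi : Integrable g)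
    (hhi : Integrable h) (hfm : Measurable f) (hgm : Measurable g) (hhm : Measurable h) {C : ℝ}
    (hf1 : ∀ x, f x ≤ C) (hg1 : ∀ x, g x ≤ C) (hfq : ∀ t, 0 < t → {x | t < f x}.OrdConnected)
    (hgq : ∀ t, 0 < t → {x | t < g x}.OrdConnected) {R : ℝ} (hfR : ∀ x, R < |x| → f x = 0)
    (hgR : ∀ x, R < |x| → g x = 0) {l m : ℝ} (hl : 0 < l) (hm : 0 < m) (hlm : l + m = 1)
    (H : ∀ x y, f x ^ l * g y ^ m ≤ h (l * x + m * y)) :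
    (∫ x, f x) ^ l * (∫ x, g x) ^ m ≤ ∫ x, h x := by
  have hsup : ∀ f : ℝ → ℝ, (∀ x, 0 ≤ f x) → (∀ x, f x ≤ C) → 0 < ∫ x, f x →
      ∃ A, 0 < A ∧ (∀ x, f x ≤ A) ∧ ∀ t < A, ∃ x, t < f x := by
    intro f hf0 hfC hpos
    have hb : BddAbove (range f) := ⟨C, by rintro _ ⟨x, rfl⟩; exact hfC x⟩
    refine ⟨sSup (range f), ?_, fun x => le_csSup hb ⟨x, rfl⟩, fun t ht => ?_⟩
    · by_contra hcon
      have : ∀ x, f x = 0 := fun x =>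
        le_antisymm ((le_csSup hb ⟨x, rfl⟩).trans (not_lt.1 hcon)) (hf0 x)
      simp [this] at hpos
    · obtain ⟨_, ⟨x, rfl⟩, hx⟩ := exists_lt_of_lt_csSup (range_nonempty f) ht
      exact ⟨x, hx⟩
  have hF : 0 ≤ ∫ x, f x := integral_nonneg hf0
  have hG : 0 ≤ ∫ x, g x := integral_nonneg hg0
  have hH : 0 ≤ ∫ x, h x := integral_nonneg hh0
  rcases hF.eq_or_lt with hFz | hFp
  · rw [← hFz, Real.zero_rpow hl.ne', zero_mul]; exact hH
  rcases hG.eq_or_lt with hGz | hGp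
  · rw [← hGz, Real.zero_rpow hm.ne', mul_zero]; exact hH
  obtain ⟨A, hA, hfA, hfs⟩ := hsup f hf0 hf1 hFp
  obtain ⟨B, hB, hgB, hgs⟩ := hsup g hg0 hg1 hGp
  -- Dividing `f` and `g` by their suprema and `h` by `D` preserves the hypothesis; the weighted
  -- AM–GM inequality then turns the additive form into the multiplicative one.
  set D := A ^ l * B ^ m with hD
  have hDpos : 0 < D := by positivity
  have hlev : ∀ (f : ℝ → ℝ) (A : ℝ), 0 < A → ∀ t, {x | t < f x / A} = {x | t * A < f x} :=
    fun f A hA t => by ext x; simp only [mem_ofPred_eq, lt_div_iff₀ hA]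
  have key := lintegral_combination_le (f := fun x => f x / A) (g := fun x => g x / B)
    (h := fun x => h x / D) (fun x => div_nonneg (hf0 x) hA.le) (fun x => div_nonneg (hg0 x) hB.le)
    (fun x => div_nonneg (hh0 x) hDpos.le) (hfm.div_const _) (hgm.div_const _) (hhm.div_const _)
    (fun x => (div_le_one hA).2 (hfA x)) (fun x => (div_le_one hB).2 (hgB x))
    (fun t ht => by
      obtain ⟨x, hx⟩ := hfs (t * A) (by nlinarith)
      exact ⟨x, (lt_div_iff₀ hA).2 hx⟩)
    (fun t ht => by
      obtain ⟨x, hx⟩ := hgs (t * B) (by nlinarith)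
      exact ⟨x, (lt_div_iff₀ hB).2 hx⟩)
    (fun t ht => by rw [hlev f A hA]; exact hfq _ (by positivity))
    (fun t ht => by rw [hlev g B hB]; exact hgq _ (by positivity))
    (fun x hx => by rw [hfR x hx, zero_div]) (fun x hx => by rw [hgR x hx, zero_div]) hl hm hlm
    (fun x y => by
      rw [Real.div_rpow (hf0 x) hA.le, Real.div_rpow (hg0 y) hB.le, div_mul_div_comm]
      exact div_le_div_of_nonneg_right (H x y) hDpos.le)
  rw [← ofReal_integral_eq_lintegral_ofReal (hfi.div_const A)
      (Filter.Eventually.of_forall fun x => div_nonneg (hf0 x) hA.le),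
    ← ofReal_integral_eq_lintegral_ofReal (hgi.div_const B)
      (Filter.Eventually.of_forall fun x => div_nonneg (hg0 x) hB.le),
    ← ofReal_integral_eq_lintegral_ofReal (hhi.div_const D)
      (Filter.Eventually.of_forall fun x => div_nonneg (hh0 x) hDpos.le),
    ← ENNReal.ofReal_mul hl.le, ← ENNReal.ofReal_mul hm.le, integral_div, integral_div,
    integral_div, ← ENNReal.ofReal_add (by positivity) (by positivity),
    ENNReal.ofReal_le_ofReal_iff (by positivity)] at key
  have amgm := Real.geom_mean_le_arith_mean2_weighted hl.le hm.le
    (show 0 ≤ (∫ x, f x) / A by positivity) (show 0 ≤ (∫ x, g x) / B by positivity) hlm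
  rw [Real.div_rpow hF hA.le, Real.div_rpow hG hB.le, div_mul_div_comm] at amgm
  exact (div_le_div_iff_of_pos_right hDpos).1 (amgm.trans key)

/-- Nonnegative functions whose logarithm is concave. -/
structure IsLogConcave {V : Type*} [AddCommGroup V] [Module ℝ V] (F : V → ℝ) : Prop where
  nonneg : ∀ x, 0 ≤ F x
  le : ∀ x y : V, ∀ l m : ℝ, 0 < l → 0 < m → l + m = 1 → F x ^ l * F y ^ m ≤ F (l • x + m • y)

theorem IsLogConcave.ordConnected {F : ℝ → ℝ} (hF : IsLogConcave F) {t : ℝ} (ht : 0 < t) :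
    {x | t < F x}.OrdConnected := by
  refine Convex.ordConnected (convex_iff_forall_pos.2 fun x hx y hy l m hl hm hlm => ?_)
  refine lt_of_lt_of_le ?_ (hF.le x y l m hl hm hlm)
  calc t = t ^ l * t ^ m := by rw [← Real.rpow_add ht, hlm, Real.rpow_one]
    _ < F x ^ l * F y ^ m := mul_lt_mul'' (Real.rpow_lt_rpow ht.le hx hl)
      (Real.rpow_lt_rpow ht.le hy hm) (by positivity) (by positivity)

/-- For `0 ≤ x < y` the point `x` is a convex combination of `y` and `-y`, where `F` takes equal
values. -/
theorem IsLogConcave.antitoneOn {F : ℝ → ℝ} (hF : IsLogConcave F) (heven : ∀ x, F (-x) = F x) :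
    AntitoneOn F (Ici 0) := by
  intro x hx y hy hxy
  have hx' : (0 : ℝ) ≤ x := hx
  rcases hxy.eq_or_lt with rfl | hlt
  · exact le_rfl
  have hy' : 0 < y := hx'.trans_lt hlt
  have h := hF.le y (-y) ((y + x) / (2 * y)) ((y - x) / (2 * y)) (by positivity)
    (div_pos (by linarith) (by positivity)) (by field_simp; ring)
  have hz := hF.nonneg y
  have e : ((y + x) / (2 * y)) • y + ((y - x) / (2 * y)) • -y = x := by
    simp only [smul_eq_mul]; field_simp; ring
  rw [e, heven, ← Real.rpow_add_of_nonneg hz (by positivity)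
    (div_nonneg (by linarith) (by positivity))] at h
  rwa [show (y + x) / (2 * y) + (y - x) / (2 * y) = 1 by field_simp; ring, Real.rpow_one] at h

theorem integrable_of_abs_le_of_support {f : ℝ → ℝ} (hm : Measurable f) {C R : ℝ}
    (hC : ∀ x, |f x| ≤ C) (hR : ∀ x, R < |x| → f x = 0) : Integrable f := by
  have : IntegrableOn f (Icc (-R) R) :=
    Measure.integrableOn_of_bounded (M := C) (by simp) hm.aestronglyMeasurable
      (Filter.Eventually.of_forall hC)
  refine (integrableOn_iff_integrable_of_support_subset fun x hx => ?_).1 this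
  exact abs_le.1 (not_lt.1 fun hcon => hx (hR x hcon))

theorem IsLogConcave.integral_right {V : Type*} [AddCommGroup V] [Module ℝ V] [MeasurableSpace V]
    {F : V × ℝ → ℝ} (hF : IsLogConcave F) (hm : Measurable F) {C R : ℝ} (hC : ∀ z, F z ≤ C)
    (hR : ∀ v x, R < |x| → F (v, x) = 0) : IsLogConcave fun v => ∫ x, F (v, x) := by
  have hmv : ∀ v, Measurable fun x => F (v, x) := fun v => hm.comp measurable_prodMk_left
  have hi : ∀ v, Integrable fun x => F (v, x) := fun v =>
    integrable_of_abs_le_of_support (hmv v) (C := C) (R := R)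
      (fun x => by rw [abs_of_nonneg (hF.nonneg _)]; exact hC _) (hR v)
  have hsec : ∀ v, IsLogConcave fun x => F (v, x) := fun v =>
    ⟨fun x => hF.nonneg _, fun x y l m hl hm hlm => by
      have := hF.le (v, x) (v, y) l m hl hm hlm
      rwa [Prod.smul_mk, Prod.smul_mk, Prod.mk_add_mk, ← add_smul, hlm, one_smul] at this⟩
  refine ⟨fun v => integral_nonneg fun x => hF.nonneg _, fun u v l m hl hm' hlm => ?_⟩
  exact integral_rpow_mul_integral_rpow_le (fun x => hF.nonneg _) (fun x => hF.nonneg _)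
    (fun x => hF.nonneg _) (hi u) (hi v) (hi _) (hmv u) (hmv v) (hmv _) (fun x => hC _)
    (fun x => hC _) (fun t ht => (hsec u).ordConnected ht) (fun t ht => (hsec v).ordConnected ht)
    (hR u) (hR v) hl hm' hlm fun x y => hF.le (u, x) (v, y) l m hl hm' hlm

theorem integrable_of_abs_le_of_box {n : ℕ} {f : ℝ × (Fin n → ℝ) → ℝ} (hm : Measurable f)
    {C R : ℝ} (hC : ∀ z, |f z| ≤ C) (hR : ∀ z, R < |z.1| → f z = 0)
    (hR' : ∀ z i, R < |z.2 i| → f z = 0) : Integrable f := by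
  set s : Set (ℝ × (Fin n → ℝ)) := Icc (-R) R ×ˢ univ.pi fun _ => Icc (-R) R with hs
  have hfin : volume s ≠ ∞ := by
    rw [hs, Measure.volume_eq_prod, Measure.prod_prod, volume_pi, Measure.pi_pi]
    exact ENNReal.mul_ne_top (by simp) (by simp)
  have : IntegrableOn f s :=
    Measure.integrableOn_of_bounded (M := C) hfin hm.aestronglyMeasurable
      (Filter.Eventually.of_forall hC)
  refine (integrableOn_iff_integrable_of_support_subset (s := s) ?_).1 this
  refine fun z hz => ⟨?_, fun i _ => ?_⟩
  · exact abs_le.1 (not_lt.1 fun hcon => hz (hR z hcon))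
  · exact abs_le.1 (not_lt.1 fun hcon => hz (hR' z i hcon))

/-- Coordinates are integrated out one by one. The induction needs `V` arbitrary: the first
coordinate is moved into the base `V × ℝ`, the others are integrated by hypothesis, and
`integral_right` removes the one left. -/
theorem IsLogConcave.integral_pi {n : ℕ} {V : Type*} [AddCommGroup V] [Module ℝ V]
    [MeasurableSpace V] {F : V × (Fin n → ℝ) → ℝ} (hF : IsLogConcave F) (hm : Measurable F)
    {C R : ℝ} (hC : ∀ z, F z ≤ C) (hR : ∀ v x i, R < |x i| → F (v, x) = 0) :
    IsLogConcave fun v => ∫ x, F (v, x) := by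
  induction n generalizing V C with
  | zero =>
    have : ∀ v, ∫ x : Fin 0 → ℝ, F (v, x) = F (v, 0) := fun v => by
      rw [volume_pi, Measure.pi_of_empty _ (0 : Fin 0 → ℝ), integral_dirac]
    simp only [this]
    refine ⟨fun v => hF.nonneg _, fun u v l m hl hm' hlm => ?_⟩
    simpa using hF.le (u, 0) (v, 0) l m hl hm' hlm
  | succ n ih =>
    set G : (V × ℝ) × (Fin n → ℝ) → ℝ := fun z => F (z.1.1, Fin.cons z.1.2 z.2) with hG
    have hcons : Measurable fun z : ℝ × (Fin n → ℝ) => (Fin.cons z.1 z.2 : Fin (n + 1) → ℝ) := by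
      refine measurable_pi_iff.2 fun i => ?_
      refine Fin.cases ?_ (fun i => ?_) i
      · simpa using measurable_fst
      · simp only [Fin.cons_succ]
        exact (measurable_pi_apply i).comp measurable_snd
    have hGm : Measurable G := hm.comp ((measurable_fst.comp measurable_fst).prodMk
      (hcons.comp ((measurable_snd.comp measurable_fst).prodMk measurable_snd)))
    have hGl : IsLogConcave G := by
      refine ⟨fun z => hF.nonneg _, fun x y l m hl hm' hlm => ?_⟩
      have := hF.le (x.1.1, Fin.cons x.1.2 x.2) (y.1.1, Fin.cons y.1.2 y.2) l m hl hm' hlm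
      refine this.trans (le_of_eq ?_)
      simp only [hG]
      congr 1
      refine Prod.ext rfl ?_
      ext i
      refine Fin.cases ?_ (fun i => ?_) i <;> simp
    have hGR : ∀ v x i, R < |x i| → G (v, x) = 0 := fun v x i hx => hR _ _ i.succ (by simpa using hx)
    have hstep := ih hGl hGm (fun z => hC _) hGR
    have hC0 : ∀ z, |G z| ≤ C := fun z => by
      rw [abs_of_nonneg (hGl.nonneg z)]; exact hC _
    have hGmeas : Measurable fun z => ∫ x, G (z, x) :=
      (StronglyMeasurable.integral_prod_right (f := fun z x => G (z, x))
        hGm.stronglyMeasurable).measurable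
    have hbound : ∀ z, ∫ x, G (z, x) ≤ C * (volume (univ.pi fun _ : Fin n => Icc (-R) R)).toReal := by
      intro z
      have hsub : Function.support (fun x => G (z, x)) ⊆ univ.pi fun _ => Icc (-R) R :=
        fun x hx i _ => abs_le.1 (not_lt.1 fun hcon => hx (hGR z x i hcon))
      rw [← setIntegral_eq_integral_of_forall_compl_eq_zero fun x hx =>
        Function.notMem_support.1 fun h => hx (hsub h)]
      refine (le_abs_self _).trans (norm_setIntegral_le_of_norm_le_const (μ := volume)
        (f := fun x => G (z, x)) ?_ fun x _ => hC0 _)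
      rw [volume_pi, Measure.pi_pi]
      simp
    have hfin := hstep.integral_right hGmeas hbound (R := R) (fun v x hx => by
      have : ∀ y, G ((v, x), y) = 0 := fun y => hR _ _ 0 (by simpa using hx)
      simp [this])
    have heq : ∀ v, ∫ x : Fin (n + 1) → ℝ, F (v, x) = ∫ x₀, ∫ y, G ((v, x₀), y) := by
      intro v
      have hi : Integrable fun z : ℝ × (Fin n → ℝ) => G ((v, z.1), z.2) := by
        refine integrable_of_abs_le_of_box (C := C) (R := R) ?_ (fun z => hC0 _) ?_ ?_
        · exact hGm.comp (by fun_prop)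
        · exact fun z hz => hR _ _ 0 (by simpa using hz)
        · exact fun z i hz => hGR _ _ i hz
      rw [← integral_prod (fun z : ℝ × (Fin n → ℝ) => G ((v, z.1), z.2)) hi,
        ← ((volume_preserving_piFinSuccAbove (fun _ : Fin (n + 1) => ℝ) 0).symm).integral_comp']
      refine integral_congr_ae (Filter.Eventually.of_forall fun z => ?_)
      simp only [hG, MeasurableEquiv.piFinSuccAbove, Fin.insertNthEquiv_zero]
      rfl
    simp only [heq]
    exact hfin

end Khintchine

namespace Khintchine

open Set ProbabilityTheory
open scoped NNReal

/-! ### Linear functionals of uniform vectors on symmetric convex bodies -/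

theorem abs_linear_le {n : ℕ} (a : Fin n → ℝ) {x : Fin n → ℝ} (hx : ∀ i, |x i| ≤ 1) :
    |∑ i, a i * x i| ≤ ∑ i, |a i| := by
  refine (Finset.abs_sum_le_sum_abs _ _).trans (Finset.sum_le_sum fun i _ => ?_)
  rw [abs_mul]
  exact mul_le_of_le_one_right (abs_nonneg _) (hx i)

theorem IsTest.abs_le {r : ℝ} (hr : 0 ≤ r) {h : ℝ → ℝ} (hh : IsTest r h) (L : ℝ) :
    ∃ C, 0 ≤ C ∧ ∀ s, |s| ≤ L → |h s| ≤ C := by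
  obtain ⟨M, hM⟩ := hh.growth
  have hM0 : 0 ≤ M := by simpa using (abs_nonneg _).trans (hM 0)
  refine ⟨M * (1 + |L|) ^ r, by positivity, fun s hs => (hM s).trans ?_⟩
  have := hs.trans (le_abs_self L)
  gcongr

/-- The point with `j`-th coordinate determined by the value `s` of the functional `a` and by the
other coordinates. -/
noncomputable def pointOfValue {m : ℕ} (a : Fin (m + 1) → ℝ) (j : Fin (m + 1))
    (p : ℝ × (Fin m → ℝ)) : Fin (m + 1) → ℝ :=
  j.insertNth ((p.1 - ∑ i, a (j.succAbove i) * p.2 i) / a j) p.2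

theorem pointOfValue_combination {m : ℕ} (a : Fin (m + 1) → ℝ) (j : Fin (m + 1))
    (p q : ℝ × (Fin m → ℝ)) (k l : ℝ) :
    pointOfValue a j (k • p + l • q) = k • pointOfValue a j p + l • pointOfValue a j q := by
  ext i
  refine Fin.succAboveCases j ?_ (fun i => ?_) i
  · simp only [pointOfValue, Fin.insertNth_apply_same, Pi.add_apply, Pi.smul_apply, smul_eq_mul,
      Prod.fst_add, Prod.snd_add, Prod.smul_fst, Prod.smul_snd, mul_add, Finset.sum_add_distrib]
    have h : ∀ (c : ℝ) (z : Fin m → ℝ), ∑ i, a (j.succAbove i) * (c * z i)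
        = c * ∑ i, a (j.succAbove i) * z i := fun c z => by
      rw [Finset.mul_sum]; exact Finset.sum_congr rfl fun i _ => by ring
    rw [h, h]; ring
  · simp [pointOfValue]

theorem measurable_insertNth {m : ℕ} (j : Fin (m + 1)) :
    Measurable fun z : ℝ × (Fin m → ℝ) => (j.insertNth z.1 z.2 : Fin (m + 1) → ℝ) :=
  (MeasurableEquiv.piFinSuccAbove (fun _ : Fin (m + 1) => ℝ) j).symm.measurable

theorem measurable_pointOfValue {m : ℕ} (a : Fin (m + 1) → ℝ) (j : Fin (m + 1)) :
    Measurable (pointOfValue a j) := by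
  have h1 : Measurable fun p : ℝ × (Fin m → ℝ) => (p.1 - ∑ i, a (j.succAbove i) * p.2 i) / a j :=
    (measurable_fst.sub ((measurable_linear fun i => a (j.succAbove i)).comp
      measurable_snd)).div_const _
  exact (measurable_insertNth j).comp (h1.prodMk measurable_snd)

theorem linear_pointOfValue {m : ℕ} (a : Fin (m + 1) → ℝ) {j : Fin (m + 1)} (hj : a j ≠ 0)
    (p : ℝ × (Fin m → ℝ)) : ∑ i, a i * pointOfValue a j p i = p.1 := by
  rw [Fin.sum_univ_succAbove _ j]
  simp only [pointOfValue, Fin.insertNth_apply_same, Fin.insertNth_apply_succAbove]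
  field_simp
  ring

/-- A coordinate `j` with `a j ≠ 0` is traded for the value `s` of the linear form. Up to a
constant, the density of the form is then the marginal `f` of the indicator `F` of a symmetric
convex set, hence even and log-concave. -/
theorem setIntegral_linear_nonneg {n : ℕ} {K : Set (Fin n → ℝ)} (hKm : MeasurableSet K)
    (hKc : Convex ℝ K) (hKs : ∀ x ∈ K, -x ∈ K) (hK1 : ∀ x ∈ K, ∀ i, |x i| ≤ 1) (a : Fin n → ℝ)
    {r : ℝ} (hr : 0 ≤ r) {h : ℝ → ℝ} (hh : IsTest r h) : 0 ≤ ∫ x in K, h (∑ i, a i * x i) := by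
  by_cases ha : a = 0
  · simp only [ha, Pi.zero_apply, zero_mul, Finset.sum_const_zero, setIntegral_const, smul_eq_mul]
    exact mul_nonneg (by positivity) hh.zero
  obtain ⟨j, hj⟩ := Function.ne_iff.1 ha
  obtain ⟨m, rfl⟩ : ∃ m, n = m + 1 := ⟨n - 1, by have := j.pos; omega⟩
  replace hj : a j ≠ 0 := hj
  set L := ∑ i, |a i| with hL
  obtain ⟨C, hC0, hC⟩ := hh.abs_le hr L
  set b : (Fin m → ℝ) → ℝ := fun z => ∑ i, a (j.succAbove i) * z i with hb
  have hbm : Measurable b := measurable_linear _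
  set T := pointOfValue a j with hT
  set F : ℝ × (Fin m → ℝ) → ℝ := fun p => K.indicator (fun _ => 1) (T p) with hF
  have hFm : Measurable F :=
    (measurable_const.indicator hKm).comp (measurable_pointOfValue a j)
  have hF01 : ∀ p, F p = 0 ∨ (F p = 1 ∧ T p ∈ K) := fun p => by
    by_cases hp : T p ∈ K
    · right; exact ⟨indicator_of_mem hp _, hp⟩
    · left; exact indicator_of_notMem hp _
  have hFnn : ∀ p, 0 ≤ F p := fun p => indicator_nonneg (fun _ _ => zero_le_one) _
  have hF1 : ∀ p, F p ≤ 1 := fun p => indicator_le' (fun _ _ => le_rfl) (fun _ _ => zero_le_one) _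
  have hs : ∀ p, T p ∈ K → |p.1| ≤ L := fun p hp => by
    rw [← linear_pointOfValue a hj p]; exact abs_linear_le a (hK1 _ hp)
  have hz : ∀ p, T p ∈ K → ∀ i, |p.2 i| ≤ 1 := fun p hp i => by
    have := hK1 _ hp (j.succAbove i)
    rwa [hT, pointOfValue, Fin.insertNth_apply_succAbove] at this
  have hFs : ∀ p : ℝ × (Fin m → ℝ), max 1 L < |p.1| → F p = 0 := fun p hp => by
    rcases hF01 p with h0 | ⟨-, h1⟩
    · exact h0
    · exact absurd (hs p h1) (not_le.2 ((le_max_right _ _).trans_lt hp))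
  have hFz : ∀ (p : ℝ × (Fin m → ℝ)) i, max 1 L < |p.2 i| → F p = 0 := fun p i hp => by
    rcases hF01 p with h0 | ⟨-, h1⟩
    · exact h0
    · exact absurd (hz p h1 i) (not_le.2 ((le_max_left _ _).trans_lt hp))
  have hFl : IsLogConcave F := by
    refine ⟨hFnn, fun p q k l hk hl hkl => ?_⟩
    rcases hF01 p with hp | ⟨hp, hp'⟩
    · rw [hp, Real.zero_rpow hk.ne', zero_mul]; exact hFnn _
    rcases hF01 q with hq | ⟨hq, hq'⟩
    · rw [hq, Real.zero_rpow hl.ne', mul_zero]; exact hFnn _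
    have : T (k • p + l • q) ∈ K := by
      rw [hT, pointOfValue_combination]
      exact hKc hp' hq' hk.le hl.le hkl
    rw [hp, hq, Real.one_rpow, Real.one_rpow, one_mul]
    simp only [hF, indicator_of_mem this, le_refl]
  have hFe : ∀ p, F (-p) = F p := fun p => by
    have h1 : T (-p) = -T p := by
      have := pointOfValue_combination a j p 0 (-1) 0
      simpa using this
    have h2 : -T p ∈ K ↔ T p ∈ K := ⟨fun h => by simpa using hKs _ h, hKs _⟩
    simp only [hF, h1]
    by_cases hp : T p ∈ K
    · rw [indicator_of_mem hp, indicator_of_mem (h2.2 hp)]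
    · rw [indicator_of_notMem hp, indicator_of_notMem (mt h2.1 hp)]
  set f : ℝ → ℝ := fun s => ∫ z, F (s, z) with hf
  have hfl : IsLogConcave f := hFl.integral_pi hFm hF1 fun v x i hi => hFz (v, x) i hi
  have hfe : ∀ s, f (-s) = f s := fun s => by
    simp only [hf]
    rw [← integral_neg_eq_self]
    exact integral_congr_ae (Filter.Eventually.of_forall fun z => hFe (s, z))
  have hFi : Integrable F :=
    integrable_of_abs_le_of_box hFm (fun p => by rw [abs_of_nonneg (hFnn p)]; exact hF1 p) hFs hFz
  have hΦi : Integrable fun p : ℝ × (Fin m → ℝ) => F p * h p.1 := by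
    refine integrable_of_abs_le_of_box (C := C) (hFm.mul (hh.meas.comp measurable_fst)) (fun p => ?_)
      (fun p hp => by rw [hFs p hp, zero_mul]) (fun p i hp => by rw [hFz p i hp, zero_mul])
    rcases hF01 p with hp | ⟨hp, hp'⟩
    · simpa [hp] using hC0
    · rw [hp, one_mul]; exact hC _ (hs p hp')
  have hmain : 0 ≤ ∫ s, f s * h s := by
    refine integral_mul_nonneg_of_even_antitone hfl.nonneg hfe (hfl.antitoneOn hfe) ?_ ?_ hh.meas ?_
      hh.sym
    · exact (StronglyMeasurable.integral_prod_right (f := fun s z => F (s, z))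
        hFm.stronglyMeasurable).measurable
    · exact hFi.integral_prod_left
    · refine hΦi.integral_prod_left.congr (Filter.Eventually.of_forall fun s => ?_)
      simp only [hf, integral_mul_const]
  -- The substitution `s = a j * y + b z` at fixed `z`, with Jacobian `|(a j)⁻¹|`.
  have hscale : ∀ z, ∫ y, K.indicator (fun _ => (1 : ℝ)) (j.insertNth y z) * h (a j * y + b z)
      = |(a j)⁻¹| * ∫ s, F (s, z) * h s := by
    intro z
    have h1 := Measure.integral_comp_mul_left
      (fun s => F (s + b z, z) * h (s + b z)) (a j)
    rw [integral_add_right_eq_self fun s => F (s, z) * h s] at h1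
    rw [← smul_eq_mul |(a j)⁻¹|, ← h1]
    refine integral_congr_ae (Filter.Eventually.of_forall fun y => ?_)
    simp only [hF, hT, pointOfValue, hb]
    rw [add_sub_cancel_right, mul_div_cancel_left₀ _ hj]
  have hΨi : Integrable fun p : ℝ × (Fin m → ℝ) =>
      K.indicator (fun _ => (1 : ℝ)) (j.insertNth p.1 p.2) * h (a j * p.1 + b p.2) := by
    refine integrable_of_abs_le_of_box (C := C) (R := 1) ?_ (fun p => ?_) (fun p hp => ?_)
      (fun p i hp => ?_)
    · exact ((measurable_const.indicator hKm).comp (measurable_insertNth j)).mul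
        (hh.meas.comp ((measurable_fst.const_mul _).add (hbm.comp measurable_snd)))
    · by_cases hp : j.insertNth p.1 p.2 ∈ K
      · rw [indicator_of_mem hp, one_mul]
        refine hC _ ?_
        have h1 := abs_linear_le a (hK1 _ hp)
        rw [Fin.sum_univ_succAbove _ j] at h1
        simpa only [Fin.insertNth_apply_same, Fin.insertNth_apply_succAbove] using h1
      · rw [indicator_of_notMem hp, zero_mul, abs_zero]; exact hC0
    · rw [indicator_of_notMem, zero_mul]
      intro hmem
      have := hK1 _ hmem j
      rw [Fin.insertNth_apply_same] at this
      linarith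
    · rw [indicator_of_notMem, zero_mul]
      intro hmem
      have := hK1 _ hmem (j.succAbove i)
      rw [Fin.insertNth_apply_succAbove] at this
      linarith
  have hprod : ∫ x in K, h (∑ i, a i * x i) = ∫ p : ℝ × (Fin m → ℝ),
      K.indicator (fun _ => (1 : ℝ)) (j.insertNth p.1 p.2) * h (a j * p.1 + b p.2) := by
    rw [← integral_indicator hKm,
      ← ((volume_preserving_piFinSuccAbove (fun _ : Fin (m + 1) => ℝ) j).symm).integral_comp']
    refine integral_congr_ae (Filter.Eventually.of_forall fun p => ?_)
    change K.indicator (fun x => h (∑ i, a i * x i)) (j.insertNth p.1 p.2)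
      = K.indicator (fun _ => (1 : ℝ)) (j.insertNth p.1 p.2) * h (a j * p.1 + b p.2)
    by_cases hp : j.insertNth p.1 p.2 ∈ K
    · rw [indicator_of_mem hp, indicator_of_mem hp, one_mul, Fin.sum_univ_succAbove _ j]
      simp only [Fin.insertNth_apply_same, Fin.insertNth_apply_succAbove, hb]
    · rw [indicator_of_notMem hp, indicator_of_notMem hp, zero_mul]
  rw [hprod, Measure.volume_eq_prod, integral_prod_symm _ hΨi]
  simp only [hscale]
  rw [integral_const_mul, ← integral_integral_swap hΦi]
  refine mul_nonneg (abs_nonneg _) ?_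
  simp only [integral_mul_const]
  exact hmain

theorem isUnimodal_linear {n : ℕ} {K : Set (Fin n → ℝ)} (hKm : MeasurableSet K)
    (hKc : Convex ℝ K) (hKs : ∀ x ∈ K, -x ∈ K) (hK1 : ∀ x ∈ K, ∀ i, |x i| ≤ 1)
    (hK0 : volume K ≠ 0) (hKt : volume K ≠ ∞) (a : Fin n → ℝ) {r : ℝ} (hr : 0 ≤ r) :
    IsUnimodal r ((ProbabilityTheory.cond volume K).map fun x => ∑ i, a i * x i) := by
  have hm := measurable_linear a
  have := cond_isProbabilityMeasure_of_finite hK0 hKt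
  constructor
  · rw [integrable_map_measure (measurable_weight r).aestronglyMeasurable hm.aemeasurable]
    refine Integrable.of_bound ((measurable_weight r).comp hm).aestronglyMeasurable
      ((1 + ∑ i, |a i|) ^ r) ?_
    refine (ae_cond_mem hKm).mono fun x hx => ?_
    rw [Function.comp, Real.norm_of_nonneg (by positivity)]
    exact Real.rpow_le_rpow (by positivity) (by linarith [abs_linear_le a (hK1 x hx)]) hr
  · intro h hh
    rw [integral_map hm.aemeasurable hh.meas.aestronglyMeasurable, ProbabilityTheory.cond, integral_smul_measure]
    exact smul_nonneg ENNReal.toReal_nonneg (setIntegral_linear_nonneg hKm hKc hKs hK1 a hr hh)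

/-- The graph of `u ^ (p / 2)` lies on one side of its tangent at `V`; after scaling by `V` this is
Bernoulli's inequality, in its convex or concave form. -/
theorem tangent_rpow_nonneg {p y V : ℝ} (hp : 1 ≤ p) (hy : 0 ≤ y) (hV : 0 < V) :
    0 ≤ (p - 2) * (y ^ (p / 2) - V ^ (p / 2) - p / 2 * V ^ (p / 2 - 1) * (y - V)) := by
  set x := y / V - 1 with hx
  have hx1 : -1 ≤ x := by
    have : 0 ≤ y / V := by positivity
    linarith
  have hyx : y = V * (1 + x) := by rw [hx]; field_simp; ring
  have h1 : 0 ≤ 1 + x := by linarith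
  have hVp : V ^ (p / 2) = V ^ (p / 2 - 1) * V := by
    rw [← Real.rpow_add_one hV.ne']; congr 1; ring
  have hfac : y ^ (p / 2) - V ^ (p / 2) - p / 2 * V ^ (p / 2 - 1) * (y - V)
      = V ^ (p / 2) * ((1 + x) ^ (p / 2) - (1 + p / 2 * x)) := by
    rw [hyx, Real.mul_rpow hV.le h1, hVp]; ring
  have hV0 : 0 ≤ V ^ (p / 2) := by positivity
  rw [hfac]
  rcases le_total 2 p with h | h
  · refine mul_nonneg (by linarith) (mul_nonneg hV0 (sub_nonneg.2 ?_))
    exact one_add_mul_self_le_rpow_one_add hx1 (by linarith)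
  · refine mul_nonneg_of_nonpos_of_nonpos (by linarith)
      (mul_nonpos_of_nonneg_of_nonpos hV0 (sub_nonpos.2 ?_))
    exact rpow_one_add_le_one_add_mul_self hx1 (by linarith) (by linarith)

theorem integral_abs_rpow_symm {p : ℝ} (hp : 0 ≤ p) {b : ℝ} (hb : 0 ≤ b) :
    (p + 1) * ∫ s in -b..b, |s| ^ p = 2 * b * b ^ p := by
  have hi : ∀ x y, IntervalIntegrable (fun s : ℝ => |s| ^ p) volume x y :=
    fun x y => (continuous_abs_rpow hp).intervalIntegrable x y
  have h1 : ∫ s in -b..0, |s| ^ p = ∫ s in 0..b, |s| ^ p := by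
    have := intervalIntegral.integral_comp_neg (a := 0) (b := b) fun s => |s| ^ p
    simpa using this.symm
  have h2 : ∫ s in 0..b, |s| ^ p = ∫ s in 0..b, s ^ p := by
    refine intervalIntegral.integral_congr fun s hs => ?_
    rw [uIcc_of_le hb] at hs
    simp only [abs_of_nonneg hs.1]
  rw [← intervalIntegral.integral_add_adjacent_intervals (hi (-b) 0) (hi 0 b), h1, h2,
    integral_rpow (Or.inl (by linarith)), Real.zero_rpow (by linarith),
    Real.rpow_add_one' hb (by linarith)]
  have : p + 1 ≠ 0 := by linarith
  field_simp
  ring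

/-- The sharp comparison of moments for symmetric unimodal laws: the extremal law is the uniform law
on an interval. -/
theorem IsUnimodal.moment_le {p : ℝ} (hp : 1 ≤ p) {κ : Measure ℝ} [IsProbabilityMeasure κ]
    (hκ : IsUnimodal (max p 2) κ) :
    (p - 2) * (3 * ∫ s, s ^ 2 ∂κ) ^ (p / 2) ≤ (p - 2) * ((p + 1) * ∫ s, |s| ^ p ∂κ) := by
  have hle : ∀ {q : ℝ}, 0 ≤ q → q ≤ max p 2 → ∀ s : ℝ, |s| ^ q ≤ (1 + |s|) ^ max p 2 :=
    fun {q} hq0 hq s => (Real.rpow_le_rpow (abs_nonneg s) (by linarith) hq0).trans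
      (Real.rpow_le_rpow_of_exponent_le (by linarith [abs_nonneg s]) hq)
  have hlep : ∀ s : ℝ, |s| ^ p ≤ (1 + |s|) ^ max p 2 := hle (by linarith) (le_max_left _ _)
  have hle2 : ∀ s : ℝ, s ^ 2 ≤ (1 + |s|) ^ max p 2 := fun s => by
    have := hle (by norm_num) (le_max_right p 2) s
    rwa [Real.rpow_two, sq_abs] at this
  have hle0 : ∀ s : ℝ, 1 ≤ (1 + |s|) ^ max p 2 := fun s => by
    simpa using hle (q := 0) le_rfl (by positivity) s
  have hip : Integrable (fun s => |s| ^ p) κ :=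
    hκ.integrable.mono' (measurable_abs_rpow p).aestronglyMeasurable
      (Filter.Eventually.of_forall fun s => by
        rw [Real.norm_of_nonneg (by positivity)]; exact hlep s)
  have hi2 : Integrable (fun s => s ^ 2) κ :=
    hκ.integrable.mono' (by fun_prop) (Filter.Eventually.of_forall fun s => by
      rw [Real.norm_of_nonneg (by positivity)]; exact hle2 s)
  -- The uniform law on `[-√V, √V]` has the second moment of `κ`, so `V` is the point of tangency.
  set V := 3 * ∫ s, s ^ 2 ∂κ with hV
  have hV0 : 0 ≤ V := mul_nonneg (by norm_num) (integral_nonneg fun s => sq_nonneg s)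
  rcases hV0.eq_or_lt with hVz | hVp
  · have hz : ∫ s, s ^ 2 ∂κ = 0 := by linarith
    have hae := (integral_eq_zero_iff_of_nonneg (fun s => sq_nonneg s) hi2).1 hz
    have hae' : (fun s : ℝ => |s| ^ p) =ᵐ[κ] fun _ => 0 := by
      filter_upwards [hae] with s hs
      have : s = 0 := by simpa using hs
      rw [this, abs_zero, Real.zero_rpow (by linarith)]
    rw [integral_congr_ae hae', ← hVz, Real.zero_rpow (by linarith)]
    simp
  set c := p / 2 * V ^ (p / 2 - 1) with hc
  have hc0 : 0 ≤ c := by positivity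
  -- Chosen so that its mean over `[-b, b]` is the gap in the tangent inequality at `u = b ^ 2`. Its
  -- value at 0 is `(p - 2)² / 2 * V ^ (p / 2)`, and by the choice of `V` the linear term has mean 0
  -- under `κ`.
  set h : ℝ → ℝ := fun s => (p - 2) * ((p + 1) * |s| ^ p - V ^ (p / 2) - c * (3 * s ^ 2 - V))
    with hh
  have hcV : c * V = p / 2 * V ^ (p / 2) := by
    rw [hc, mul_assoc, ← Real.rpow_add_one hVp.ne']; congr 2; ring
  have hVpow : 0 ≤ V ^ (p / 2) := by positivity
  have hTest : IsTest (max p 2) h := by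
    refine ⟨by simp only [hh]; fun_prop,
      ⟨|p - 2| * ((p + 1) + V ^ (p / 2) + c * 3 + c * V), fun s => ?_⟩, ?_, fun b hb => ?_⟩
    · simp only [hh]
      rw [abs_mul, mul_assoc |p - 2|]
      refine mul_le_mul_of_nonneg_left ?_ (abs_nonneg _)
      have h1 := mul_le_mul_of_nonneg_left (hlep s) (show 0 ≤ p + 1 by linarith)
      have h2 := mul_le_mul_of_nonneg_left (hle2 s) (show 0 ≤ c * 3 by positivity)
      have h3 := mul_le_mul_of_nonneg_left (hle0 s) hVpow
      have h4 := mul_le_mul_of_nonneg_left (hle0 s) (show 0 ≤ c * V by positivity)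
      have h5 : 0 ≤ (p + 1) * |s| ^ p := mul_nonneg (by linarith) (by positivity)
      have h6 : 0 ≤ c * 3 * s ^ 2 := by positivity
      rw [abs_le]
      constructor <;> nlinarith
    · simp only [hh, abs_zero]
      rw [Real.zero_rpow (by linarith)]
      have : (p - 2) * ((p + 1) * 0 - V ^ (p / 2) - c * (3 * 0 ^ 2 - V))
          = (p - 2) ^ 2 / 2 * V ^ (p / 2) := by
        have : c * (3 * 0 ^ 2 - V) = -(p / 2 * V ^ (p / 2)) := by rw [← hcV]; ring
        rw [this]; ring
      rw [this]; positivity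
    · have i1 : IntervalIntegrable (fun s : ℝ => |s| ^ p) volume (-b) b :=
        (continuous_abs_rpow (by linarith)).intervalIntegrable _ _
      have h1 : ∫ s in -b..b, h s = 2 * b * ((p - 2) * ((b ^ 2) ^ (p / 2) - V ^ (p / 2)
          - c * (b ^ 2 - V))) := by
        simp only [hh]
        rw [intervalIntegral.integral_const_mul, intervalIntegral.integral_sub,
          intervalIntegral.integral_sub, intervalIntegral.integral_const_mul,
          integral_abs_rpow_symm (by linarith) hb.le, intervalIntegral.integral_const_mul,
          intervalIntegral.integral_sub, intervalIntegral.integral_const_mul, integral_pow,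
          intervalIntegral.integral_const, intervalIntegral.integral_const, ← Real.rpow_natCast b 2,
          ← Real.rpow_mul hb.le]
        · simp only [smul_eq_mul]
          push_cast
          rw [show (2 : ℝ) * (p / 2) = p by ring, Real.rpow_two]
          ring
        all_goals first
          | exact Continuous.intervalIntegrable (by fun_prop) _ _
          | exact i1.const_mul _
          | exact (i1.const_mul _).sub (Continuous.intervalIntegrable (by fun_prop) _ _)
      rw [h1]
      exact mul_nonneg (by positivity) (tangent_rpow_nonneg hp (sq_nonneg b) hVp)
  have hfin := hκ.nonneg h hTest
  have hcomp : ∫ s, h s ∂κ = (p - 2) * ((p + 1) * (∫ s, |s| ^ p ∂κ) - V ^ (p / 2)) := by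
    have j1 : Integrable (fun s => (p + 1) * |s| ^ p - V ^ (p / 2)) κ :=
      (hip.const_mul _).sub (integrable_const _)
    have j2 : Integrable (fun s => 3 * s ^ 2 - V) κ := (hi2.const_mul _).sub (integrable_const _)
    simp only [hh]
    rw [integral_const_mul, integral_sub j1 (j2.const_mul c), integral_sub (hip.const_mul _)
      (integrable_const _), integral_const_mul, integral_const_mul, integral_sub (hi2.const_mul _)
      (integrable_const _), integral_const_mul, ← hV]
    simp
  rw [hcomp] at hfin
  linarith

end Khintchine

namespace Khintchine

open Set ProbabilityTheory Filter Topology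
open scoped NNReal

/-! ### Product densities and uniform vectors on `ℓ_q` balls -/

theorem pi_densityLaw {w : ℝ → ℝ} (hw0 : ∀ x, 0 ≤ w x) (hwi : Integrable w)
    (n : ℕ) :
    Measure.pi (fun _ : Fin n => densityLaw w)
      = (volume : Measure (Fin n → ℝ)).withDensity fun x => ENNReal.ofReal (∏ i, w (x i)) := by
  have hfin : IsFiniteMeasure (densityLaw w) := isFiniteMeasure_withDensity_ofReal hwi.2
  refine Measure.pi_eq fun s hs => ?_
  have hmeas : MeasurableSet (univ.pi s) := MeasurableSet.univ_pi hs
  have hind : ∀ x : Fin n → ℝ, (univ.pi s).indicator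
      (fun x => ENNReal.ofReal (∏ i, w (x i))) x
        = ENNReal.ofReal (∏ i, (s i).indicator w (x i)) := by
    intro x
    by_cases hx : x ∈ univ.pi s
    · rw [indicator_of_mem hx]
      congr 1
      exact Finset.prod_congr rfl fun i _ => (indicator_of_mem (hx i (mem_univ i)) w).symm
    · rw [indicator_of_notMem hx]
      simp only [Set.mem_pi, mem_univ, true_implies, not_forall] at hx
      obtain ⟨i, hi⟩ := hx
      rw [Finset.prod_eq_zero (Finset.mem_univ i) (indicator_of_notMem hi w), ENNReal.ofReal_zero]
  have hii : ∀ i, Integrable ((s i).indicator w) := fun i => hwi.indicator (hs i)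
  have hi0 : ∀ i x, 0 ≤ (s i).indicator w x := fun i x => indicator_nonneg (fun y _ => hw0 y) x
  have hint : Integrable fun x : Fin n → ℝ => ∏ i, (s i).indicator w (x i) :=
    Integrable.fintype_prod hii
  rw [withDensity_apply _ hmeas, ← lintegral_indicator hmeas, lintegral_congr hind,
    ← ofReal_integral_eq_lintegral_ofReal hint
      (.of_forall fun x => Finset.prod_nonneg fun i _ => hi0 i (x i)),
    integral_fintype_prod_volume_eq_prod (fun i => (s i).indicator w),
    ENNReal.ofReal_prod_of_nonneg fun i _ => integral_nonneg (hi0 i)]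
  refine Finset.prod_congr rfl fun i _ => ?_
  rw [densityLaw, withDensity_apply _ (hs i), integral_indicator (hs i),
    ofReal_integral_eq_lintegral_ofReal hwi.integrableOn (.of_forall hw0)]

theorem lintegral_sumLaw_densityLaw {w : ℝ → ℝ} (hw0 : ∀ x, 0 ≤ w x) (hwm : Measurable w)
    (hwi : Integrable w) {n : ℕ} (a : Fin n → ℝ) {g : ℝ → ℝ≥0∞} (hg : Measurable g) :
    ∫⁻ t, g t ∂sumLaw (densityLaw w) a
      = ∫⁻ x : Fin n → ℝ, ENNReal.ofReal (∏ i, w (x i)) * g (∑ i, a i * x i) := by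
  rw [sumLaw, lintegral_map hg (measurable_linear a), pi_densityLaw hw0 hwi,
    lintegral_withDensity_eq_lintegral_mul _ _
      (show Measurable fun x : Fin n → ℝ => g (∑ i, a i * x i) from hg.comp (measurable_linear a))]
  · rfl
  · exact (Finset.measurable_prod _ fun i _ => hwm.comp (measurable_pi_apply i)).ennreal_ofReal

theorem lintegral_comp_smul_pi {n : ℕ} {c : ℝ} (hc : 0 < c) {g : (Fin n → ℝ) → ℝ≥0∞}
    (hg : Measurable g) :
    ∫⁻ x, g x = ENNReal.ofReal (c ^ n) * ∫⁻ x, g (c • x) := by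
  rw [← lintegral_map hg (measurable_const_smul c), Measure.map_addHaar_smul _ hc.ne',
    lintegral_smul_measure, Module.finrank_fin_fun, smul_eq_mul, ← mul_assoc,
    ← ENNReal.ofReal_mul (by positivity), abs_of_pos (by positivity), mul_inv_cancel₀ (by positivity),
    ENNReal.ofReal_one, one_mul]

theorem lintegral_exp_neg_Ici (c : ℝ) :
    ∫⁻ t in Ici c, ENNReal.ofReal (Real.exp (-t)) = ENNReal.ofReal (Real.exp (-c)) := by
  rw [setLIntegral_congr Ioi_ae_eq_Ici.symm, ← ofReal_integral_eq_lintegral_ofReal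
    (integrableOn_exp_neg_Ioi c) (.of_forall fun t => (Real.exp_pos _).le), integral_exp_neg_Ioi]

/-- Integration of a homogeneous function against `exp (-N)`, for a homogeneous gauge `N`. -/
theorem lintegral_exp_neg_gauge_mul {n : ℕ} {N : (Fin n → ℝ) → ℝ} {φ : (Fin n → ℝ) → ℝ≥0∞}
    {s r : ℝ} (hs : 0 < s) (hr : 0 ≤ r) (hN : Measurable N) (hN0 : ∀ x, 0 ≤ N x)
    (hNs : ∀ c x, 0 < c → N (c • x) = c ^ s * N x) (hφ : Measurable φ)
    (hφr : ∀ c x, 0 < c → φ (c • x) = ENNReal.ofReal (c ^ r) * φ x) :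
    ∫⁻ x, ENNReal.ofReal (Real.exp (-N x)) * φ x
      = ENNReal.ofReal (Real.Gamma ((n + r) / s + 1)) * ∫⁻ x in {x | N x ≤ 1}, φ x := by
  have hK : MeasurableSet {x | N x ≤ 1} := measurableSet_le hN measurable_const
  -- Dilation by `t ^ (1 / s)` maps the unit ball onto `{N ≤ t}`: the Jacobian contributes `t ^ (n /
  -- s)` and the homogeneity of `φ` contributes `t ^ (r / s)`.
  have hinner : ∀ t : ℝ, 0 < t → ∫⁻ x in {x | N x ≤ t}, φ x
      = ENNReal.ofReal (t ^ ((n + r) / s)) * ∫⁻ x in {x | N x ≤ 1}, φ x := by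
    intro t ht
    have hc : 0 < t ^ (1 / s) := Real.rpow_pos_of_pos ht _
    have hcs : (t ^ (1 / s)) ^ s = t := by
      rw [← Real.rpow_mul ht.le, one_div_mul_cancel hs.ne', Real.rpow_one]
    rw [← lintegral_indicator (measurableSet_le hN measurable_const), lintegral_comp_smul_pi hc
      (hφ.indicator (measurableSet_le hN measurable_const)), ← lintegral_indicator hK]
    have : ∀ x, {x | N x ≤ t}.indicator φ (t ^ (1 / s) • x)
        = ENNReal.ofReal ((t ^ (1 / s)) ^ r) * {x | N x ≤ 1}.indicator φ x := by
      intro x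
      have hiff : t ^ (1 / s) • x ∈ {x | N x ≤ t} ↔ x ∈ {x | N x ≤ 1} := by
        simp only [mem_ofPred_eq, hNs _ x hc, hcs]
        exact ⟨fun h => by nlinarith, fun h => by nlinarith⟩
      by_cases hx : x ∈ {x | N x ≤ 1}
      · rw [indicator_of_mem hx, indicator_of_mem (hiff.2 hx), hφr _ x hc]
      · rw [indicator_of_notMem hx, indicator_of_notMem (fun h => hx (hiff.1 h)), mul_zero]
    rw [lintegral_congr this, lintegral_const_mul _ (hφ.indicator hK), ← mul_assoc,
      ← ENNReal.ofReal_mul (by positivity)]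
    congr 2
    rw [← Real.rpow_natCast, ← Real.rpow_mul ht.le, ← Real.rpow_mul ht.le, ← Real.rpow_add ht]
    congr 1
    field_simp
  -- Since `exp (-N x)` is the integral of `exp (-t)` over `t ≥ N x`, exchanging integrals leaves
  -- the Gamma integral of `exp (-t) * t ^ ((n + r) / s)`.
  have hexp : ∀ x, ENNReal.ofReal (Real.exp (-N x)) * φ x
      = ∫⁻ t in Ioi 0, ENNReal.ofReal (Real.exp (-t)) * {x | N x ≤ t}.indicator φ x := by
    intro x
    have h1 : ∀ t, ENNReal.ofReal (Real.exp (-t)) * {x | N x ≤ t}.indicator φ x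
        = (Ici (N x)).indicator (fun t => ENNReal.ofReal (Real.exp (-t))) t * φ x := by
      intro t
      by_cases ht : N x ≤ t
      · rw [indicator_of_mem (show x ∈ {x | N x ≤ t} from ht),
          indicator_of_mem (show t ∈ Ici (N x) from ht)]
      · rw [indicator_of_notMem (show x ∉ {x | N x ≤ t} from ht),
          indicator_of_notMem (show t ∉ Ici (N x) from ht), mul_zero, zero_mul]
    have hm : Measurable fun t : ℝ => ENNReal.ofReal (Real.exp (-t)) := by fun_prop
    rw [lintegral_congr h1, lintegral_mul_const _ (hm.indicator measurableSet_Ici),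
      setLIntegral_congr Ioi_ae_eq_Ici, lintegral_indicator measurableSet_Ici,
      Measure.restrict_restrict measurableSet_Ici,
      inter_eq_left.2 (Ici_subset_Ici.2 (hN0 x)), lintegral_exp_neg_Ici]
  rw [lintegral_congr hexp, lintegral_lintegral_swap]
  · have h2 : ∀ t ∈ Ioi (0 : ℝ),
        ∫⁻ x, ENNReal.ofReal (Real.exp (-t)) * {x | N x ≤ t}.indicator φ x
          = ENNReal.ofReal (Real.exp (-t) * t ^ ((n + r) / s + 1 - 1))
            * ∫⁻ x in {x | N x ≤ 1}, φ x := by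
      intro t ht
      have hKt : MeasurableSet {x | N x ≤ t} := measurableSet_le hN measurable_const
      rw [lintegral_const_mul _ (hφ.indicator hKt), lintegral_indicator hKt, hinner t ht,
        ← mul_assoc, ← ENNReal.ofReal_mul (Real.exp_pos _).le, add_sub_cancel_right]
    have hpos : 0 < (n + r) / s + 1 := by positivity
    rw [setLIntegral_congr_fun measurableSet_Ioi h2, lintegral_mul_const _ (by fun_prop),
      Real.Gamma_eq_integral hpos, ofReal_integral_eq_lintegral_ofReal
        (Real.GammaIntegral_convergent hpos)]
    filter_upwards [ae_restrict_mem measurableSet_Ioi] with t ht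
    exact mul_nonneg (Real.exp_pos _).le (Real.rpow_nonneg (mem_Ioi.1 ht).le _)
  · refine Measurable.aemeasurable ?_
    have hS : MeasurableSet {z : (Fin n → ℝ) × ℝ | N z.1 ≤ z.2} :=
      measurableSet_le (hN.comp measurable_fst) measurable_snd
    have : (Function.uncurry fun x (t : ℝ) => ENNReal.ofReal (Real.exp (-t))
        * {x | N x ≤ t}.indicator φ x) = fun z : (Fin n → ℝ) × ℝ =>
          ENNReal.ofReal (Real.exp (-z.2)) * {z : (Fin n → ℝ) × ℝ | N z.1 ≤ z.2}.indicator
            (fun z => φ z.1) z := by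
      ext z
      rfl
    rw [this]
    exact (by fun_prop : Measurable fun z : (Fin n → ℝ) × ℝ => ENNReal.ofReal (Real.exp (-z.2))).mul
      ((hφ.comp measurable_fst).indicator hS)

/-! ### Geometry of the `ℓ_q` balls and their product models -/

theorem unitBall_top (n : ℕ) : unitBall ∞ n = {x | ∀ i, |x i| ≤ 1} := if_pos rfl

theorem unitBall_of_ne_top {q : ℝ≥0∞} (hq : q ≠ ∞) (n : ℕ) :
    unitBall q n = {x | ∑ i, |x i| ^ q.toReal ≤ 1} := if_neg hq

theorem measurableSet_unitBall (q : ℝ≥0∞) (n : ℕ) : MeasurableSet (unitBall q n) := by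
  rw [unitBall]
  split_ifs
  · rw [ofPred_forall]
    exact MeasurableSet.iInter fun i => measurableSet_le (by fun_prop) measurable_const
  · exact measurableSet_le (by fun_prop) measurable_const

theorem abs_le_one_of_mem_unitBall {q : ℝ≥0∞} (hq : 2 ≤ q) {n : ℕ} {x : Fin n → ℝ}
    (hx : x ∈ unitBall q n) (i : Fin n) : |x i| ≤ 1 := by
  rw [unitBall] at hx
  split_ifs at hx with h
  · exact hx i
  · have hpos : 0 < q.toReal := ENNReal.toReal_pos (by rintro rfl; simp at hq) h
    have h1 : |x i| ^ q.toReal ≤ 1 := (Finset.single_le_sum (f := fun i => |x i| ^ q.toReal)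
      (fun j _ => Real.rpow_nonneg (abs_nonneg _) _) (Finset.mem_univ i)).trans hx
    by_contra hlt
    exact absurd h1 (not_le.2 (Real.one_lt_rpow (not_le.1 hlt) hpos))

theorem neg_mem_unitBall {q : ℝ≥0∞} {n : ℕ} {x : Fin n → ℝ} (hx : x ∈ unitBall q n) :
    -x ∈ unitBall q n := by
  rw [unitBall] at hx ⊢
  split_ifs at hx ⊢ with h
  · simpa using hx
  · simpa using hx

theorem two_le_toReal {q : ℝ≥0∞} (hq : 2 ≤ q) (hqt : q ≠ ∞) : 2 ≤ q.toReal := by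
  simpa using ENNReal.toReal_mono hqt hq

theorem convex_unitBall {q : ℝ≥0∞} (hq : 2 ≤ q) (n : ℕ) : Convex ℝ (unitBall q n) := by
  by_cases h : q = ∞
  · subst h
    rw [unitBall_top]
    intro x hx y hy s t hs ht hst i
    calc |s * x i + t * y i| ≤ |s * x i| + |t * y i| := abs_add_le _ _
      _ = s * |x i| + t * |y i| := by rw [abs_mul, abs_mul, abs_of_nonneg hs, abs_of_nonneg ht]
      _ ≤ s * 1 + t * 1 := by gcongr <;> [exact hx i; exact hy i]
      _ = 1 := by linarith
  · rw [unitBall_of_ne_top h]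
    have h2 := two_le_toReal hq h
    intro x hx y hy s t hs ht hst
    have key : ∀ i, |s * x i + t * y i| ^ q.toReal
        ≤ s * |x i| ^ q.toReal + t * |y i| ^ q.toReal := by
      intro i
      have hc := (convexOn_rpow (by linarith : 1 ≤ q.toReal)).2 (mem_Ici.2 (abs_nonneg (x i)))
        (mem_Ici.2 (abs_nonneg (y i))) hs ht hst
      refine le_trans (Real.rpow_le_rpow (abs_nonneg _) ?_ (by linarith)) hc
      calc |s * x i + t * y i| ≤ |s * x i| + |t * y i| := abs_add_le _ _
        _ = _ := by simp only [abs_mul, abs_of_nonneg hs, abs_of_nonneg ht, smul_eq_mul]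
    calc ∑ i, |s * x i + t * y i| ^ q.toReal
        ≤ ∑ i, (s * |x i| ^ q.toReal + t * |y i| ^ q.toReal) := Finset.sum_le_sum fun i _ => key i
      _ = s * ∑ i, |x i| ^ q.toReal + t * ∑ i, |y i| ^ q.toReal := by
          rw [Finset.sum_add_distrib, Finset.mul_sum, Finset.mul_sum]
      _ ≤ s * 1 + t * 1 := by gcongr <;> [exact hx; exact hy]
      _ = 1 := by linarith

/-- The law of the linear form with coefficients `a` of a uniform vector on the unit ball of
`ℓ_q^n`. -/
noncomputable def ballLaw (q : ℝ≥0∞) {n : ℕ} (a : Fin n → ℝ) : Measure ℝ :=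
  (cond volume (unitBall q n)).map fun x => ∑ i, a i * x i

theorem integral_ballLaw (q : ℝ≥0∞) {n : ℕ} (a : Fin n → ℝ) {g : ℝ → ℝ} (hg : Measurable g)
    (hg0 : ∀ t, 0 ≤ g t) :
    ∫ t, g t ∂ballLaw q a = (volume.real (unitBall q n))⁻¹
      * (∫⁻ x in unitBall q n, ENNReal.ofReal (g (∑ i, a i * x i))).toReal := by
  rw [ballLaw, integral_map (measurable_linear a).aemeasurable hg.aestronglyMeasurable,
    ProbabilityTheory.cond, integral_smul_measure, smul_eq_mul, ENNReal.toReal_inv,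
    integral_eq_lintegral_of_nonneg_ae (.of_forall fun x => hg0 _)
      (hg.comp (measurable_linear a)).aestronglyMeasurable]
  rfl

/-- The moments of linear forms of the product law are proportional to those of a uniform vector,
provided that this holds at the level of unnormalised integrals. -/
theorem integral_sumLaw_eq_mul_integral_ballLaw {q : ℝ≥0∞} {n : ℕ} {w : ℝ → ℝ}
    (hw0 : ∀ x, 0 ≤ w x) (hwm : Measurable w) (hwi : Integrable w) (hw1 : ∫ x, w x = 1)
    {C : ℝ → ℝ} (hC : ∀ r, 0 ≤ r → 0 < C r)
    (h : ∀ (a : Fin n → ℝ) (r : ℝ), 0 ≤ r →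
      ∫⁻ x : Fin n → ℝ, ENNReal.ofReal (∏ i, w (x i)) * ENNReal.ofReal (|∑ i, a i * x i| ^ r)
        = ENNReal.ofReal (C r)
          * ∫⁻ x in unitBall q n, ENNReal.ofReal (|∑ i, a i * x i| ^ r)) :
    (volume (unitBall q n) ≠ 0 ∧ volume (unitBall q n) ≠ ∞) ∧
      ∀ (a : Fin n → ℝ) (r : ℝ), 0 ≤ r →
        ∫ t, |t| ^ r ∂sumLaw (densityLaw w) a = C r / C 0 * ∫ t, |t| ^ r ∂ballLaw q a := by
  have hprob : IsProbabilityMeasure (densityLaw w) := by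
    refine ⟨?_⟩
    rw [densityLaw, withDensity_apply _ MeasurableSet.univ, setLIntegral_univ,
      ← ofReal_integral_eq_lintegral_ofReal hwi (.of_forall hw0), hw1, ENNReal.ofReal_one]
  have hsum : ∀ (a : Fin n → ℝ) (r : ℝ), 0 ≤ r →
      ∫⁻ t, ENNReal.ofReal (|t| ^ r) ∂sumLaw (densityLaw w) a = ENNReal.ofReal (C r)
          * ∫⁻ x in unitBall q n, ENNReal.ofReal (|∑ i, a i * x i| ^ r) := by
    intro a r hr
    rw [lintegral_sumLaw_densityLaw hw0 hwm hwi a (g := fun t => ENNReal.ofReal (|t| ^ r))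
      (by fun_prop), h a r hr]
  -- Exponent 0 expresses the total mass 1 of the product law: the ball has positive finite volume,
  -- and `C 0` is its inverse.
  have hvol : 1 = ENNReal.ofReal (C 0) * volume (unitBall q n) := by
    simpa using hsum 0 0 le_rfl
  have hvol' : 1 = C 0 * volume.real (unitBall q n) := by
    have := congrArg ENNReal.toReal hvol
    rwa [ENNReal.toReal_mul, ENNReal.toReal_ofReal (hC 0 le_rfl).le, ENNReal.toReal_one] at this
  refine ⟨⟨fun h0 => ?_, fun h0 => ?_⟩, fun a r hr => ?_⟩
  · rw [h0, mul_zero] at hvol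
    exact one_ne_zero hvol
  · rw [h0, ENNReal.mul_top (ENNReal.ofReal_pos.2 (hC 0 le_rfl)).ne'] at hvol
    exact ENNReal.one_ne_top hvol
  · rw [integral_eq_lintegral_of_nonneg_ae (.of_forall fun t => Real.rpow_nonneg (abs_nonneg t) r)
      (measurable_abs_rpow r).aestronglyMeasurable, hsum a r hr,
      integral_ballLaw q a (measurable_abs_rpow r) fun t => Real.rpow_nonneg (abs_nonneg t) r,
      ENNReal.toReal_mul, ENNReal.toReal_ofReal (hC r hr).le,
      ← eq_inv_of_mul_eq_one_left hvol'.symm]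
    field_simp [(hC 0 le_rfl).ne']

theorem lintegral_cube_mul {n : ℕ} (φ : (Fin n → ℝ) → ℝ≥0∞) :
    ∫⁻ x : Fin n → ℝ, ENNReal.ofReal (∏ i, cubeDensity (x i)) * φ x
      = ENNReal.ofReal ((1 / 2) ^ n) * ∫⁻ x in unitBall ∞ n, φ x := by
  rw [← lintegral_indicator (measurableSet_unitBall ∞ n),
    ← lintegral_const_mul' _ _ ENNReal.ofReal_ne_top]
  refine lintegral_congr fun x => ?_
  have hmem : ∀ i, x i ∈ Icc (-1 : ℝ) 1 ↔ |x i| ≤ 1 := fun i => by rw [mem_Icc, abs_le]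
  rw [unitBall_top]
  by_cases hx : x ∈ {x : Fin n → ℝ | ∀ i, |x i| ≤ 1}
  · rw [indicator_of_mem hx, Finset.prod_congr rfl fun i _ =>
      show cubeDensity (x i) = 1 / 2 from indicator_of_mem ((hmem i).2 (hx i)) _]
    simp
  · rw [indicator_of_notMem hx]
    simp only [mem_ofPred_eq, not_forall] at hx
    obtain ⟨i, hi⟩ := hx
    rw [Finset.prod_eq_zero (Finset.mem_univ i) (indicator_of_notMem (fun h => hi ((hmem i).1 h)) _)]
    simp

/-- The product density depends only on the gauge `∑ |x i| ^ q`, homogeneous of degree `q`, and the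
integrand is homogeneous of degree `r`. -/
theorem lintegral_prod_powerDensity_mul {q : ℝ≥0∞} (hq : 2 ≤ q) (hqt : q ≠ ∞) {n : ℕ}
    (a : Fin n → ℝ) {r : ℝ} (hr : 0 ≤ r) :
    ∫⁻ x : Fin n → ℝ, ENNReal.ofReal (∏ i, powerDensity q.toReal (x i))
        * ENNReal.ofReal (|∑ i, a i * x i| ^ r)
      = ENNReal.ofReal ((∫ y, Real.exp (-|y| ^ q.toReal))⁻¹ ^ n
          * Real.Gamma ((n + r) / q.toReal + 1))
        * ∫⁻ x in unitBall q n, ENNReal.ofReal (|∑ i, a i * x i| ^ r) := by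
  have hs : 0 < q.toReal := by linarith [two_le_toReal hq hqt]
  have hZ := integral_exp_neg_abs_rpow_pos hs
  have hprod : ∀ x : Fin n → ℝ, ENNReal.ofReal (∏ i, powerDensity q.toReal (x i))
      = ENNReal.ofReal ((∫ y, Real.exp (-|y| ^ q.toReal))⁻¹ ^ n)
        * ENNReal.ofReal (Real.exp (-∑ i, |x i| ^ q.toReal)) := by
    intro x
    rw [← ENNReal.ofReal_mul (by positivity)]
    simp only [powerDensity, Finset.prod_mul_distrib, Finset.prod_const, Finset.card_univ,
      Fintype.card_fin, ← Finset.sum_neg_distrib, Real.exp_sum]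
  rw [lintegral_congr fun x => by rw [hprod x, mul_assoc],
    lintegral_const_mul' _ _ ENNReal.ofReal_ne_top, ENNReal.ofReal_mul (by positivity), mul_assoc,
    unitBall_of_ne_top hqt]
  congr 1
  refine lintegral_exp_neg_gauge_mul hs hr (by fun_prop)
    (fun x => Finset.sum_nonneg fun i _ => Real.rpow_nonneg (abs_nonneg _) _) ?_
    (by fun_prop) ?_
  · intro c x hc
    simp only [Pi.smul_apply, smul_eq_mul, abs_mul, abs_of_pos hc, Finset.mul_sum,
      Real.mul_rpow hc.le (abs_nonneg _)]
  · intro c x hc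
    rw [← ENNReal.ofReal_mul (by positivity), ← Real.mul_rpow hc.le (abs_nonneg _),
      ← abs_of_pos hc, ← abs_mul, Finset.mul_sum, abs_of_pos hc]
    simp only [Pi.smul_apply, smul_eq_mul, mul_left_comm]

/-! ### Ratios of Gamma values -/

/-- `Γ (x + s) / Γ x`. -/
noncomputable def gammaRatio (x s : ℝ) : ℝ := Real.Gamma (x + s) / Real.Gamma x

theorem gammaRatio_pos {x s : ℝ} (hx : 0 < x) (hs : 0 ≤ s) : 0 < gammaRatio x s :=
  div_pos (Real.Gamma_pos_of_pos (by linarith)) (Real.Gamma_pos_of_pos hx)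

theorem log_gammaRatio {x s : ℝ} (hx : 0 < x) (hs : 0 ≤ s) :
    Real.log (gammaRatio x s) = (Real.log ∘ Real.Gamma) (x + s) - (Real.log ∘ Real.Gamma) x :=
  Real.log_div (Real.Gamma_pos_of_pos (by linarith)).ne' (Real.Gamma_pos_of_pos hx).ne'

theorem log_Gamma_add_one {x : ℝ} (hx : 0 < x) :
    (Real.log ∘ Real.Gamma) (x + 1) = Real.log x + (Real.log ∘ Real.Gamma) x := by
  simp only [Function.comp_apply]
  rw [Real.Gamma_add_one hx.ne', Real.log_mul hx.ne' (Real.Gamma_pos_of_pos hx).ne']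

/-- Slopes of the convex function `log Γ` increase: the one over `[x, x + s]` is at most the one
over `[x + s, x + s + 1]`, which is `log (x + s)`. The lower bound `le_gammaRatio` compares `[x, x +
1]` with the adjacent interval. -/
theorem gammaRatio_le {x s : ℝ} (hx : 0 < x) (hs : 0 < s) : gammaRatio x s ≤ (x + s) ^ s := by
  have hxs : 0 < x + s := by linarith
  have h := Real.convexOn_log_Gamma.slope_mono_adjacent (mem_Ioi.2 hx)
    (mem_Ioi.2 (by linarith : 0 < x + s + 1)) (by linarith : x < x + s)
    (by linarith : x + s < x + s + 1)
  rw [← log_gammaRatio hx hs.le, log_Gamma_add_one hxs] at h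
  simp only [add_sub_cancel_left, add_sub_cancel_right, div_one] at h
  rw [← Real.log_le_log_iff (gammaRatio_pos hx hs.le) (Real.rpow_pos_of_pos hxs _),
    Real.log_rpow hxs, mul_comm]
  exact (div_le_iff₀ hs).1 h

theorem le_gammaRatio {x s : ℝ} (hx : 0 < x) (hs : 0 < s) : x ^ s ≤ gammaRatio (x + 1) s := by
  have h := Real.convexOn_log_Gamma.slope_mono_adjacent (mem_Ioi.2 hx)
    (mem_Ioi.2 (by linarith : 0 < x + 1 + s)) (by linarith : x < x + 1)
    (by linarith : x + 1 < x + 1 + s)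
  rw [← log_gammaRatio (by linarith) hs.le, log_Gamma_add_one hx] at h
  simp only [add_sub_cancel_left, add_sub_cancel_right, div_one] at h
  rw [← Real.log_le_log_iff (Real.rpow_pos_of_pos hx _) (gammaRatio_pos (by linarith) hs.le),
    Real.log_rpow hx, mul_comm]
  exact (le_div_iff₀ hs).1 h

theorem gammaRatio_rpow_le {x s t : ℝ} (hx : 0 < x) (hs : 0 < s) (hst : s ≤ t) :
    gammaRatio x s ^ (t / s) ≤ gammaRatio x t := by
  have ht : 0 < t := hs.trans_le hst
  have h := Real.convexOn_log_Gamma.secant_mono (mem_Ioi.2 hx)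
    (mem_Ioi.2 (by linarith : 0 < x + s)) (mem_Ioi.2 (by linarith : 0 < x + t))
    (by linarith) (by linarith) (by linarith : x + s ≤ x + t)
  rw [← log_gammaRatio hx hs.le, ← log_gammaRatio hx ht.le, add_sub_cancel_left,
    add_sub_cancel_left] at h
  rw [← Real.log_le_log_iff (Real.rpow_pos_of_pos (gammaRatio_pos hx hs.le) _)
    (gammaRatio_pos hx ht.le), Real.log_rpow (gammaRatio_pos hx hs.le)]
  calc t / s * Real.log (gammaRatio x s) = Real.log (gammaRatio x s) / s * t := by ring
    _ ≤ Real.log (gammaRatio x t) := (le_div_iff₀ ht).1 h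

theorem mul_gammaRatio_rpow_le {x q p : ℝ} (hx : 0 < x) (hq : 0 < q) (hp : 0 < p) :
    (p - 2) * gammaRatio x (2 / q) ^ (p / 2) ≤ (p - 2) * gammaRatio x (p / q) := by
  have h2 : 0 < 2 / q := by positivity
  have hpq : 0 < p / q := by positivity
  rcases le_total 2 p with h | h
  · refine mul_le_mul_of_nonneg_left ?_ (by linarith)
    have := gammaRatio_rpow_le hx h2 (div_le_div_of_nonneg_right h hq.le)
    rwa [div_div_div_cancel_right₀ hq.ne'] at this
  · refine mul_le_mul_of_nonpos_left ?_ (by linarith)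
    -- For `p ≤ 2` the roles of `p` and `2` are exchanged, and the result is raised to the power `p
    -- / 2`.
    have := gammaRatio_rpow_le hx hpq (div_le_div_of_nonneg_right h hq.le)
    rw [div_div_div_cancel_right₀ hq.ne'] at this
    have h3 := Real.rpow_le_rpow (Real.rpow_nonneg (gammaRatio_pos hx hpq.le).le _) this
      (by positivity : 0 ≤ p / 2)
    rwa [← Real.rpow_mul (gammaRatio_pos hx hpq.le).le, div_mul_div_comm, mul_comm 2 p, div_self
      (by positivity), Real.rpow_one] at h3

theorem tendsto_shift_ratio (b c : ℝ) {s : ℝ} (hs : 0 ≤ s) :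
    Tendsto (fun x : ℝ => ((x + b) / (x + c)) ^ s) atTop (𝓝 1) := by
  have h1 : Tendsto (fun x : ℝ => (x + b) / (x + c)) atTop (𝓝 1) := by
    have h2 : Tendsto (fun x : ℝ => 1 + (b - c) / (x + c)) atTop (𝓝 (1 + 0)) :=
      tendsto_const_nhds.add (tendsto_const_nhds.div_atTop
        (tendsto_atTop_add_const_right _ _ tendsto_id))
    rw [add_zero] at h2
    refine h2.congr' ?_
    filter_upwards [eventually_gt_atTop (-c)] with x hx
    have : x + c ≠ 0 := by linarith
    field_simp
    ring
  simpa using h1.rpow_const (Or.inr hs)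

/-- Both the numerator and the denominator are squeezed between shifted powers of exponent `p / q`.
-/
theorem tendsto_gammaRatio {q p : ℝ} (hq : 0 < q) (hp : 0 < p) :
    Tendsto (fun x : ℝ => gammaRatio (x + 1) (p / q) / gammaRatio (x + 1) (2 / q) ^ (p / 2)) atTop
      (𝓝 1) := by
  have h2 : 0 < 2 / q := by positivity
  have hpq : 0 < p / q := by positivity
  refine tendsto_of_tendsto_of_tendsto_of_le_of_le'
    (tendsto_shift_ratio 0 (1 + 2 / q) hpq.le) (tendsto_shift_ratio (1 + p / q) 0 hpq.le) ?_ ?_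
  · filter_upwards [eventually_gt_atTop 0] with x hx
    have hx2 : 0 < x + (1 + 2 / q) := by linarith
    rw [Real.div_rpow (by linarith) hx2.le, add_zero]
    refine div_le_div₀ (gammaRatio_pos (by linarith) hpq.le).le (le_gammaRatio hx hpq)
      (Real.rpow_pos_of_pos (gammaRatio_pos (by linarith) h2.le) _) ?_
    refine (Real.rpow_le_rpow (gammaRatio_pos (by linarith) h2.le).le
      (gammaRatio_le (by linarith : 0 < x + 1) h2) (by positivity)).trans_eq ?_
    rw [← Real.rpow_mul (by linarith), ← add_assoc]
    congr 1
    field_simp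
  · filter_upwards [eventually_gt_atTop 0] with x hx
    rw [Real.div_rpow (by linarith) (by linarith), add_zero]
    refine div_le_div₀ (Real.rpow_nonneg (by linarith) _) ?_ (Real.rpow_pos_of_pos hx _) ?_
    · rw [← add_assoc]
      exact gammaRatio_le (by linarith) hpq
    · refine le_trans (Eq.le ?_) (Real.rpow_le_rpow (Real.rpow_nonneg hx.le _)
        (le_gammaRatio hx h2) (by positivity))
      rw [← Real.rpow_mul hx.le]
      congr 1
      field_simp

/-- Linear forms of a uniform vector on an `ℓ_q` ball are compared with sums of independent
variables of density `w`, by means of moment multipliers `m`. -/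
structure IsBallModel (q : ℝ≥0∞) (v : ℝ≥0) (w : ℝ → ℝ) (m : ℕ → ℝ → ℝ) : Prop where
  density : ∀ r, 0 ≤ r → IsSubGaussianDensity r v w
  pos : ∀ n r, 0 ≤ r → 0 < m n r
  volume_ne : ∀ n, volume (unitBall q n) ≠ 0 ∧ volume (unitBall q n) ≠ ∞
  moment : ∀ (n : ℕ) (a : Fin n → ℝ) (r : ℝ), 0 ≤ r →
    ∫ t, |t| ^ r ∂sumLaw (densityLaw w) a = m n r * ∫ t, |t| ^ r ∂ballLaw q a
  -- The passage from the product law to the ball can only help the Gaussian bound; `tendsto` says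
  -- that nothing is gained in the limit, which sharpness requires.
  le : ∀ n p, 0 < p → (p - 2) * m n 2 ^ (p / 2) ≤ (p - 2) * m n p
  tendsto : ∀ p, 0 < p → Tendsto (fun n => m n p / m n 2 ^ (p / 2)) atTop (𝓝 1)

theorem isBallModel_top : IsBallModel ∞ (1 / 3) cubeDensity fun _ _ => 1 := by
  have hw := isSubGaussianDensity_cubeDensity le_rfl
  have h := fun n : ℕ => integral_sumLaw_eq_mul_integral_ballLaw (q := ∞) (n := n) hw.nonneg hw.meas
    hw.integrable hw.integral_eq (C := fun _ => (1 / 2) ^ n) (fun _ _ => by positivity)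
    fun a r _ => lintegral_cube_mul _
  exact
    { density := fun r hr => isSubGaussianDensity_cubeDensity hr
      pos := fun _ _ _ => one_pos
      volume_ne := fun n => (h n).1
      moment := fun n a r hr => by
        rw [(h n).2 a r hr, div_self (by positivity)]
      le := fun n p hp => by simp
      tendsto := fun p hp => by simp }

theorem exists_isBallModel {q : ℝ≥0∞} (hq : 2 ≤ q) : ∃ v w m, IsBallModel q v w m := by
  by_cases hqt : q = ∞
  · subst hqt
    exact ⟨_, _, _, isBallModel_top⟩
  obtain ⟨v, hv⟩ := exists_isSubGaussianDensity_powerDensity (two_le_toReal hq hqt)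
  have hs : 0 < q.toReal := by linarith [two_le_toReal hq hqt]
  have hw := hv 0 le_rfl
  have hZ := integral_exp_neg_abs_rpow_pos hs
  have hΓ : ∀ (n : ℕ) (r : ℝ), 0 ≤ r → 0 < Real.Gamma ((n + r) / q.toReal + 1) :=
    fun n r hr => Real.Gamma_pos_of_pos (by positivity)
  have h := fun n : ℕ => integral_sumLaw_eq_mul_integral_ballLaw (q := q) (n := n) hw.nonneg hw.meas
    hw.integrable hw.integral_eq (fun r hr => mul_pos (by positivity) (hΓ n r hr))
    fun a r hr => lintegral_prod_powerDensity_mul hq hqt a hr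
  have hx : ∀ n : ℕ, 0 < n / q.toReal + 1 := fun n => by positivity
  -- The multiplier is the quotient of the radial constants for exponents `r` and 0, that is `Γ((n +
  -- r) / q + 1) / Γ(n / q + 1)`.
  refine ⟨v, powerDensity q.toReal, fun n r => gammaRatio (n / q.toReal + 1) (r / q.toReal), ?_⟩
  exact
    { density := hv
      pos := fun n r hr => gammaRatio_pos (hx n) (by positivity)
      volume_ne := fun n => (h n).1
      moment := fun n a r hr => by
        rw [(h n).2 a r hr, mul_div_mul_left _ _ (by positivity), gammaRatio, add_zero, add_div,
          add_right_comm]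
      le := fun n p hp => mul_gammaRatio_rpow_le (hx n) hs hp
      tendsto := fun p hp => (tendsto_gammaRatio hs hp).comp
        (tendsto_natCast_atTop_atTop.atTop_div_const hs) }

end Khintchine

namespace Khintchine

open Set ProbabilityTheory Filter Topology
open scoped NNReal

/-! ### The central limit theorem for the absolute moments -/

theorem IsUnimodalDensity.memLp_id {r : ℝ} {w : ℝ → ℝ} (hw : IsUnimodalDensity r w) (hr : 0 < r) :
    MemLp id (ENNReal.ofReal r) (densityLaw w) := by
  rw [← integrable_norm_rpow_iff measurable_id.aestronglyMeasurable
    (ENNReal.ofReal_pos.2 hr).ne' ENNReal.ofReal_ne_top, ENNReal.toReal_ofReal hr.le]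
  refine hw.integrable_law.mono' (measurable_abs_rpow r).aestronglyMeasurable
    (.of_forall fun x => ?_)
  simpa using abs_rpow_le_weight hr.le x

theorem memLp_id_sumLaw {μ : Measure ℝ} [IsProbabilityMeasure μ] {p : ℝ≥0∞} (h : MemLp id p μ)
    {n : ℕ} (a : Fin n → ℝ) : MemLp id p (sumLaw μ a) := by
  rw [sumLaw, memLp_map_measure_iff measurable_id.aestronglyMeasurable
    (measurable_linear a).aemeasurable]
  exact memLp_finsetSum (f := fun (i : Fin n) (x : Fin n → ℝ) => a i * x i) Finset.univ fun i _ => (h.comp_measurePreserving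
    (measurePreserving_eval (fun _ : Fin n => μ) i)).const_mul (a i)

theorem integrable_abs_rpow_sumLaw {r : ℝ} {w : ℝ → ℝ} (hw : IsUnimodalDensity r w) (hr : 0 < r)
    {n : ℕ} (a : Fin n → ℝ) : Integrable (fun t => |t| ^ r) (sumLaw (densityLaw w) a) := by
  have := hw.isProbabilityMeasure
  have h := (memLp_id_sumLaw (hw.memLp_id hr) a).integrable_norm_rpow
    (ENNReal.ofReal_pos.2 hr).ne' ENNReal.ofReal_ne_top
  simpa [ENNReal.toReal_ofReal hr.le] using h

theorem IsUnimodalDensity.integral_id {r : ℝ} {w : ℝ → ℝ} (hw : IsUnimodalDensity r w) :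
    ∫ x, x ∂densityLaw w = 0 := by
  rw [integral_densityLaw hw.nonneg hw.meas]
  have h := integral_neg_eq_self (fun x => w x * x) volume
  simp only [hw.even, mul_neg, integral_neg] at h
  linarith

/-- Domination forces equality of the variances, since both `u` and `-u` are convex. -/
theorem IsSubGaussianDensity.integral_sq {v : ℝ≥0} {w : ℝ → ℝ} (hw : IsSubGaussianDensity 2 v w) :
    ∫ x, x ^ 2 ∂densityLaw w = v := by
  have hi : Integrable (fun x : ℝ => x ^ 2) (densityLaw w) := by
    refine hw.integrable_law.mono' (by fun_prop) (.of_forall fun x => ?_)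
    simpa using abs_rpow_le_weight zero_le_two x
  have hg := integrable_sq_gaussianReal v
  have h1 := hw.convex_le id (convexOn_id (convex_Ici 0)) hi hg
  have h2 := hw.convex_le (fun u => -u) (concaveOn_id (convex_Ici 0)).neg hi.neg hg.neg
  simp only [integral_neg, id, integral_sq_gaussianReal] at h1 h2
  linarith

theorem integral_sq_sumLaw {v : ℝ≥0} {w : ℝ → ℝ} (hw : IsSubGaussianDensity 2 v w) {n : ℕ}
    (a : Fin n → ℝ) : ∫ t, t ^ 2 ∂sumLaw (densityLaw w) a = v * ∑ i, a i ^ 2 := by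
  have := hw.isProbabilityMeasure
  have hL : MemLp id 2 (densityLaw w) := by
    simpa using hw.memLp_id two_pos
  have hL1 : Integrable (fun x : ℝ => x) (densityLaw w) := hL.integrable one_le_two
  have hmean : ∫ x, ∑ i, a i * x i ∂(Measure.pi fun _ : Fin n => densityLaw w) = 0 := by
    rw [integral_finsetSum]
    · refine Finset.sum_eq_zero fun i _ => ?_
      rw [integral_const_mul, integral_comp_eval (μ := fun _ : Fin n => densityLaw w) (i := i)
        (f := fun x => x) measurable_id.aestronglyMeasurable, hw.integral_id, mul_zero]
    · exact fun i _ => (integrable_comp_eval (μ := fun _ : Fin n => densityLaw w) (i := i)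
        hL1).const_mul _
  have hvar : Var[fun x : ℝ => x; densityLaw w] = v := by
    rw [variance_of_integral_eq_zero measurable_id'.aemeasurable hw.integral_id, hw.integral_sq]
  have h := variance_sum_pi (μ := fun _ : Fin n => densityLaw w) (X := fun i x => a i * x)
    fun i => hL.const_mul (a i)
  have e : (∑ i, fun x : Fin n → ℝ => a i * x i) = fun x => ∑ i, a i * x i := by
    ext x
    simp
  rw [e, variance_of_integral_eq_zero (measurable_linear a).aemeasurable hmean] at h
  rw [sumLaw, integral_map (measurable_linear a).aemeasurable (by fun_prop), h, Finset.mul_sum]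
  refine Finset.sum_congr rfl fun i _ => ?_
  rw [← hvar, mul_comm]
  exact variance_const_mul (a i) (fun x => x) (densityLaw w)

theorem tendsto_charFun_sumLaw {v : ℝ≥0} {w : ℝ → ℝ} (hw : IsSubGaussianDensity 2 v w) (t : ℝ) :
    Tendsto (fun n : ℕ => charFun (sumLaw (densityLaw w) fun _ : Fin n => (√n)⁻¹) t) atTop
      (𝓝 (charFun (gaussianReal 0 v) t)) := by
  have := hw.isProbabilityMeasure
  have hv : 0 < (v : ℝ) := NNReal.coe_pos.2 (pos_iff_ne_zero.2 hw.var_ne_zero)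
  have hsv : √(v : ℝ) ≠ 0 := (Real.sqrt_pos.2 hv).ne'
  -- The central limit theorem for the variable scaled to variance 1, at the argument `√v * t`.
  have h := tendsto_charFun_inv_sqrt_mul_pow (P := densityLaw w) (X := fun x => (√(v : ℝ))⁻¹ * x)
    (by fun_prop) (by rw [integral_const_mul, hw.integral_id, mul_zero])
    (by
      simp only [Pi.pow_apply, mul_pow]
      rw [integral_const_mul, hw.integral_sq, inv_pow, Real.sq_sqrt hv.le, inv_mul_cancel₀ hv.ne'])
    (√v * t)
  have e1 : ∀ n : ℕ, charFun (sumLaw (densityLaw w) fun _ : Fin n => (√n)⁻¹) t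
      = charFun ((densityLaw w).map fun x => (√(v : ℝ))⁻¹ * x) ((√n)⁻¹ * (√v * t)) ^ n := by
    intro n
    rw [charFun_sumLaw, Finset.prod_const, Finset.card_univ, Fintype.card_fin, charFun_map_mul]
    congr 2
    field_simp
  have e2 : charFun (gaussianReal 0 v) t = Complex.exp (-((√v * t : ℝ) : ℂ) ^ 2 / 2) := by
    have h3 : ((√(v : ℝ) : ℝ) : ℂ) ^ 2 = ((v : ℝ) : ℂ) := by
      exact_mod_cast Real.sq_sqrt hv.le
    rw [charFun_gaussianReal, Complex.ofReal_mul, mul_pow, h3]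
    congr 1
    simp
    ring
  simp only [e1, e2]
  exact h

theorem integral_mul_abs_rpow_add_mul_sq {p : ℝ} (b c : ℝ) {κ : Measure ℝ} [IsProbabilityMeasure κ]
    (h1 : Integrable (fun t => |t| ^ p) κ) (h2 : Integrable (fun t => t ^ 2) κ) :
    ∫ t, b * |t| ^ p + c * (1 + t ^ 2) ∂κ = b * ∫ t, |t| ^ p ∂κ + c * (1 + ∫ t, t ^ 2 ∂κ) := by
  have h3 : Integrable (fun t : ℝ => 1 + t ^ 2) κ := (integrable_const 1).add h2
  rw [integral_add (h1.const_mul b) (h3.const_mul c), integral_const_mul, integral_const_mul,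
    integral_add (integrable_const 1) h2]
  simp

/-- For a nonnegative continuous function, weak convergence bounds the lower limit of the integrals
from below. The matching upper bound is the Gaussian comparison already proved, so no uniform
integrability is needed. -/
theorem tendsto_integral_abs_rpow_sumLaw {p : ℝ} (hp : 1 ≤ p) (hp2 : p ≠ 2) {v : ℝ≥0} {w : ℝ → ℝ}
    (hw : ∀ r, 0 ≤ r → IsSubGaussianDensity r v w) :
    Tendsto (fun n : ℕ => ∫ t, |t| ^ p ∂sumLaw (densityLaw w) fun _ : Fin n => (√n)⁻¹) atTop
      (𝓝 ((v : ℝ) ^ (p / 2) * gammaConst p ^ p)) := by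
  have hp0 : 0 < p := by linarith
  have := (hw 0 le_rfl).isProbabilityMeasure
  set μ : ℕ → Measure ℝ := fun n => sumLaw (densityLaw w) fun _ : Fin n => (√n)⁻¹ with hμ
  -- The quadratic term makes `f` nonnegative also for `p < 2`; its integral is `|p - 2| * (1 + v)`
  -- for every `n ≥ 1` and for the limit.
  set f : ℝ → ℝ := fun t => (p - 2) * |t| ^ p + |p - 2| * (1 + t ^ 2) with hf
  have hfc : Continuous f := ((continuous_abs_rpow hp0.le).const_mul _).add (by fun_prop)
  have hf0 : 0 ≤ f := by
    intro t
    have h0 : 0 ≤ |t| ^ p := Real.rpow_nonneg (abs_nonneg t) p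
    rcases le_total 2 p with h | h
    · simp only [hf, Pi.zero_apply]
      have : 0 ≤ p - 2 := by linarith
      positivity
    · simp only [hf, Pi.zero_apply, abs_of_nonpos (by linarith : p - 2 ≤ 0)]
      have : |t| ^ p ≤ 1 + t ^ 2 := by
        rcases le_total |t| 1 with h1 | h1
        · nlinarith [Real.rpow_le_one (abs_nonneg t) h1 hp0.le, sq_nonneg t]
        · have := Real.rpow_le_rpow_of_exponent_le h1 h
          rw [Real.rpow_two, sq_abs] at this
          linarith
      nlinarith
  have hint : ∀ n, Integrable (fun t => |t| ^ p) (μ n) := fun n =>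
    integrable_abs_rpow_sumLaw (hw p hp0.le).toIsUnimodalDensity hp0 _
  have hint2 : ∀ n, Integrable (fun t => t ^ 2) (μ n) := fun n => by
    simpa using integrable_abs_rpow_sumLaw (hw 2 zero_le_two).toIsUnimodalDensity two_pos
      fun _ : Fin n => (√n)⁻¹
  have hintf : ∀ n, Integrable f (μ n) := fun n =>
    ((hint n).const_mul _).add (((integrable_const 1).add (hint2 n)).const_mul _)
  have hsum : ∀ n : ℕ, 1 ≤ n → ∑ _i : Fin n, (√(n : ℝ))⁻¹ ^ 2 = 1 := by
    intro n hn
    have : (n : ℝ) ≠ 0 := by positivity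
    simp [this]
  have hF : ∀ n : ℕ, 1 ≤ n →
      ∫ t, f t ∂μ n = (p - 2) * ∫ t, |t| ^ p ∂μ n + |p - 2| * (1 + v) := by
    intro n hn
    rw [hf, integral_mul_abs_rpow_add_mul_sq _ _ (hint n) (hint2 n),
      integral_sq_sumLaw (hw 2 zero_le_two), hsum n hn, mul_one]
  have hgi : Integrable (fun t => |t| ^ p) (gaussianReal 0 v) := by
    refine (integrable_weight_gaussianReal hp0.le v).mono'
      (measurable_abs_rpow p).aestronglyMeasurable (.of_forall fun x => ?_)
    simpa using abs_rpow_le_weight hp0.le x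
  have hgi2 := integrable_sq_gaussianReal v
  have hgf : Integrable f (gaussianReal 0 v) :=
    (hgi.const_mul _).add (((integrable_const 1).add hgi2).const_mul _)
  have hG : ∫ t, f t ∂gaussianReal 0 v
      = (p - 2) * ((v : ℝ) ^ (p / 2) * gammaConst p ^ p) + |p - 2| * (1 + v) := by
    rw [hf, integral_mul_abs_rpow_add_mul_sq _ _ hgi hgi2, integral_abs_rpow_gaussianReal hp0,
      integral_sq_gaussianReal]
  let μ' : ℕ → ProbabilityMeasure ℝ := fun n => ⟨μ n, inferInstance⟩
  let γ : ProbabilityMeasure ℝ := ⟨gaussianReal 0 v, inferInstance⟩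
  have hweak : Tendsto μ' atTop (𝓝 γ) :=
    ProbabilityMeasure.tendsto_iff_tendsto_charFun.2 (tendsto_charFun_sumLaw (hw 2 zero_le_two))
  have hlim : Tendsto (fun n => ∫⁻ t, ENNReal.ofReal (f t) ∂μ n) atTop
      (𝓝 (∫⁻ t, ENNReal.ofReal (f t) ∂gaussianReal 0 v)) := by
    refine tendsto_of_le_liminf_of_limsup_le
      (lintegral_le_liminf_lintegral_of_forall_isOpen_measure_le_liminf_measure hfc hf0
        fun G hG => ProbabilityMeasure.le_liminf_measure_open_of_tendsto hweak hG)
      (limsup_le_of_le (by isBoundedDefault) ?_)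
    filter_upwards [eventually_ge_atTop 1] with n hn
    rw [← ofReal_integral_eq_lintegral_ofReal (hintf n) (.of_forall hf0),
      ← ofReal_integral_eq_lintegral_ofReal hgf (.of_forall hf0), hF n hn, hG]
    have := sumLaw_moment_le hp (hw p hp0.le) fun _ : Fin n => (√(n : ℝ))⁻¹
    rw [hsum n hn, mul_one] at this
    exact ENNReal.ofReal_le_ofReal (by linarith)
  have hlim' : Tendsto (fun n => ∫ t, f t ∂μ n) atTop (𝓝 (∫ t, f t ∂gaussianReal 0 v)) := by
    simp only [integral_eq_lintegral_of_nonneg_ae (.of_forall hf0)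
      hfc.measurable.aestronglyMeasurable]
    refine (ENNReal.tendsto_toReal ?_).comp hlim
    rw [← ofReal_integral_eq_lintegral_ofReal hgf (.of_forall hf0)]
    exact ENNReal.ofReal_ne_top
  have hp2' : p - 2 ≠ 0 := sub_ne_zero.2 hp2
  have h := (hlim'.sub_const (|p - 2| * (1 + v))).div_const (p - 2)
  rw [hG, add_sub_cancel_right, mul_div_cancel_left₀ _ hp2'] at h
  refine h.congr' ?_
  filter_upwards [eventually_ge_atTop 1] with n hn
  rw [hF n hn, add_sub_cancel_right, mul_div_cancel_left₀ _ hp2']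

end Khintchine

namespace Khintchine

open Set ProbabilityTheory Filter Topology
open scoped NNReal

/-! ### Moment comparison on the balls -/

theorem volume_unitBall_ne {q : ℝ≥0∞} (hq : 2 ≤ q) (n : ℕ) :
    volume (unitBall q n) ≠ 0 ∧ volume (unitBall q n) ≠ ∞ := by
  obtain ⟨v, w, m, h⟩ := exists_isBallModel hq
  exact h.volume_ne n

theorem isProbabilityMeasure_cond_unitBall {q : ℝ≥0∞} (hq : 2 ≤ q) (n : ℕ) :
    IsProbabilityMeasure (cond volume (unitBall q n)) :=
  cond_isProbabilityMeasure_of_finite (volume_unitBall_ne hq n).1 (volume_unitBall_ne hq n).2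

theorem isProbabilityMeasure_ballLaw {q : ℝ≥0∞} (hq : 2 ≤ q) {n : ℕ} (a : Fin n → ℝ) :
    IsProbabilityMeasure (ballLaw q a) :=
  have := isProbabilityMeasure_cond_unitBall hq n
  Measure.isProbabilityMeasure_map (measurable_linear a).aemeasurable

/-- The absolute moment of order `r` of the linear form with coefficients `a`. -/
noncomputable def ballMoment (q : ℝ≥0∞) {n : ℕ} (a : Fin n → ℝ) (r : ℝ) : ℝ :=
  ∫ t, |t| ^ r ∂ballLaw q a

theorem ballMoment_nonneg (q : ℝ≥0∞) {n : ℕ} (a : Fin n → ℝ) (r : ℝ) : 0 ≤ ballMoment q a r :=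
  integral_nonneg fun t => Real.rpow_nonneg (abs_nonneg t) r

theorem momentNorm_eq {Ω : Type*} [MeasurableSpace Ω] {q : ℝ≥0∞} (hq : 2 ≤ q) {n : ℕ}
    {P : Measure Ω} {X : Ω → Fin n → ℝ} (hX : IsUniformOnBall q n P X) (a : Fin n → ℝ) (r : ℝ) :
    momentNorm P r (fun ω => ∑ i, a i * X ω i) = ballMoment q a r ^ (1 / r) := by
  have hXm := pdf.IsUniform.aemeasurable (volume_unitBall_ne hq n).1 (volume_unitBall_ne hq n).2 hX
  have hm : Measurable fun x : Fin n → ℝ => |∑ i, a i * x i| ^ r := by fun_prop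
  rw [momentNorm, ballMoment, ballLaw, integral_map (measurable_linear a).aemeasurable
    (measurable_abs_rpow r).aestronglyMeasurable, ← show P.map X = _ from hX,
    integral_map hXm hm.aestronglyMeasurable]

/-- The bounds quantify over sample spaces in `Type u`; a lifted copy of `Fin n → ℝ` shows that the
quantifier is not vacuous there, so the bounds concern the law alone. -/
theorem exists_isUniformOnBall {q : ℝ≥0∞} (hq : 2 ≤ q) (n : ℕ) :
    ∃ (Ω : Type u) (_ : MeasurableSpace Ω) (P : Measure Ω) (_ : IsProbabilityMeasure P)
      (X : Ω → Fin n → ℝ), IsUniformOnBall q n P X := by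
  have := isProbabilityMeasure_cond_unitBall hq n
  refine ⟨ULift.{u} (Fin n → ℝ), inferInstance, (cond volume (unitBall q n)).map ULift.up,
    Measure.isProbabilityMeasure_map measurable_up.aemeasurable, ULift.down, ?_⟩
  change Measure.map ULift.down _ = _
  rw [Measure.map_map measurable_down measurable_up]
  exact Measure.map_id

theorem isLowerBound_iff {q : ℝ≥0∞} (hq : 2 ≤ q) {p A : ℝ} :
    IsLowerBound.{u} q p A ↔ ∀ n : ℕ, 1 ≤ n → ∀ a : Fin n → ℝ,
      A * ballMoment q a 2 ^ (1 / 2 : ℝ) ≤ ballMoment q a p ^ (1 / p) := by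
  constructor
  · intro h n hn a
    obtain ⟨Ω, _, P, _, X, hX⟩ := exists_isUniformOnBall.{u} hq n
    rw [← momentNorm_eq hq hX, ← momentNorm_eq hq hX]
    exact h n hn Ω P X hX a
  · intro h n hn Ω _ P _ X hX a
    rw [momentNorm_eq hq hX, momentNorm_eq hq hX]
    exact h n hn a

theorem isUpperBound_iff {q : ℝ≥0∞} (hq : 2 ≤ q) {p B : ℝ} :
    IsUpperBound.{u} q p B ↔ ∀ n : ℕ, 1 ≤ n → ∀ a : Fin n → ℝ,
      ballMoment q a p ^ (1 / p) ≤ B * ballMoment q a 2 ^ (1 / 2 : ℝ) := by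
  constructor
  · intro h n hn a
    obtain ⟨Ω, _, P, _, X, hX⟩ := exists_isUniformOnBall.{u} hq n
    rw [← momentNorm_eq hq hX, ← momentNorm_eq hq hX]
    exact h n hn Ω P X hX a
  · intro h n hn Ω _ P _ X hX a
    rw [momentNorm_eq hq hX, momentNorm_eq hq hX]
    exact h n hn a

theorem ballMoment_edge_le {q : ℝ≥0∞} (hq : 2 ≤ q) {p : ℝ} (hp : 1 ≤ p) {n : ℕ}
    (a : Fin n → ℝ) :
    (p - 2) * (3 * ballMoment q a 2) ^ (p / 2) ≤ (p - 2) * ((p + 1) * ballMoment q a p) := by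
  have := isProbabilityMeasure_ballLaw hq a
  have h := IsUnimodal.moment_le (κ := ballLaw q a) hp (isUnimodal_linear (measurableSet_unitBall q n)
    (convex_unitBall hq n) (fun x hx => neg_mem_unitBall hx)
    (fun x hx i => abs_le_one_of_mem_unitBall hq hx i) (volume_unitBall_ne hq n).1
    (volume_unitBall_ne hq n).2 a (by positivity : 0 ≤ max p 2))
  simpa [ballMoment] using h

theorem IsBallModel.mul_ballMoment_two {q : ℝ≥0∞} {v : ℝ≥0} {w : ℝ → ℝ} {m : ℕ → ℝ → ℝ}
    (h : IsBallModel q v w m) {n : ℕ} (a : Fin n → ℝ) :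
    m n 2 * ballMoment q a 2 = v * ∑ i, a i ^ 2 := by
  rw [ballMoment, ← h.moment n a 2 zero_le_two, ← integral_sq_sumLaw (h.density 2 zero_le_two) a]
  simp

theorem gammaConst_pos {p : ℝ} (hp : 0 < p) : 0 < gammaConst p := by
  have : 0 < Real.Gamma ((p + 1) / 2) := Real.Gamma_pos_of_pos (by linarith)
  rw [gammaConst]
  positivity

/-- Writing `M r` for the moments on the ball, and for `p ≥ 2`: `m p * M p ≤ γ^p * (m 2 * M 2) ^ (p
/ 2) ≤ γ^p * m p * M 2 ^ (p / 2)`, by the independent case and the ordering of the multipliers; then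
`m p` cancels. -/
theorem ballMoment_gamma_le {q : ℝ≥0∞} (hq : 2 ≤ q) {p : ℝ} (hp : 1 ≤ p) {n : ℕ}
    (a : Fin n → ℝ) :
    (p - 2) * ballMoment q a p ≤ (p - 2) * (gammaConst p ^ p * ballMoment q a 2 ^ (p / 2)) := by
  obtain ⟨v, w, m, h⟩ := exists_isBallModel hq
  have hp0 : 0 ≤ p := by linarith
  have h1 := sumLaw_moment_le hp (h.density p hp0) a
  have hmp := h.pos n p hp0
  have hm2 := (h.pos n 2 zero_le_two).le
  have hM := ballMoment_nonneg q a 2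
  have hg : 0 ≤ gammaConst p ^ p := Real.rpow_nonneg (gammaConst_pos (by linarith)).le _
  rw [h.moment n a p hp0, ← h.mul_ballMoment_two a, Real.mul_rpow hm2 hM, ← ballMoment] at h1
  have h2 := mul_le_mul_of_nonneg_right (h.le n p (by linarith))
    (mul_nonneg hg (Real.rpow_nonneg hM (p / 2)))
  refine le_of_mul_le_mul_left ?_ hmp
  linarith

/-! ### Dimension one and the values of the constants -/

theorem sumLaw_fin_one (μ : Measure ℝ) [IsProbabilityMeasure μ] :
    sumLaw μ (fun _ : Fin 1 => (1 : ℝ)) = μ := by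
  refine Measure.ext_of_charFun ?_
  ext t
  simp [charFun_sumLaw]

theorem unitBall_one {q : ℝ≥0∞} (hq : 2 ≤ q) : unitBall q 1 = unitBall ∞ 1 := by
  by_cases h : q = ∞
  · rw [h]
  · have hpos : 0 < q.toReal := by linarith [two_le_toReal hq h]
    ext x
    rw [unitBall_top, unitBall_of_ne_top h]
    simpa using Real.rpow_le_rpow_iff (abs_nonneg (x 0)) zero_le_one hpos

theorem ballMoment_fin_one {q : ℝ≥0∞} (hq : 2 ≤ q) {r : ℝ} (hr : 0 ≤ r) :
    ballMoment q (fun _ : Fin 1 => (1 : ℝ)) r = 1 / (r + 1) := by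
  have hc := isSubGaussianDensity_cubeDensity hr
  have := hc.isProbabilityMeasure
  have h := isBallModel_top.moment 1 (fun _ : Fin 1 => (1 : ℝ)) r hr
  have h2 := integral_abs_rpow_symm hr zero_le_one
  rw [sumLaw_fin_one, integral_densityLaw hc.nonneg hc.meas, integral_cubeDensity_mul, one_mul] at h
  rw [ballMoment, ballLaw, unitBall_one hq, ← ballLaw, ← h]
  rw [Real.one_rpow] at h2
  field_simp
  linarith

theorem edgeConst_pos {p : ℝ} (hp : 0 < p) : 0 < edgeConst p := by
  rw [edgeConst]
  positivity

theorem gammaConst_two : gammaConst 2 = 1 := by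
  have h : Real.Gamma ((2 + 1) / 2) = √Real.pi / 2 := by
    rw [show ((2 : ℝ) + 1) / 2 = 1 / 2 + 1 by norm_num, Real.Gamma_add_one (by norm_num),
      Real.Gamma_one_half_eq]
    ring
  have hpi : √Real.pi ≠ 0 := (Real.sqrt_pos.2 Real.pi_pos).ne'
  rw [gammaConst, h, div_right_comm, div_self hpi, ← Real.sqrt_eq_rpow, ← Real.sqrt_mul zero_le_two]
  norm_num

theorem edgeConst_two : edgeConst 2 = 1 := by
  rw [edgeConst, show (2 : ℝ) + 1 = 3 by norm_num, div_self (by positivity)]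

theorem edgeConst_rpow {p : ℝ} (hp : 0 < p) : edgeConst p ^ p = 3 ^ (p / 2) / (p + 1) := by
  rw [edgeConst, Real.div_rpow (by positivity) (by positivity), ← Real.rpow_mul (by norm_num),
    ← Real.rpow_mul (by linarith), one_div_mul_cancel hp.ne', Real.rpow_one, one_div_mul_eq_div]

theorem mul_rpow_half_rpow {c x p : ℝ} (hc : 0 ≤ c) (hx : 0 ≤ x) :
    (c * x ^ (1 / 2 : ℝ)) ^ p = c ^ p * x ^ (p / 2) := by
  rw [Real.mul_rpow hc (Real.rpow_nonneg hx _), ← Real.rpow_mul hx, one_div_mul_eq_div]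

theorem mul_rpow_half_le_iff {c x y p : ℝ} (hc : 0 ≤ c) (hx : 0 ≤ x) (hy : 0 ≤ y) (hp : 0 < p) :
    c * x ^ (1 / 2 : ℝ) ≤ y ^ (1 / p) ↔ c ^ p * x ^ (p / 2) ≤ y := by
  rw [← Real.rpow_le_rpow_iff (by positivity) (by positivity) hp, mul_rpow_half_rpow hc hx,
    ← Real.rpow_mul hy, one_div_mul_cancel hp.ne', Real.rpow_one]

theorem le_mul_rpow_half_iff {c x y p : ℝ} (hc : 0 ≤ c) (hx : 0 ≤ x) (hy : 0 ≤ y) (hp : 0 < p) :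
    y ^ (1 / p) ≤ c * x ^ (1 / 2 : ℝ) ↔ y ≤ c ^ p * x ^ (p / 2) := by
  rw [← Real.rpow_le_rpow_iff (by positivity) (by positivity) hp, mul_rpow_half_rpow hc hx,
    ← Real.rpow_mul hy, one_div_mul_cancel hp.ne', Real.rpow_one]

theorem edgeConst_mul_ballMoment_le {q : ℝ≥0∞} (hq : 2 ≤ q) {p : ℝ} (hp : 1 ≤ p) {n : ℕ}
    (a : Fin n → ℝ) :
    (p - 2) * (edgeConst p ^ p * ballMoment q a 2 ^ (p / 2)) ≤ (p - 2) * ballMoment q a p := by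
  have h := ballMoment_edge_le hq hp a
  have hp1 : 0 < p + 1 := by linarith
  rw [Real.mul_rpow (by norm_num) (ballMoment_nonneg q a 2)] at h
  rw [edgeConst_rpow (by linarith)]
  refine le_of_mul_le_mul_left ?_ hp1
  calc _ = (p - 2) * (3 ^ (p / 2) * ballMoment q a 2 ^ (p / 2)) := by field_simp
    _ ≤ _ := h
    _ = _ := by ring

theorem isLowerBound_lowerConst {q : ℝ≥0∞} (hq : 2 ≤ q) {p : ℝ} (hp : 1 ≤ p) :
    IsLowerBound.{u} q p (lowerConst p) := by
  refine (isLowerBound_iff hq).2 fun n _ a => ?_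
  have hp0 : 0 < p := by linarith
  have h2 := ballMoment_nonneg q a 2
  have hpn := ballMoment_nonneg q a p
  rw [lowerConst]
  split_ifs with h
  · rw [mul_rpow_half_le_iff (gammaConst_pos hp0).le h2 hpn hp0]
    -- Cancelling the negative factor `p - 2` reverses the inequality, which is why the two
    -- constants change roles at `p = 2`.
    exact (mul_le_mul_left_of_neg (by linarith : p - 2 < 0)).1 (ballMoment_gamma_le hq hp a)
  · rcases (not_lt.1 h).eq_or_lt with rfl | h'
    · rw [edgeConst_two, one_mul]
    · rw [mul_rpow_half_le_iff (edgeConst_pos hp0).le h2 hpn hp0]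
      exact le_of_mul_le_mul_left (edgeConst_mul_ballMoment_le hq hp a) (by linarith)

theorem isUpperBound_upperConst {q : ℝ≥0∞} (hq : 2 ≤ q) {p : ℝ} (hp : 1 ≤ p) :
    IsUpperBound.{u} q p (upperConst p) := by
  refine (isUpperBound_iff hq).2 fun n _ a => ?_
  have hp0 : 0 < p := by linarith
  have h2 := ballMoment_nonneg q a 2
  have hpn := ballMoment_nonneg q a p
  rw [upperConst]
  split_ifs with h
  · rw [le_mul_rpow_half_iff (edgeConst_pos hp0).le h2 hpn hp0]
    exact (mul_le_mul_left_of_neg (by linarith : p - 2 < 0)).1 (edgeConst_mul_ballMoment_le hq hp a)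
  · rcases (not_lt.1 h).eq_or_lt with rfl | h'
    · rw [gammaConst_two, one_mul]
    · rw [le_mul_rpow_half_iff (gammaConst_pos hp0).le h2 hpn hp0]
      exact le_of_mul_le_mul_left (ballMoment_gamma_le hq hp a) (by linarith)

/-! ### Sharpness -/

theorem ballMoment_fin_one_ratio {q : ℝ≥0∞} (hq : 2 ≤ q) {p : ℝ} (hp : 0 < p) :
    ballMoment q (fun _ : Fin 1 => (1 : ℝ)) p ^ (1 / p)
      = edgeConst p * ballMoment q (fun _ : Fin 1 => (1 : ℝ)) 2 ^ (1 / 2 : ℝ) := by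
  rw [ballMoment_fin_one hq hp.le, ballMoment_fin_one hq zero_le_two, edgeConst,
    Real.div_rpow zero_le_one (by linarith), Real.div_rpow zero_le_one (by norm_num),
    Real.one_rpow, Real.one_rpow, show (2 : ℝ) + 1 = 3 by norm_num]
  field_simp

theorem ballMoment_fin_one_rpow_pos {q : ℝ≥0∞} (hq : 2 ≤ q) :
    0 < ballMoment q (fun _ : Fin 1 => (1 : ℝ)) 2 ^ (1 / 2 : ℝ) := by
  rw [ballMoment_fin_one hq zero_le_two]
  positivity

theorem IsBallModel.ballMoment_two_pos {q : ℝ≥0∞} {v : ℝ≥0} {w : ℝ → ℝ} {m : ℕ → ℝ → ℝ}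
    (h : IsBallModel q v w m) {n : ℕ} (hn : 1 ≤ n) :
    0 < ballMoment q (fun _ : Fin n => (√(n : ℝ))⁻¹) 2 := by
  have hv : 0 < (v : ℝ) := NNReal.coe_pos.2 (pos_iff_ne_zero.2 (h.density 0 le_rfl).var_ne_zero)
  have h1 := h.mul_ballMoment_two fun _ : Fin n => (√(n : ℝ))⁻¹
  have hn' : (n : ℝ) ≠ 0 := by positivity
  refine (pos_iff_pos_of_mul_pos ?_).1 (h.pos n 2 zero_le_two)
  rw [h1]
  simpa [hn'] using hv

/-- The moments of the product law converge to the Gaussian ones, and the correction `m n p / m n 2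
^ (p / 2)` tends to 1; the variance is eliminated through `v = m n 2 * M 2`, with `M 2` the second
moment on the ball. -/
theorem tendsto_ballMoment_ratio {q : ℝ≥0∞} (hq : 2 ≤ q) {p : ℝ} (hp : 1 ≤ p) (hp2 : p ≠ 2) :
    Tendsto (fun n : ℕ => ballMoment q (fun _ : Fin n => (√(n : ℝ))⁻¹) p ^ (1 / p)
      / ballMoment q (fun _ : Fin n => (√(n : ℝ))⁻¹) 2 ^ (1 / 2 : ℝ)) atTop (𝓝 (gammaConst p)) := by
  obtain ⟨v, w, m, h⟩ := exists_isBallModel hq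
  have hp0 : 0 < p := by linarith
  have hv : 0 < (v : ℝ) := NNReal.coe_pos.2 (pos_iff_ne_zero.2 (h.density 0 le_rfl).var_ne_zero)
  have hvp : 0 < (v : ℝ) ^ (p / 2) := Real.rpow_pos_of_pos hv _
  have hg := gammaConst_pos hp0
  have h1 := (((tendsto_integral_abs_rpow_sumLaw hp hp2 h.density).div_const
    ((v : ℝ) ^ (p / 2))).div (h.tendsto p hp0) one_ne_zero).rpow_const
      (Or.inr (by positivity : 0 ≤ 1 / p))
  rw [mul_div_cancel_left₀ _ hvp.ne', div_one, ← Real.rpow_mul hg.le, mul_one_div_cancel hp0.ne',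
    Real.rpow_one] at h1
  refine h1.congr' ?_
  filter_upwards [eventually_ge_atTop 1] with n hn
  set a : Fin n → ℝ := fun _ => (√(n : ℝ))⁻¹ with ha
  have hn' : (n : ℝ) ≠ 0 := by positivity
  have hmp := h.pos n p hp0.le
  have hm2 := h.pos n 2 zero_le_two
  have hM2 : 0 < ballMoment q a 2 := h.ballMoment_two_pos hn
  have hMp := ballMoment_nonneg q a p
  have e1 : (v : ℝ) = m n 2 * ballMoment q a 2 := by
    rw [h.mul_ballMoment_two a]
    simp [ha, hn']
  have e2 : ballMoment q a 2 ^ (1 / 2 : ℝ) = (ballMoment q a 2 ^ (p / 2)) ^ (1 / p) := by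
    rw [← Real.rpow_mul hM2.le]
    congr 1
    field_simp
  have hm2p : 0 < m n 2 ^ (p / 2) := Real.rpow_pos_of_pos hm2 _
  have hM2p : 0 < ballMoment q a 2 ^ (p / 2) := Real.rpow_pos_of_pos hM2 _
  simp only [Pi.div_apply]
  rw [h.moment n a p hp0.le, ← ballMoment, e2, ← Real.div_rpow hMp hM2p.le, e1,
    Real.mul_rpow hm2.le hM2.le]
  congr 1
  field_simp

theorem IsLowerBound.le_lowerConst {q : ℝ≥0∞} (hq : 2 ≤ q) {p : ℝ} (hp : 1 ≤ p) {A : ℝ}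
    (hA : IsLowerBound.{u} q p A) : A ≤ lowerConst p := by
  rw [isLowerBound_iff hq] at hA
  rw [lowerConst]
  split_ifs with h
  -- The Gaussian constant is approached by equal coefficients as `n → ∞`; the other one is attained
  -- in dimension one.
  · refine ge_of_tendsto (tendsto_ballMoment_ratio hq hp h.ne) ?_
    obtain ⟨v, w, m, hm⟩ := exists_isBallModel hq
    filter_upwards [eventually_ge_atTop 1] with n hn
    rw [le_div_iff₀ (Real.rpow_pos_of_pos (hm.ballMoment_two_pos hn) _)]
    exact hA n hn _
  · have := hA 1 le_rfl fun _ => 1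
    rw [ballMoment_fin_one_ratio hq (by linarith : 0 < p)] at this
    exact le_of_mul_le_mul_right this (ballMoment_fin_one_rpow_pos hq)

theorem IsUpperBound.upperConst_le {q : ℝ≥0∞} (hq : 2 ≤ q) {p : ℝ} (hp : 1 ≤ p) {B : ℝ}
    (hB : IsUpperBound.{u} q p B) : upperConst p ≤ B := by
  rw [isUpperBound_iff hq] at hB
  have hedge : edgeConst p ≤ B := by
    have := hB 1 le_rfl fun _ => 1
    rw [ballMoment_fin_one_ratio hq (by linarith : 0 < p)] at this
    exact le_of_mul_le_mul_right this (ballMoment_fin_one_rpow_pos hq)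
  rw [upperConst]
  split_ifs with h
  · exact hedge
  -- The limit is available only for `p ≠ 2`; at `p = 2` both constants are 1 and dimension one
  -- suffices.
  · by_cases h2 : p = 2
    · subst h2
      rwa [gammaConst_two, ← edgeConst_two]
    · refine le_of_tendsto (tendsto_ballMoment_ratio hq hp h2) ?_
      obtain ⟨v, w, m, hm⟩ := exists_isBallModel hq
      filter_upwards [eventually_ge_atTop 1] with n hn
      rw [div_le_iff₀ (Real.rpow_pos_of_pos (hm.ballMoment_two_pos hn) _)]
      exact hB n hn _

end Khintchine

theorem mainTheorem5 (q : ℝ≥0∞) (hq : 2 ≤ q) (p : ℝ) (hp : 1 ≤ p) :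
    IsGreatest {A : ℝ | Khintchine.IsLowerBound.{u} q p A} (Khintchine.lowerConst p) ∧
      IsLeast {B : ℝ | Khintchine.IsUpperBound.{u} q p B} (Khintchine.upperConst p) :=
  ⟨⟨Khintchine.isLowerBound_lowerConst hq hp, fun _ hA => hA.le_lowerConst hq hp⟩,
    ⟨Khintchine.isUpperBound_upperConst hq hp, fun _ hB => hB.upperConst_le hq hp⟩⟩
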